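/- **Conventions.** For unbounded operators on a Hilbert space $\mathcal H$, products and commutators carry their natural domains. For a closed densely defined $\mathcal D$ put $$\langle\mathcal D\rangle^2=\tfrac12(\mathcal D\mathcal D^*+\mathcal D^*\mathcal D)\ \text{ on }\ \mathrm{dom}\,\mathcal D\mathcal D^*\cap\mathrm{dom}\,\mathcal D^*\mathcal D,\qquad \mathcal R_{\mathcal D}=\tfrac i2(\mathcal D^2-\mathcal D^{*2}).$$ When $\langle\mathcal D\rangle^2$ is essentially self-adjoint, the same symbol denotes its closure. Put $\Lambda=(1+\langle\mathcal D\rangle^2)^{1/2}$, $\mathcal H_l=\mathrm{dom}\,\Lambda^l$, $\mathcal H_\infty=\bigcap_l\mathcal H_l$ and $\delta(T)=[\Lambda,T]$. For an operator $T$ on $\mathcal H_\infty$, a statement that $\delta^k(T)$ or $T$ is bounded, or lies in a space of bounded operators, refers to its bounded extension from $\mathcal H_\infty$. Let $\mathrm{OP}^0$ be the set of bounded $T$ with $T\mathcal H_\infty\subset\mathcal H_\infty$ and $\delta^k(T)$ bounded for all $k$, and let $\mathrm{OP}^r=\Lambda^r\,\mathrm{OP}^0$. For $p\ge1$ and $s>p$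 let $\varphi_s(T)=\mathrm{Trace}(\Lambda^{-s/2}T\Lambda^{-s/2})$ for $0\le T\in\mathcal B(\mathcal H)$, and let $$\mathcal B_2(p)=\{T\in\mathcal B(\mathcal H):\varphi_s(T^*T)<\infty,\ \varphi_s(TT^*)<\infty\ \ \forall s>p\},$$ $$\mathcal Q_n(T)=\big(\|T\|^2+\varphi_{p+1/n}(T^*T)+\varphi_{p+1/n}(TT^*)\big)^{1/2},\quad n\ge1.$$ On the linear span $\mathcal B_2(p)^2$ of the products of two elements of $\mathcal B_2(p)$ let $$\mathcal P_n(T)=\inf\sum_i\mathcal Q_n(T_{1,i})\mathcal Q_n(T_{2,i}),$$ the infimum being over all finite representations $T=\sum_iT_{1,i}T_{2,i}$ with $T_{1,i},T_{2,i}\in\mathcal B_2(p)$. Let $\mathcal B_1(p)\subset\mathcal B(\mathcal H)$ be the completion of $\mathcal B_2(p)^2$ for the norms $\mathcal P_n$, $n\ge1$; each $\mathcal P_n$ dominates the operator norm, so the completion is realised by operator norm limits of sequences that are Cauchy for all the $\mathcal P_n$. Let $\mathcal B_1^\infty(p)$ be the set of $T\in\mathcal B(\mathcal H)$ with $T\mathcal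 H_l\subset\mathcal H_l$ and $\delta^l(T)\in\mathcal B_1(p)$ for all $l\ge0$. **Pseudo-Riemannian spectral triples.** Let $\mathcal A$ be a $*$-algebra represented on $\mathcal H$ by bounded operators, and $\mathcal D$ a closed densely defined operator on $\mathcal H$. Then $(\mathcal A,\mathcal H,\mathcal D)$ is a *pseudo-Riemannian spectral triple* if 1. $\mathrm{dom}\,\mathcal D^*\mathcal D\cap\mathrm{dom}\,\mathcal D\mathcal D^*$ is dense, and $\langle\mathcal D\rangle^2$ is essentially self-adjoint on it; 2. $\mathcal R_{\mathcal D}\mathcal H_\infty\subset\mathcal H_\infty$, $[\langle\mathcal D\rangle^2,\mathcal R_{\mathcal D}]\in\mathrm{OP}^2$, and $a\mathcal R_{\mathcal D}(1+\langle\mathcal D\rangle^2)^{-1}$ is (everywhere defined and) compact for all $a\in\mathcal A$; 3. each $a\in\mathcal A$ preserves $\mathrm{dom}\,\mathcal D$ and $\mathrm{dom}\,\mathcal D^*$, and $[\mathcal D,a]$, $[\mathcal D^*,a]$ extend to bounded operators; 4. $a(1+\langle\mathcal D\rangle^2)^{-1/2}$ is compact for all $a\in\mathcal A$. It is *finitely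 summable with spectral dimension $p$* if there is an $s>0$ such that $a(1+\langle\mathcal D\rangle^2)^{-s/2}$ is trace class for all $a\in\mathcal A$, and $$p=\inf\{s>0:\ |a|(1+\langle\mathcal D\rangle^2)^{-s/2}\text{ is trace class for all }a\in\mathcal A\}.$$ Put $S^0=\mathcal A\cup[\mathcal D,\mathcal A]\cup[\mathcal D^*,\mathcal A]$ and $S^n=[\langle\mathcal D\rangle^2,S^{n-1}]\cup[\mathcal R_{\mathcal D},S^{n-1}]$ for $n\ge1$. The triple is *smoothly summable with spectral dimension $p$* if it is finitely summable with spectral dimension $p$ and, as operators on $\mathcal H_\infty$, $S^n\subset\mathcal B_1^\infty(p)\,(1+\langle\mathcal D\rangle^2)^{n/2}$ for all $n\ge0$. **Proposition.** Let $C_1^\infty(\mathbb R)$ be the $*$-algebra of smooth functions $f:\mathbb R\to\mathbb C$ such that $f^{(k)}\in L^1(\mathbb R)$ for all $k\ge0$, acting on $L^2(\mathbb R)$ by multiplication, and let $\mathcal D=\frac{d}{dx}+x$ be the closure in $L^2(\mathbb R)$ of the operator $\varphi\mapsto\varphi'+x\varphi$ on Schwartz functions. Then $(C_1^\infty(\mathbb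 R),L^2(\mathbb R),\mathcal D)$ is a pseudo-Riemannian spectral triple, and it is smoothly summable with spectral dimension $1$. -/

import Mathlib

open MeasureTheory SchwartzMap
open scoped ENNReal ContDiff

noncomputable section

namespace PRST

section General

variable {H : Type*} [NormedAddCommGroup H] [InnerProductSpace ℂ H] [CompleteSpace H]

/-! ### Unbounded operators: composition, commutators -/

/-- A bounded operator, seen as an everywhere defined unbounded operator. -/
def ofBdd (T : H →L[ℂ] H) : H →ₗ.[ℂ] H :=
  (T : H →ₗ[ℂ] H).toPMap ⊤

/-- The product `S T` of two unbounded operators, with its natural domain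
`{x ∈ dom T | T x ∈ dom S}`. -/
def pcomp (S T : H →ₗ.[ℂ] H) : H →ₗ.[ℂ] H where
  domain :=
    { carrier := {x | ∃ h : x ∈ T.domain, T ⟨x, h⟩ ∈ S.domain}
      zero_mem' := ⟨T.domain.zero_mem, by
        have h : T ⟨0, T.domain.zero_mem⟩ = 0 := T.map_zero
        rw [h]; exact S.domain.zero_mem⟩
      add_mem' := by
        rintro x y ⟨hx, hx'⟩ ⟨hy, hy'⟩
        refine ⟨T.domain.add_mem hx hy, ?_⟩
        have h : T ⟨x + y, T.domain.add_mem hx hy⟩ = T ⟨x, hx⟩ + T ⟨y, hy⟩ :=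
          T.map_add ⟨x, hx⟩ ⟨y, hy⟩
        rw [h]; exact S.domain.add_mem hx' hy'
      smul_mem' := by
        rintro c x ⟨hx, hx'⟩
        refine ⟨T.domain.smul_mem c hx, ?_⟩
        have h : T ⟨c • x, T.domain.smul_mem c hx⟩ = c • T ⟨x, hx⟩ := T.map_smul c ⟨x, hx⟩
        rw [h]; exact S.domain.smul_mem c hx' }
  toFun :=
    { toFun := fun x => S ⟨T ⟨x, x.2.fst⟩, x.2.snd⟩
      map_add' := by
        rintro ⟨x, hx, hx'⟩ ⟨y, hy, hy'⟩
        rw [← S.map_add]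
        congr 1
        exact Subtype.ext (T.map_add ⟨x, hx⟩ ⟨y, hy⟩)
      map_smul' := by
        rintro c ⟨x, hx, hx'⟩
        rw [RingHom.id_apply, ← S.map_smul]
        congr 1
        exact Subtype.ext (T.map_smul c ⟨x, hx⟩) }

/-- The commutator `[S, T] = S T - T S`, with its natural domain. -/
def comm (S T : H →ₗ.[ℂ] H) : H →ₗ.[ℂ] H :=
  pcomp S T - pcomp T S

/-- The unbounded operator `P` is defined on the whole of the subspace `E` and coincides there
with the bounded operator `S`. -/
def AgreesOn (P : H →ₗ.[ℂ] H) (E : Submodule ℂ H) (S : H →L[ℂ] H) : Prop :=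
  ∀ x ∈ E, ∃ h : x ∈ P.domain, P ⟨x, h⟩ = S x

/-- Essential self-adjointness: densely defined, closable, with self-adjoint closure. -/
def IsEssentiallySelfAdjoint (P : H →ₗ.[ℂ] H) : Prop :=
  Dense (P.domain : Set H) ∧ P.IsClosable ∧ IsSelfAdjoint P.closure

/-- `⟨D⟩² = (D D* + D* D) / 2` on `dom D* D ∩ dom D D*`. -/
def preAngleSq (D : H →ₗ.[ℂ] H) : H →ₗ.[ℂ] H :=
  (1 / 2 : ℂ) • (pcomp D D.adjoint + pcomp D.adjoint D)

/-- The closure of `⟨D⟩²`; it is self-adjoint when `⟨D⟩²` is essentially self-adjoint. -/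
def angleSq (D : H →ₗ.[ℂ] H) : H →ₗ.[ℂ] H :=
  (preAngleSq D).closure

/-- `R_D = (i / 2) (D² - D*²)`. -/
def remainder (D : H →ₗ.[ℂ] H) : H →ₗ.[ℂ] H :=
  (Complex.I / 2) • (pcomp D D - pcomp D.adjoint D.adjoint)

/-! ### Functional calculus of a positive self-adjoint operator `N`

Below `N` stands for the positive self-adjoint operator `𝒟²` or `⟨𝒟⟩²` with respect to which
smoothness and summability are measured; all notions depend only on `1 + N`. -/

/-- `B` is the bounded two-sided inverse of `1 + N : dom N → H`. -/
def IsInvOnePlus (N : H →ₗ.[ℂ] H) (B : H →L[ℂ] H) : Prop :=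
  (∀ x, ∃ h : B x ∈ N.domain, B x + N ⟨B x, h⟩ = x) ∧ ∀ y : N.domain, B ((y : H) + N y) = y

open Classical in
/-- `(1 + N)⁻¹` as a bounded operator (zero if `1 + N` has no bounded inverse). -/
def invOnePlus (N : H →ₗ.[ℂ] H) : H →L[ℂ] H :=
  if h : ∃ B, IsInvOnePlus N B then h.choose else 0

/-- The bounded operator `(1 + N)^(-s/2)`, for real `s ≥ 0`. -/
def negPow (N : H →ₗ.[ℂ] H) (s : ℝ) : H →L[ℂ] H :=
  (invOnePlus N) ^ (s / 2)

/-- The unbounded operator `(1 + N)^(s/2)`, for real `s ≥ 0`: the inverse of `(1 + N)^(-s/2)`,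
with domain the range of the latter. -/
def posPow (N : H →ₗ.[ℂ] H) (s : ℝ) : H →ₗ.[ℂ] H :=
  (ofBdd (negPow N s)).inverse

/-- The Sobolev space `H_l = dom (1 + N)^(l/2)`. -/
def sobolev (N : H →ₗ.[ℂ] H) (l : ℕ) : Submodule ℂ H :=
  (posPow N l).domain

/-- `H_∞`, the intersection of all the `H_l`. -/
def smoothVectors (N : H →ₗ.[ℂ] H) : Submodule ℂ H :=
  ⨅ l : ℕ, sobolev N l

/-! ### Traces -/

/-- The trace, with values in `[0, ∞]`, of a positive bounded operator: the supremum of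
`∑ ⟪eᵢ, T eᵢ⟫` over all finite orthonormal families, which for `T ≥ 0` equals the sum over any
orthonormal basis. -/
def posTrace (T : H →L[ℂ] H) : ℝ≥0∞ :=
  ⨆ (n : ℕ) (e : Fin n → H) (_ : Orthonormal ℂ e),
    ∑ i, ENNReal.ofReal (inner ℂ (e i) (T (e i))).re

/-- `T` is trace class: `Trace |T| < ∞` with `|T| = (T* T)^(1/2)`. -/
def IsTraceClass (T : H →L[ℂ] H) : Prop :=
  posTrace (CFC.abs T) < ⊤

/-! ### Square integrable and integrable operators -/

/-- The weight `φ_s(T) = Trace ((1 + N)^(-s/4) T (1 + N)^(-s/4))`, for `T ≥ 0`. -/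
def weight (N : H →ₗ.[ℂ] H) (s : ℝ) (T : H →L[ℂ] H) : ℝ≥0∞ :=
  posTrace (negPow N (s / 2) * T * negPow N (s / 2))

/-- The space `B₂(N, p)`: the `T` such that `φ_s(T* T)` and `φ_s(T T*)` are finite for every
`s > p`. -/
def B2 (N : H →ₗ.[ℂ] H) (p : ℝ) : Set (H →L[ℂ] H) :=
  {T | ∀ s, p < s → weight N s (star T * T) < ⊤ ∧ weight N s (T * star T) < ⊤}

/-- The norm `Q` on `B₂(N, p)` with parameter `s`; the norms of the topology are those for
`s = p + 1/n`, `n ≥ 1`. -/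
def normQ (N : H →ₗ.[ℂ] H) (s : ℝ) (T : H →L[ℂ] H) : ℝ :=
  Real.sqrt (‖T‖ ^ 2 + (weight N s (star T * T)).toReal + (weight N s (T * star T)).toReal)

/-- `B₂(N, p)²`: the linear span of the products of two elements of `B₂(N, p)`. -/
def B2sq (N : H →ₗ.[ℂ] H) (p : ℝ) : Submodule ℂ (H →L[ℂ] H) :=
  Submodule.span ℂ {T | ∃ T₁ ∈ B2 N p, ∃ T₂ ∈ B2 N p, T = T₁ * T₂}

/-- The norm `P` on `B₂(N, p)²` with parameter `s`: the infimum of `∑ Q(T₁ᵢ) Q(T₂ᵢ)` over all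
finite representations `T = ∑ T₁ᵢ T₂ᵢ` with `T₁ᵢ, T₂ᵢ ∈ B₂(N, p)`. -/
def normP (N : H →ₗ.[ℂ] H) (p s : ℝ) (T : H →L[ℂ] H) : ℝ :=
  sInf {r | ∃ (k : ℕ) (T₁ T₂ : Fin k → (H →L[ℂ] H)),
    (∀ i, T₁ i ∈ B2 N p) ∧ (∀ i, T₂ i ∈ B2 N p) ∧ T = ∑ i, T₁ i * T₂ i ∧
    r = ∑ i, normQ N s (T₁ i) * normQ N s (T₂ i)}

/-- `B₁(N, p)`, the completion of `B₂(N, p)²` for the norms `P_n` (`s = p + 1/n`, `n ≥ 1`), seen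
inside the bounded operators. As `P_n` dominates the operator norm, a sequence which is Cauchy for
all the `P_n` has a limit in operator norm; `B₁(N, p)` consists of these limits. -/
def B1 (N : H →ₗ.[ℂ] H) (p : ℝ) : Set (H →L[ℂ] H) :=
  {T | ∃ u : ℕ → (H →L[ℂ] H), (∀ k, u k ∈ B2sq N p) ∧
    (∀ n : ℕ, 1 ≤ n → ∀ ε > 0, ∃ K, ∀ k ≥ K, ∀ l ≥ K,
      normP N p (p + 1 / n) (u k - u l) < ε) ∧
    Filter.Tendsto u Filter.atTop (nhds T)}

/-! ### Smoothness -/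

/-- `S = δᵏ(T)`, where `δ(T)` is the bounded extension of `[(1 + N)^(1/2), T]` from `H_∞`. -/
def IsDeltaIter (N : H →ₗ.[ℂ] H) : ℕ → (H →L[ℂ] H) → (H →L[ℂ] H) → Prop
  | 0, T, S => S = T
  | k + 1, T, S => ∃ T', IsDeltaIter N k T T' ∧
      AgreesOn (comm (posPow N 1) (ofBdd T')) (smoothVectors N) S

/-- `OP⁰(N)`: the bounded operators `T` preserving `H_∞` such that `δᵏ(T)` is bounded for
all `k`. -/
def OP0 (N : H →ₗ.[ℂ] H) : Set (H →L[ℂ] H) :=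
  {T | (∀ x ∈ smoothVectors N, T x ∈ smoothVectors N) ∧ ∀ k, ∃ S, IsDeltaIter N k T S}

/-- The regular pseudodifferential operators of order `r ≥ 0`, as operators on `H_∞`:
`OPʳ(N) = (1 + N)^(r/2) OP⁰(N)`. -/
def OP (N : H →ₗ.[ℂ] H) (r : ℝ) : Set (H →ₗ.[ℂ] H) :=
  {T | ∃ A ∈ OP0 N, ∀ x ∈ smoothVectors N, ∃ (h : x ∈ T.domain) (h' : A x ∈ (posPow N r).domain),
    T ⟨x, h⟩ = posPow N r ⟨A x, h'⟩}

/-- `B₁^∞(N, p)`: the bounded operators `T` which preserve every `H_l` and such that `δᵏ(T)`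
lies in `B₁(N, p)` for all `k`. -/
def B1smooth (N : H →ₗ.[ℂ] H) (p : ℝ) : Set (H →L[ℂ] H) :=
  {T | (∀ l : ℕ, ∀ x ∈ sobolev N l, T x ∈ sobolev N l) ∧
    ∀ k, ∃ S ∈ B1 N p, IsDeltaIter N k T S}

/-- `B₁^∞(N, p) (1 + N)^(r/2)`, for `r ≥ 0`, as a set of operators on `H_∞`. -/
def tameOP (N : H →ₗ.[ℂ] H) (p r : ℝ) : Set (H →ₗ.[ℂ] H) :=
  {T | ∃ A ∈ B1smooth N p,
    ∀ x ∈ smoothVectors N, ∃ (h : x ∈ T.domain) (h' : x ∈ (posPow N r).domain),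
      T ⟨x, h⟩ = A (posPow N r ⟨x, h'⟩)}

/-! ### Pseudo-Riemannian spectral triples -/

variable {A : Type*} [NonUnitalRing A] [StarRing A] [Module ℂ A] [IsScalarTower ℂ A A]
  [SMulCommClass ℂ A A] [StarModule ℂ A]

/-- `(A, H, D)` is a pseudo-Riemannian spectral triple; `π` is the representation of the
`*`-algebra `A` by bounded operators on `H`. -/
structure IsPseudoRiemannianTriple (π : A →⋆ₙₐ[ℂ] (H →L[ℂ] H)) (D : H →ₗ.[ℂ] H) : Prop where
  dense_domain : Dense (D.domain : Set H)
  isClosed : D.IsClosed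
  essentiallySelfAdjoint : IsEssentiallySelfAdjoint (preAngleSq D)
  remainder_mapsTo : ∀ x ∈ smoothVectors (angleSq D), ∃ h : x ∈ (remainder D).domain,
    remainder D ⟨x, h⟩ ∈ smoothVectors (angleSq D)
  comm_remainder : comm (angleSq D) (remainder D) ∈ OP (angleSq D) 2
  remainder_compact : ∀ a, ∃ K : H →L[ℂ] H, IsCompactOperator K ∧
    AgreesOn (pcomp (ofBdd (π a)) (pcomp (remainder D) (ofBdd (negPow (angleSq D) 2)))) ⊤ K
  comm_bounded : ∀ a, ∃ S, AgreesOn (comm D (ofBdd (π a))) D.domain S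
  comm_adjoint_bounded : ∀ a, ∃ S,
    AgreesOn (comm D.adjoint (ofBdd (π a))) D.adjoint.domain S
  resolvent_compact : ∀ a, IsCompactOperator (π a * negPow (angleSq D) 1)

/-- `(A, H, D)` is finitely summable with spectral dimension `p`. -/
def HasSpectralDimension (π : A →⋆ₙₐ[ℂ] (H →L[ℂ] H)) (D : H →ₗ.[ℂ] H) (p : ℝ) : Prop :=
  (∃ s : ℝ, 0 < s ∧ ∀ a, IsTraceClass (π a * negPow (angleSq D) s)) ∧
  IsGLB {s : ℝ | 0 < s ∧ ∀ a, IsTraceClass (CFC.abs (π a) * negPow (angleSq D) s)} p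

/-- The sets of operators `S⁰ = A ∪ [D, A] ∪ [D*, A]` and
`Sⁿ⁺¹ = [⟨D⟩², Sⁿ] ∪ [R_D, Sⁿ]`. -/
def iteratedCommutators (π : A →⋆ₙₐ[ℂ] (H →L[ℂ] H)) (D : H →ₗ.[ℂ] H) :
    ℕ → Set (H →ₗ.[ℂ] H)
  | 0 => {T | ∃ a, T = ofBdd (π a) ∨ T = comm D (ofBdd (π a)) ∨
      T = comm D.adjoint (ofBdd (π a))}
  | n + 1 => {T | ∃ T' ∈ iteratedCommutators π D n,
      T = comm (angleSq D) T' ∨ T = comm (remainder D) T'}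

/-- `(A, H, D)` is smoothly summable with spectral dimension `p`: it is finitely summable with
spectral dimension `p`, and `Sⁿ ⊆ B₁^∞(⟨D⟩, p) (1 + ⟨D⟩²)^(n/2)` for all `n`. -/
def IsSmoothlySummable (π : A →⋆ₙₐ[ℂ] (H →L[ℂ] H)) (D : H →ₗ.[ℂ] H) (p : ℝ) : Prop :=
  HasSpectralDimension π D p ∧
  ∀ n : ℕ, iteratedCommutators π D n ⊆ tameOP (angleSq D) p n

end General

/-! ### The harmonic oscillator -/

/-- The Hilbert space `L²(ℝ)`. -/
abbrev L2 : Type := Lp ℂ 2 (volume : Measure ℝ)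

/-- Smooth functions all of whose derivatives (of order `k ≥ 0`) are integrable. -/
def IsC1inf (f : ℝ → ℂ) : Prop :=
  ContDiff ℝ ∞ f ∧ ∀ k : ℕ, Integrable (iteratedDeriv k f)

theorem IsC1inf.bounded {f : ℝ → ℂ} (hf : IsC1inf f) (k : ℕ) :
    ∃ C : ℝ, ∀ x, ‖iteratedDeriv k f x‖ ≤ C := by
  have hd : ∀ x, HasDerivAt (iteratedDeriv k f) (iteratedDeriv (k + 1) f x) x := by
    intro x
    rw [iteratedDeriv_succ]
    exact ((hf.1.differentiable_iteratedDeriv k (by exact_mod_cast WithTop.coe_lt_top _)) x).hasDerivAt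
  refine ⟨‖iteratedDeriv k f 0‖ + ∫ t, ‖iteratedDeriv (k + 1) f t‖, fun x => ?_⟩
  have h := intervalIntegral.integral_eq_sub_of_hasDerivAt (a := 0) (b := x)
    (fun y _ => hd y) (hf.2 (k + 1)).intervalIntegrable
  have h1 : iteratedDeriv k f x
      = iteratedDeriv k f 0 + ∫ t in (0 : ℝ)..x, iteratedDeriv (k + 1) f t := by
    rw [h]; ring
  rw [h1]
  refine (norm_add_le _ _).trans (add_le_add le_rfl ?_)
  refine intervalIntegral.norm_integral_le_integral_norm_uIoc.trans ?_
  exact setIntegral_le_integral (hf.2 (k + 1)).norm (Filter.Eventually.of_forall fun _ => norm_nonneg _)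

/-- The `*`-algebra `C₁^∞(ℝ)`, with pointwise operations and complex conjugation. -/
def C1inf : NonUnitalStarSubalgebra ℂ (ℝ → ℂ) where
  carrier := {f | IsC1inf f}
  zero_mem' := by
    refine ⟨contDiff_const, fun k => ?_⟩
    have : iteratedDeriv k (0 : ℝ → ℂ) = 0 := by
      induction k with
      | zero => simp
      | succ k ih => rw [iteratedDeriv_succ, ih]; ext x; simp
    rw [this]; exact integrable_zero _ _ _
  add_mem' := by
    rintro f g ⟨hf, hf'⟩ ⟨hg, hg'⟩
    refine ⟨hf.add hg, fun k => ?_⟩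
    have : iteratedDeriv k (f + g) = iteratedDeriv k f + iteratedDeriv k g := by
      ext x
      exact iteratedDeriv_add (hf.of_le (by exact_mod_cast le_top)).contDiffAt
        (hg.of_le (by exact_mod_cast le_top)).contDiffAt
    rw [this]; exact (hf' k).add (hg' k)
  smul_mem' := by
    rintro c f ⟨hf, hf'⟩
    refine ⟨contDiff_const.smul hf, fun k => ?_⟩
    have : iteratedDeriv k (c • f) = c • iteratedDeriv k f := by
      ext x; exact iteratedDeriv_const_smul_field c f
    rw [this]; exact (hf' k).smul c
  mul_mem' := by
    intro f g hf hg
    refine ⟨hf.1.mul hg.1, fun k => ?_⟩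
    have : iteratedDeriv k (f * g) = fun x => ∑ i ∈ Finset.range (k + 1),
        (k.choose i : ℂ) * iteratedDeriv i f x * iteratedDeriv (k - i) g x := by
      ext x
      exact iteratedDeriv_mul (hf.1.of_le (by exact_mod_cast le_top)).contDiffAt
        (hg.1.of_le (by exact_mod_cast le_top)).contDiffAt
    rw [this]
    refine integrable_finsetSum _ fun i _ => ?_
    obtain ⟨C, hC⟩ := hg.bounded (k - i)
    refine Integrable.mul_bdd (c := C) ((hf.2 i).const_mul _) ?_ (Filter.Eventually.of_forall hC)
    exact (hg.2 (k - i)).aestronglyMeasurable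
  star_mem' := by
    rintro f ⟨hf, hf'⟩
    have h : ∀ k, iteratedDeriv k (star f) = fun x => star (iteratedDeriv k f x) := by
      intro k
      induction k with
      | zero => ext x; simp
      | succ k ih => rw [iteratedDeriv_succ, ih, deriv.star', iteratedDeriv_succ]
    refine ⟨(Complex.conjCLE.contDiff (n := ∞)).comp hf, fun k => ?_⟩
    rw [h]
    exact (Complex.conjLIE.toLinearIsometry.toContinuousLinearMap.integrable_comp (hf' k))

theorem C1inf.memLp_top (a : C1inf) : MemLp (a : ℝ → ℂ) ∞ volume := by
  have ha : IsC1inf a := a.2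
  obtain ⟨C, hC⟩ := ha.bounded 0
  exact memLp_top_of_bound ha.1.continuous.aestronglyMeasurable C
    (Filter.Eventually.of_forall fun x => by simpa using hC x)

/-- The operator of multiplication by `a` on `L²(ℝ)`. -/
def mulOp (a : C1inf) : L2 →L[ℂ] L2 :=
  (ContinuousLinearMap.mul ℂ ℂ).holderL volume ∞ 2 2 (C1inf.memLp_top a).toLp

theorem mulOp_apply (a : C1inf) (f : L2) :
    (mulOp a f : ℝ → ℂ) =ᵐ[volume] fun x => (a : ℝ → ℂ) x * f x := by
  have h1 := (ContinuousLinearMap.mul ℂ ℂ).coeFn_holder (r := 2) (C1inf.memLp_top a).toLp f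
  filter_upwards [h1, (C1inf.memLp_top a).coeFn_toLp] with x h1 h2
  rw [← h2]
  exact h1

/-- The representation of `C₁^∞(ℝ)` on `L²(ℝ)` by multiplication operators. -/
def oscRep : C1inf →⋆ₙₐ[ℂ] (L2 →L[ℂ] L2) where
  toFun := mulOp
  map_smul' c a := by
    ext f
    filter_upwards [mulOp_apply (c • a) f, mulOp_apply a f, Lp.coeFn_smul c (mulOp a f)]
      with x h1 h2 h3
    simp only [MonoidHom.id_apply, smul_apply]
    rw [h1, h3, Pi.smul_apply, h2]
    simp [mul_assoc]
  map_zero' := by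
    ext f
    filter_upwards [mulOp_apply 0 f, Lp.coeFn_zero ℂ 2 (volume : Measure ℝ)] with x h1 h2
    simp only [zero_apply]
    rw [h1, h2]
    simp
  map_add' a b := by
    ext f
    filter_upwards [mulOp_apply (a + b) f, mulOp_apply a f, mulOp_apply b f,
      Lp.coeFn_add (mulOp a f) (mulOp b f)] with x h1 h2 h3 h4
    simp only [add_apply]
    rw [h1, h4, Pi.add_apply, h2, h3]
    simp [add_mul]
  map_mul' a b := by
    ext f
    filter_upwards [mulOp_apply (a * b) f, mulOp_apply a (mulOp b f), mulOp_apply b f]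
      with x h1 h2 h3
    change _ = (mulOp a (mulOp b f) : ℝ → ℂ) x
    rw [h1, h2, h3]
    simp [mul_assoc]
  map_star' a := by
    rw [ContinuousLinearMap.star_eq_adjoint, ContinuousLinearMap.eq_adjoint_iff]
    intro f g
    rw [L2.inner_def, L2.inner_def]
    refine integral_congr_ae ?_
    filter_upwards [mulOp_apply (star a) f, mulOp_apply a g] with x h1 h2
    rw [h1, h2]
    simp
    ring

/-- `φ ↦ φ' + x φ` on Schwartz functions. -/
def oscSchwartz : 𝓢(ℝ, ℂ) →ₗ[ℂ] 𝓢(ℝ, ℂ) :=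
  (SchwartzMap.derivCLM ℂ ℂ + SchwartzMap.smulLeftCLM ℂ (fun x : ℝ => (x : ℂ)) :
    𝓢(ℝ, ℂ) →L[ℂ] 𝓢(ℝ, ℂ))

theorem oscSchwartz_apply (φ : 𝓢(ℝ, ℂ)) (x : ℝ) :
    oscSchwartz φ x = deriv φ x + x * φ x := by
  simp only [oscSchwartz, ContinuousLinearMap.coe_coe, add_apply,
    SchwartzMap.derivCLM_apply]
  rw [SchwartzMap.smulLeftCLM_apply_apply (by fun_prop)]
  simp

/-- The embedding of the Schwartz space in `L²(ℝ)`. -/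
def schwartzToL2 : 𝓢(ℝ, ℂ) →ₗ[ℂ] L2 :=
  (SchwartzMap.toLpCLM ℂ ℂ 2 volume : 𝓢(ℝ, ℂ) →L[ℂ] L2)

theorem schwartzToL2_injective : Function.Injective schwartzToL2 :=
  SchwartzMap.injective_toLp 2 volume

/-- `d/dx + x` with domain the Schwartz functions. -/
def preOsc : L2 →ₗ.[ℂ] L2 where
  domain := LinearMap.range schwartzToL2
  toFun := schwartzToL2 ∘ₗ oscSchwartz ∘ₗ
    (LinearEquiv.ofInjective schwartzToL2 schwartzToL2_injective).symm.toLinearMap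

/-- The closed operator `d/dx + x` on `L²(ℝ)`. -/
def osc : L2 →ₗ.[ℂ] L2 :=
  preOsc.closure

end PRST

end

/-! In the Hermite basis `D` is the weighted lowering shift with weights √(2n), `D*` is the raising
shift, and ⟨D⟩² is diagonal with eigenvalues 2n + 1. Hence Λ has eigenvalues `lam n` = √(2n+2).
Domains, closures, adjoints and powers become conditions on coefficients, and δᵏ(T) has the matrix
(lam m − lam n)ᵏ T_mn. Operators supported on one diagonal of the matrix ("homogeneous") are
regular, which settles the conditions on R_D alone. Since D² − D*² = 2x(D − D*) + 2, the operator f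
R_D Λ⁻² is compact when f has compact support, and a general f is a uniform limit of its cutoffs.

Smooth summability rests on a factorization f = g h, where all derivatives of g and h are square
integrable (`IsC1inf.exists_mul`). One takes h = √G for a smooth integrable G > 0 which dominates
all derivatives of f and, up to constants, its own derivatives. Multiplication by h is square
integrable for the weights with s > 1, because Σ_{n<N} |φ_n(x)|² = O(√N) uniformly in x for the
Hermite functions φ_n (`sum_norm_sq_hermiteFun_le`).

To control δᵏ without functional calculus, write lam m − lam n as (2m − 2n)(1/lam m + 1/lam n) times
the Schur multiplier lam m lam n / (lam m + lam n)². The first factor is a commutator with Λ²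
composed with Λ⁻¹. It preserves sums of Z M_u Z' with Z, Z' homogeneous and u smooth in the L²
sense, as [Λ², M_u] = M_{u'}(D* − D) − M_{u''}. The multiplier is bounded, with entries at most 1,
so it preserves the square integrable operators (`HasDeltas.of_mem_towerSpan`). The Leibniz rule
puts every δᵏ(M_f Z) in B₂².

On smooth vectors ⟨D⟩² and R_D are quadratic in D and D*, whose commutator is the scalar 2. A
commutator of such a quadratic element with M_f w, for w a product of n ladder operators, raises the
ladder degree by at most one. So Sⁿ lies in multiplications times ladder words of length at most n,
and such words are homogeneous operators times Λⁿ.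

For the dimension, M_f Λ⁻ˢ = (M_g Λ^(−s/2))(Λ^(s/2) M_h Λ⁻ˢ) is a product of two Hilbert-Schmidt
operators when 1 < s ≤ 2. Conversely, M disjoint bumps in [0,1] with energy O(M²) give diagonal sums
of order M^(1−s), which forces s ≥ 1. -/

set_option linter.unusedSectionVars false

noncomputable section

namespace PRST

/-! ### Matrices of bounded operators in a Hilbert basis. -/

section HilbertBasis

variable {H : Type*} [NormedAddCommGroup H] [InnerProductSpace ℂ H] [CompleteSpace H]
variable (b : HilbertBasis ℕ ℂ H)

/-- The matrix elements of a bounded operator with respect to a Hilbert basis. -/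
def mat (T : H →L[ℂ] H) (m n : ℕ) : ℂ := inner ℂ (b m) (T (b n))

theorem basis_ext {x y : H} (h : ∀ n, inner ℂ (b n) x = inner ℂ (b n) y) : x = y := by
  apply b.repr.injective
  ext n
  simpa [b.repr_apply_apply] using h n

theorem clm_ext_basis {T S : H →L[ℂ] H} (h : ∀ n, T (b n) = S (b n)) : T = S := by
  refine ContinuousLinearMap.ext_on (s := Set.range b) ?_ ?_
  · exact Submodule.dense_iff_topologicalClosure_eq_top.mpr b.dense_span
  · rintro _ ⟨n, rfl⟩; exact h n

theorem mat_ext {T S : H →L[ℂ] H} (h : ∀ m n, mat b T m n = mat b S m n) : T = S :=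
  clm_ext_basis b fun n => basis_ext b fun m => h m n

theorem mat_star (T : H →L[ℂ] H) (m n : ℕ) : mat b (star T) m n = star (mat b T n m) := by
  simp only [mat, ContinuousLinearMap.star_eq_adjoint, ContinuousLinearMap.adjoint_inner_right]
  exact (inner_conj_symm _ _).symm

theorem mat_add (T S : H →L[ℂ] H) (m n : ℕ) : mat b (T + S) m n = mat b T m n + mat b S m n := by
  simp [mat]

theorem mat_smul (c : ℂ) (T : H →L[ℂ] H) (m n : ℕ) : mat b (c • T) m n = c * mat b T m n := by
  simp [mat]

theorem mat_zero (m n : ℕ) : mat b (0 : H →L[ℂ] H) m n = 0 := by simp [mat]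

theorem hasSum_mat_apply (T : H →L[ℂ] H) (x : H) (m : ℕ) :
    HasSum (fun n => mat b T m n * inner ℂ (b n) x) (inner ℂ (b m) (T x)) := by
  have h := b.hasSum_inner_mul_inner (star T (b m)) x
  simp only [ContinuousLinearMap.star_eq_adjoint, ContinuousLinearMap.adjoint_inner_left] at h
  exact h

theorem hasSum_mat_mul (T S : H →L[ℂ] H) (m n : ℕ) :
    HasSum (fun l => mat b T m l * mat b S l n) (mat b (T * S) m n) :=
  hasSum_mat_apply b T (S (b n)) m

theorem inner_basis (m n : ℕ) : inner ℂ (b m) (b n) = if m = n then (1 : ℂ) else 0 :=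
  orthonormal_iff_ite.1 b.orthonormal m n

theorem norm_sq_eq_tsum (x : H) :
    HasSum (fun n => ‖(inner ℂ (b n) x : ℂ)‖ ^ 2) (‖x‖ ^ 2) := by
  have h := b.hasSum_inner_mul_inner x x
  have h3 := Complex.hasSum_re h
  rw [inner_self_eq_norm_sq_to_K] at h3
  convert! h3 using 1
  · ext n
    rw [← inner_conj_symm x (b n), mul_comm, Complex.mul_conj, Complex.normSq_eq_norm_sq]
    norm_cast
  · norm_cast

theorem enorm_sq_eq_tsum (x : H) : ‖x‖ₑ ^ 2 = ∑' n, ‖(inner ℂ (b n) x : ℂ)‖ₑ ^ 2 := by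
  have h2 := norm_sq_eq_tsum b x
  have h4 : ∀ y : ℝ, 0 ≤ y → ENNReal.ofReal (y ^ 2) = ENNReal.ofReal y ^ 2 :=
    fun y hy => ENNReal.ofReal_pow hy 2
  rw [← ofReal_norm, ← h4 _ (norm_nonneg _), ← h2.tsum_eq,
    ENNReal.ofReal_tsum_of_nonneg (fun n => by positivity) h2.summable]
  congr 1; ext n
  rw [← ofReal_norm, h4 _ (norm_nonneg _)]

theorem exists_of_memℓp {c : ℕ → ℂ} (hc : Memℓp c 2) : ∃ x : H, ∀ n, inner ℂ (b n) x = c n :=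
  ⟨b.repr.symm ⟨c, hc⟩, fun n => by rw [← b.repr_apply_apply]; simp⟩

theorem exists_of_summable {c : ℕ → ℂ} (hc : Summable fun n => ‖c n‖ ^ 2) :
    ∃ x : H, ∀ n, inner ℂ (b n) x = c n :=
  exists_of_memℓp b (memℓp_gen (by simpa using hc))

theorem exists_of_norm_le {c : ℕ → ℂ} (x : H) (C : ℝ) (hc : ∀ n, ‖c n‖ ≤ C * ‖(inner ℂ (b n) x : ℂ)‖) :
    ∃ y : H, ∀ n, inner ℂ (b n) y = c n := by
  refine exists_of_summable b (Summable.of_nonneg_of_le (fun n => by positivity) (fun n => ?_)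
    ((norm_sq_eq_tsum b x).summable.mul_left (C ^ 2)))
  calc ‖c n‖ ^ 2 ≤ (C * ‖(inner ℂ (b n) x : ℂ)‖) ^ 2 := by gcongr; exact hc n
    _ = _ := by ring

/-- A matrix with a bounded quadratic form is the matrix of a bounded operator. -/
theorem exists_clm_of_form (K : ℕ → ℕ → ℂ) (C : ℝ)
    (hK : ∀ (s : Finset ℕ) (u v : ℕ → ℂ), ‖∑ m ∈ s, ∑ n ∈ s, star (v m) * K m n * u n‖ ≤
      C * (∑ n ∈ s, ‖u n‖ ^ 2 + ∑ m ∈ s, ‖v m‖ ^ 2)) :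
    ∃ T : H →L[ℂ] H, ∀ m n, mat b T m n = K m n := by
  wlog hC : 0 < C generalizing C
  · refine this (|C| + 1) (fun s u v => (hK s u v).trans ?_) (by positivity)
    gcongr
    linarith [le_abs_self C]
  have key : ∀ (s : Finset ℕ) (u : ℕ →₀ ℂ),
      ∑ m ∈ s, ‖∑ n ∈ u.support, K m n * u n‖ ^ 2 ≤ (2 * C) ^ 2 * ∑ n ∈ u.support, ‖u n‖ ^ 2 := by
    intro s u
    classical
    set y : ℕ → ℂ := fun m => ∑ n ∈ u.support, K m n * u n with hy
    -- Test with v = y/(2C), where y is the image of u. Then C‖v‖² is half of the form's value, so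
    -- it is absorbed, and ‖y‖² ≤ (2C)²‖u‖² remains.
    have h := hK (s ∪ u.support) u (fun m => if m ∈ s then ((1 / (2 * C) : ℝ) : ℂ) * y m else 0)
    have e1 : ∑ n ∈ s ∪ u.support, ‖u n‖ ^ 2 = ∑ n ∈ u.support, ‖u n‖ ^ 2 := by
      symm
      refine Finset.sum_subset Finset.subset_union_right fun n _ hn => ?_
      simp [Finsupp.notMem_support_iff.1 hn]
    have e2 : ∑ m ∈ s ∪ u.support, ‖(if m ∈ s then ((1 / (2 * C) : ℝ) : ℂ) * y m else 0)‖ ^ 2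
        = (1 / (2 * C)) ^ 2 * ∑ m ∈ s, ‖y m‖ ^ 2 := by
      rw [Finset.mul_sum]
      rw [← Finset.sum_subset Finset.subset_union_left (s₁ := s)]
      · refine Finset.sum_congr rfl fun m hm => ?_
        rw [if_pos hm, norm_mul, Complex.norm_real, mul_pow, Real.norm_eq_abs, sq_abs]
      · intro m _ hm; simp [hm]
    have e3 : ∑ m ∈ s ∪ u.support, ∑ n ∈ s ∪ u.support,
        star (if m ∈ s then ((1 / (2 * C) : ℝ) : ℂ) * y m else 0) * K m n * u n
        = (((1 / (2 * C)) * ∑ m ∈ s, ‖y m‖ ^ 2 : ℝ) : ℂ) := by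
      rw [← Finset.sum_subset Finset.subset_union_left (s₁ := s)]
      · push_cast
        rw [Finset.mul_sum]
        refine Finset.sum_congr rfl fun m hm => ?_
        rw [← Finset.sum_subset Finset.subset_union_right (s₁ := u.support)]
        · simp only [if_pos hm, mul_assoc]
          rw [← Finset.mul_sum]
          change star _ * y m = _
          rw [star_mul', ← Complex.conj_mul']
          simp
          ring
        · intro n _ hn; simp [Finsupp.notMem_support_iff.1 hn]
      · intro m _ hm; simp [hm]
    rw [e1, e2, e3, Complex.norm_real, Real.norm_eq_abs] at h
    have h' := (le_abs_self _).trans h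
    have hY : 0 ≤ ∑ m ∈ s, ‖y m‖ ^ 2 := by positivity
    have : C * ((1 / (2 * C)) ^ 2 * ∑ m ∈ s, ‖y m‖ ^ 2)
        = (1 / 2) * (1 / (2 * C) * ∑ m ∈ s, ‖y m‖ ^ 2) := by field_simp
    rw [mul_add, this] at h'
    have h2 : (1 / (2 * C)) * ∑ m ∈ s, ‖y m‖ ^ 2 ≤ 2 * C * ∑ n ∈ u.support, ‖u n‖ ^ 2 := by linarith
    rw [div_mul_eq_mul_div, one_mul, div_le_iff₀ (by positivity)] at h2
    calc _ ≤ _ := h2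
      _ = _ := by ring
  have hmem : ∀ u : ℕ →₀ ℂ, Memℓp (fun m => ∑ n ∈ u.support, K m n * u n) 2 := by
    intro u
    refine memℓp_gen' (C := (2 * C) ^ 2 * ∑ n ∈ u.support, ‖u n‖ ^ 2) fun s => ?_
    simpa using key s u
  let f : (ℕ →₀ ℂ) →ₗ[ℂ] H :=
    { toFun := fun u => b.repr.symm ⟨_, hmem u⟩
      map_add' := by
        intro u v
        rw [← map_add]
        congr 1
        ext m
        change (u + v).sum (fun n c => K m n * c) =
          u.sum (fun n c => K m n * c) + v.sum (fun n c => K m n * c)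
        exact Finsupp.sum_add_index' (by simp) (by intros; ring)
      map_smul' := by
        intro c u
        rw [RingHom.id_apply, ← map_smul]
        congr 1
        ext m
        change (c • u).sum (fun n c => K m n * c) = c * u.sum (fun n c => K m n * c)
        rw [Finsupp.sum_smul_index (by simp), Finsupp.sum, Finsupp.sum, Finset.mul_sum]
        exact Finset.sum_congr rfl fun n _ => by ring }
  let e : (ℕ →₀ ℂ) →ₗ[ℂ] H := Finsupp.linearCombination ℂ b
  have hd : DenseRange e := by
    have : (Set.range e) = (Submodule.span ℂ (Set.range b) : Set H) := by
      rw [← Finsupp.range_linearCombination]; rfl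
    rw [DenseRange, this]
    exact Submodule.dense_iff_topologicalClosure_eq_top.mpr b.dense_span
  have hn : ∀ u, ‖f u‖ ≤ (2 * C) * ‖e u‖ := by
    intro u
    have h1 : ‖e u‖ ^ 2 = ∑ n ∈ u.support, ‖u n‖ ^ 2 := by
      have := b.orthonormal.inner_finsupp_eq_sum_left u u
      have h3 : ((‖e u‖ ^ 2 : ℝ) : ℂ) = ((∑ n ∈ u.support, ‖u n‖ ^ 2 : ℝ) : ℂ) := by
        have h4 := inner_self_eq_norm_sq_to_K (𝕜 := ℂ) (e u)
        push_cast at h4 ⊢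
        refine h4.symm.trans (this.trans ?_)
        refine Finset.sum_congr rfl fun n _ => ?_
        rw [← Complex.conj_mul']
      exact_mod_cast h3
    have h2 : ‖f u‖ ≤ Real.sqrt ((2 * C) ^ 2 * ‖e u‖ ^ 2) := by
      change ‖b.repr.symm ⟨_, hmem u⟩‖ ≤ _
      rw [LinearIsometryEquiv.norm_map]
      refine lp.norm_le_of_forall_sum_le (by simp) (Real.sqrt_nonneg _) fun s => ?_
      simp only [ENNReal.toReal_ofNat, Real.rpow_two]
      rw [Real.sq_sqrt (by positivity), h1]
      exact key s u
    rwa [← mul_pow, Real.sqrt_sq (by positivity)] at h2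
  refine ⟨f.extendOfNorm e, fun m n => ?_⟩
  have h1 : e (Finsupp.single n 1) = b n := by simp [e]
  rw [mat, ← h1, LinearMap.extendOfNorm_eq hd ⟨_, hn⟩]
  rw [← b.repr_apply_apply]
  change (b.repr (b.repr.symm ⟨_, hmem _⟩)) m = K m n
  rw [LinearIsometryEquiv.apply_symm_apply]
  change (Finsupp.single n 1).sum (fun n c => K m n * c) = _
  simp

/-- Every row and every column has at most one nonzero entry, so |v_m u_n| ≤ |u_n|² + |v_m|² already
bounds the quadratic form. All shifts and diagonal operators below are built this way. -/
theorem exists_clm_homogeneous (d : ℤ) (K : ℕ → ℕ → ℂ) (C : ℝ) (h0 : ∀ m n : ℕ, (m : ℤ) ≠ n + d → K m n = 0)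
    (hC : ∀ m n, ‖K m n‖ ≤ C) : ∃ T : H →L[ℂ] H, ∀ m n, mat b T m n = K m n := by
  have hC0 : 0 ≤ C := (norm_nonneg _).trans (hC 0 0)
  refine exists_clm_of_form b K C fun s u v => ?_
  have h1 : ∀ m n, ‖star (v m) * K m n * u n‖ ≤
      (if (m : ℤ) = n + d then C * ‖u n‖ ^ 2 else 0) + (if (m : ℤ) = n + d then C * ‖v m‖ ^ 2 else 0) := by
    intro m n
    split_ifs with h
    · rw [norm_mul, norm_mul, norm_star]
      calc ‖v m‖ * ‖K m n‖ * ‖u n‖ = ‖K m n‖ * (‖v m‖ * ‖u n‖) := by ring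
        _ ≤ C * (‖v m‖ * ‖u n‖) := by gcongr; exact hC m n
        _ ≤ C * (‖u n‖ ^ 2 + ‖v m‖ ^ 2) := by
          gcongr; nlinarith [sq_nonneg (‖u n‖ - ‖v m‖), sq_nonneg (‖u n‖ ), sq_nonneg (‖v m‖)]
        _ = _ := by ring
    · simp [h0 m n h]
  calc _ ≤ ∑ m ∈ s, ∑ n ∈ s, ((if (m : ℤ) = n + d then C * ‖u n‖ ^ 2 else 0) +
        (if (m : ℤ) = n + d then C * ‖v m‖ ^ 2 else 0)) :=
      (norm_sum_le _ _).trans (Finset.sum_le_sum fun m _ => (norm_sum_le _ _).trans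
        (Finset.sum_le_sum fun n _ => h1 m n))
    _ = (∑ n ∈ s, ∑ m ∈ s, (if (m : ℤ) = n + d then C * ‖u n‖ ^ 2 else 0)) +
        ∑ m ∈ s, ∑ n ∈ s, (if (m : ℤ) = n + d then C * ‖v m‖ ^ 2 else 0) := by
      simp only [Finset.sum_add_distrib]
      rw [Finset.sum_comm]
    _ ≤ (∑ n ∈ s, C * ‖u n‖ ^ 2) + ∑ m ∈ s, C * ‖v m‖ ^ 2 := by
      gcongr with n _ m _
      · rw [← Finset.sum_filter, Finset.sum_const, nsmul_eq_mul]
        have : (s.filter fun m : ℕ => (m : ℤ) = n + d).card ≤ 1 :=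
          Finset.card_le_one.2 fun a ha c hc => by
            simp only [Finset.mem_filter] at ha hc; omega
        have h2 : ((s.filter fun m : ℕ => (m : ℤ) = n + d).card : ℝ) ≤ 1 := by exact_mod_cast this
        exact mul_le_of_le_one_left (by positivity) h2
      · rw [← Finset.sum_filter, Finset.sum_const, nsmul_eq_mul]
        have : (s.filter fun n : ℕ => (m : ℤ) = n + d).card ≤ 1 :=
          Finset.card_le_one.2 fun a ha c hc => by
            simp only [Finset.mem_filter] at ha hc; omega
        have h2 : ((s.filter fun n : ℕ => (m : ℤ) = n + d).card : ℝ) ≤ 1 := by exact_mod_cast this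
        exact mul_le_of_le_one_left (by positivity) h2
    _ = _ := by rw [← Finset.mul_sum, ← Finset.mul_sum]; ring

end HilbertBasis

/-! ### Hilbert-Schmidt norms, trace class operators and functional calculus on eigenvectors. -/

section HilbertSchmidt

variable {H : Type*} [NormedAddCommGroup H] [InnerProductSpace ℂ H] [CompleteSpace H]
variable (b : HilbertBasis ℕ ℂ H)

/-- The square of the Hilbert-Schmidt norm. -/
def hs (X : H →L[ℂ] H) : ℝ≥0∞ := ∑' n, ‖X (b n)‖ₑ ^ 2

theorem hs_eq_tsum_mat (X : H →L[ℂ] H) : hs b X = ∑' n, ∑' m, ‖mat b X m n‖ₑ ^ 2 := by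
  unfold hs mat
  congr 1; ext n
  exact enorm_sq_eq_tsum b _

theorem hs_star (X : H →L[ℂ] H) : hs b (star X) = hs b X := by
  rw [hs_eq_tsum_mat, hs_eq_tsum_mat, ENNReal.tsum_comm]
  simp only [mat_star, ← ofReal_norm, norm_star]

theorem enorm_apply_sq_le (A : H →L[ℂ] H) (x : H) : ‖A x‖ₑ ^ 2 ≤ ‖A‖ₑ ^ 2 * ‖x‖ₑ ^ 2 := by
  rw [← mul_pow]
  gcongr
  rw [← ofReal_norm, ← ofReal_norm, ← ofReal_norm, ← ENNReal.ofReal_mul (norm_nonneg _)]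
  exact ENNReal.ofReal_le_ofReal (A.le_opNorm x)

theorem hs_mul_le_left (A X : H →L[ℂ] H) : hs b (A * X) ≤ ‖A‖ₑ ^ 2 * hs b X := by
  unfold hs
  rw [← ENNReal.tsum_mul_left]
  exact ENNReal.tsum_le_tsum fun n => enorm_apply_sq_le A _

theorem hs_mul_le_right (A X : H →L[ℂ] H) : hs b (X * A) ≤ ‖A‖ₑ ^ 2 * hs b X := by
  rw [← hs_star, star_mul, ← hs_star b X]
  refine (hs_mul_le_left b _ _).trans ?_
  rw [← ofReal_norm, norm_star, ofReal_norm]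

theorem enorm_sq_ne_top (A : H →L[ℂ] H) : ‖A‖ₑ ^ 2 ≠ ⊤ := by simp

theorem hs_mul_left_lt_top {X : H →L[ℂ] H} (A : H →L[ℂ] H) (hX : hs b X < ⊤) : hs b (A * X) < ⊤ :=
  (hs_mul_le_left b A X).trans_lt (ENNReal.mul_lt_top (enorm_sq_ne_top A).lt_top hX)

theorem hs_mul_right_lt_top {X : H →L[ℂ] H} (A : H →L[ℂ] H) (hX : hs b X < ⊤) : hs b (X * A) < ⊤ :=
  (hs_mul_le_right b A X).trans_lt (ENNReal.mul_lt_top (enorm_sq_ne_top A).lt_top hX)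

theorem enorm_add_sq_le (x y : H) : ‖x + y‖ₑ ^ 2 ≤ 2 * (‖x‖ₑ ^ 2 + ‖y‖ₑ ^ 2) := by
  simp only [← ofReal_norm, ← ENNReal.ofReal_pow (norm_nonneg _)]
  rw [← ENNReal.ofReal_add (by positivity) (by positivity)]
  have : (2 : ℝ≥0∞) = ENNReal.ofReal 2 := by simp
  rw [this, ← ENNReal.ofReal_mul (by positivity)]
  refine ENNReal.ofReal_le_ofReal ?_
  nlinarith [norm_add_le x y, norm_nonneg (x + y), sq_nonneg (‖x‖ - ‖y‖), norm_nonneg x, norm_nonneg y]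

theorem hs_add_lt_top {X Y : H →L[ℂ] H} (hX : hs b X < ⊤) (hY : hs b Y < ⊤) : hs b (X + Y) < ⊤ := by
  have : hs b (X + Y) ≤ 2 * (hs b X + hs b Y) := by
    unfold hs
    rw [← ENNReal.tsum_add, ← ENNReal.tsum_mul_left]
    exact ENNReal.tsum_le_tsum fun n => enorm_add_sq_le _ _
  refine this.trans_lt (ENNReal.mul_lt_top (by simp) (ENNReal.add_lt_top.2 ⟨hX, hY⟩))

theorem hs_smul_lt_top {X : H →L[ℂ] H} (c : ℂ) (hX : hs b X < ⊤) : hs b (c • X) < ⊤ := by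
  have : c • X = (c • (1 : H →L[ℂ] H)) * X := by ext; simp
  rw [this]
  exact hs_mul_left_lt_top b _ hX

theorem hs_zero : hs b (0 : H →L[ℂ] H) = 0 := by simp [hs]

/-- Bessel's inequality for Hilbert-Schmidt norms. -/
theorem sum_enorm_sq_le_hs (X : H →L[ℂ] H) {ι : Type*} [Fintype ι] {e : ι → H} (he : Orthonormal ℂ e) :
    ∑ i, ‖X (e i)‖ₑ ^ 2 ≤ hs b X := by
  rw [← hs_star]
  calc ∑ i, ‖X (e i)‖ₑ ^ 2 = ∑ i, ∑' n, ‖(inner ℂ (b n) (X (e i)) : ℂ)‖ₑ ^ 2 := by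
        simp only [enorm_sq_eq_tsum b]
    _ = ∑' n, ∑ i, ‖(inner ℂ (b n) (X (e i)) : ℂ)‖ₑ ^ 2 :=
        (Summable.tsum_finsetSum fun _ _ => ENNReal.summable).symm
    _ ≤ ∑' n, ‖star X (b n)‖ₑ ^ 2 := by
        refine ENNReal.tsum_le_tsum fun n => ?_
        have h := he.sum_inner_products_le (star X (b n)) (s := Finset.univ)
        have h2 := ENNReal.ofReal_le_ofReal h
        rw [ENNReal.ofReal_pow (norm_nonneg _), ofReal_norm,
          ENNReal.ofReal_sum_of_nonneg fun _ _ => by positivity] at h2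
        refine le_trans (le_of_eq ?_) h2
        refine Finset.sum_congr rfl fun i _ => ?_
        rw [ENNReal.ofReal_pow (norm_nonneg _), ContinuousLinearMap.star_eq_adjoint,
          ContinuousLinearMap.adjoint_inner_right, norm_inner_symm, ofReal_norm]

theorem ofReal_inner_star_mul_self (X : H →L[ℂ] H) (x : H) :
    ENNReal.ofReal (inner ℂ x ((star X * X) x) : ℂ).re = ‖X x‖ₑ ^ 2 := by
  rw [mul_apply_eq_comp, ContinuousLinearMap.star_eq_adjoint,
    ContinuousLinearMap.adjoint_inner_right, inner_self_eq_norm_sq_to_K]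
  change ENNReal.ofReal ((‖X x‖ : ℂ) ^ 2).re = _
  rw [← Complex.ofReal_pow, Complex.ofReal_re, ENNReal.ofReal_pow (norm_nonneg _), ofReal_norm]

/-- Together with `hs_le_posTrace` this computes the trace of X*X, defined as a supremum over all
finite orthonormal families, in a single basis. Bessel's inequality is what makes the other families
harmless. -/
theorem posTrace_star_mul_self_le (X : H →L[ℂ] H) : posTrace (star X * X) ≤ hs b X := by
  refine iSup_le fun n => iSup_le fun e => iSup_le fun he => ?_
  simp only [ofReal_inner_star_mul_self]
  exact sum_enorm_sq_le_hs b X he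

theorem hs_le_posTrace (X : H →L[ℂ] H) : hs b X ≤ posTrace (star X * X) := by
  unfold hs
  rw [ENNReal.tsum_eq_iSup_nat]
  refine iSup_le fun n => ?_
  have he : Orthonormal ℂ fun i : Fin n => b i := b.orthonormal.comp _ Fin.val_injective
  refine le_trans (le_of_eq ?_) (le_iSup_of_le n (le_iSup_of_le _ (le_iSup_of_le he le_rfl)))
  simp only [ofReal_inner_star_mul_self]
  exact Finset.sum_range fun i => ‖X (b i)‖ₑ ^ 2

/-- Approximate polar decomposition. -/
theorem exists_approx_polar (T : H →L[ℂ] H) {ε : ℝ} (hε : 0 < ε) :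
    ∃ V : H →L[ℂ] H, ‖V‖ ≤ 1 ∧ ‖T - V * CFC.abs T‖ ≤ ε ∧ ‖CFC.abs T - star V * T‖ ≤ ε := by
  set P := CFC.abs T with hP
  have hP0 : 0 ≤ P := CFC.abs_nonneg T
  have hsa : IsSelfAdjoint P := hP0.isSelfAdjoint
  have hPP : P * P = star T * T := CFC.abs_mul_abs T
  have hsp : ∀ x ∈ spectrum ℝ P, 0 ≤ x := fun x hx => spectrum_nonneg_of_nonneg hP0 hx
  -- The regularised partial isometry is V = T(|T| + ε)⁻¹. It avoids a genuine polar decomposition,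
  -- because A − A(|T| + ε)⁻¹|T| = ε A(|T| + ε)⁻¹ is small for A = T and A = |T|.
  set g : ℝ → ℝ := fun t => (t + ε)⁻¹ with hg
  have hgc : ContinuousOn g (spectrum ℝ P) :=
    ContinuousOn.inv₀ (by fun_prop) fun x hx => by have := hsp x hx; positivity
  set r := cfc g P with hr
  have hid : cfc (fun t : ℝ => t) P = P := cfc_id' ℝ P
  have hrsa : star r = r := (cfc_predicate g P : IsSelfAdjoint _)
  have hrP : r * P = cfc (fun t => g t * t) P := by
    rw [cfc_mul g (fun t => t) P hgc (by fun_prop), hid]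
  have hPr : P * r = r * P := by
    conv_lhs => rw [← hid]
    conv_rhs => rw [← hid]
    rw [hr, ← cfc_mul _ _ _ (by fun_prop) hgc, ← cfc_mul _ _ _ hgc (by fun_prop)]
    simp only [mul_comm]
  have hnorm : ‖r * P‖ ≤ 1 := by
    rw [hrP]
    refine norm_cfc_le zero_le_one fun x hx => ?_
    have := hsp x hx
    rw [Real.norm_of_nonneg (by positivity), hg]
    rw [inv_mul_le_one₀ (by positivity)]; linarith
  have hsub : ∀ A : H →L[ℂ] H, A - A * (r * P) = ε • (A * r) := by
    intro A
    have : (1 : H →L[ℂ] H) - r * P = ε • r := by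
      have h1 : (1 : H →L[ℂ] H) = cfc (fun _ : ℝ => (1 : ℝ)) P := (cfc_const_one ℝ P).symm
      rw [hrP, h1, ← cfc_sub (fun _ : ℝ => (1 : ℝ)) (fun t => g t * t) P (by fun_prop) (hgc.mul continuousOn_id), hr,
        ← cfc_smul ε g P hgc]
      refine cfc_congr fun x hx => ?_
      have := hsp x hx
      have h3 : x + ε ≠ 0 := by positivity
      simp only [hg, smul_eq_mul]
      field_simp
      ring
    calc A - A * (r * P) = A * (1 - r * P) := by rw [mul_sub, mul_one]
      _ = _ := by rw [this, mul_smul_comm]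
  have hV : ‖T * r‖ ≤ 1 := by
    have h1 : star (T * r) * (T * r) = star (r * P) * (r * P) := by
      rw [star_mul, star_mul, hrsa, hsa.star_eq, ← hPr]
      calc r * star T * (T * r) = r * (star T * T) * r := by simp only [mul_assoc]
        _ = r * (P * P) * r := by rw [hPP]
        _ = (r * P) * (P * r) := by simp only [mul_assoc]
        _ = _ := by rw [hPr]
    have h2 := CStarRing.norm_star_mul_self (x := T * r)
    rw [h1, CStarRing.norm_star_mul_self] at h2
    nlinarith [norm_nonneg (T * r), norm_nonneg (r * P)]
  refine ⟨T * r, hV, ?_, ?_⟩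
  · rw [mul_assoc, hsub, norm_smul, Real.norm_of_nonneg hε.le]
    nlinarith
  · have h1 : star (T * r) * T = P * (r * P) := by
      rw [star_mul, hrsa, mul_assoc, ← hPP, ← mul_assoc, ← mul_assoc, hPr]
    rw [h1, hsub, norm_smul, Real.norm_of_nonneg hε.le, hPr]
    nlinarith

theorem ofReal_mul_self_sqrt_le {ι : Type*} (s : Finset ι) (x y : ι → H) :
    ENNReal.ofReal (∑ i ∈ s, ‖x i‖ * ‖y i‖) ^ 2 ≤ (∑ i ∈ s, ‖x i‖ₑ ^ 2) * ∑ i ∈ s, ‖y i‖ₑ ^ 2 := by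
  simp only [← ofReal_norm, ← ENNReal.ofReal_pow (norm_nonneg _)]
  rw [← ENNReal.ofReal_sum_of_nonneg fun _ _ => by positivity,
    ← ENNReal.ofReal_sum_of_nonneg fun _ _ => by positivity,
    ← ENNReal.ofReal_mul (by positivity), ← ENNReal.ofReal_pow (by positivity)]
  exact ENNReal.ofReal_le_ofReal (Finset.sum_mul_sq_le_sq_mul_sq s _ _)

/-- Since ⟨e, XYe⟩ = ⟨X*e, Ye⟩, this is Cauchy-Schwarz followed by Bessel for X* and for Y. -/
theorem sum_re_inner_mul_le {X Y : H →L[ℂ] H} (hX : hs b X < ⊤) (hY : hs b Y < ⊤)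
    {ι : Type*} [Fintype ι] {e : ι → H} (he : Orthonormal ℂ e) :
    ∑ i, (inner ℂ (e i) ((X * Y) (e i)) : ℂ).re ≤ Real.sqrt ((hs b X).toReal * (hs b Y).toReal) := by
  have h1 : ∑ i, (inner ℂ (e i) ((X * Y) (e i)) : ℂ).re ≤ ∑ i, ‖star X (e i)‖ * ‖Y (e i)‖ := by
    refine Finset.sum_le_sum fun i _ => ?_
    rw [mul_apply_eq_comp, ← ContinuousLinearMap.adjoint_inner_left,
      ← ContinuousLinearMap.star_eq_adjoint]
    exact (Complex.re_le_norm _).trans (norm_inner_le_norm _ _)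
  refine h1.trans (Real.le_sqrt_of_sq_le ?_)
  have h2 := ofReal_mul_self_sqrt_le Finset.univ (fun i => star X (e i)) (fun i => Y (e i))
  have h3 := h2.trans (mul_le_mul' (sum_enorm_sq_le_hs b (star X) he) (sum_enorm_sq_le_hs b Y he))
  rw [hs_star, ← ENNReal.ofReal_pow (by positivity)] at h3
  rw [← ENNReal.toReal_mul]
  exact (ENNReal.ofReal_le_iff_le_toReal (ENNReal.mul_ne_top hX.ne hY.ne)).1 h3

theorem re_inner_le_of_norm_sub_le {S T : H →L[ℂ] H} {ε : ℝ} (h : ‖S - T‖ ≤ ε) {x : H} (hx : ‖x‖ = 1) :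
    (inner ℂ x (S x) : ℂ).re ≤ (inner ℂ x (T x) : ℂ).re + ε := by
  have : (inner ℂ x ((S - T) x) : ℂ).re ≤ ε := by
    refine (Complex.re_le_norm _).trans ((norm_inner_le_norm _ _).trans ?_)
    rw [hx, one_mul]
    refine ((S - T).le_opNorm x).trans ?_
    rw [hx, mul_one]; exact h
  rw [sub_apply, inner_sub_right, Complex.sub_re] at this
  linarith

/-- Up to a small norm error |XY| is V*XY with ‖V‖ ≤ 1, and V*X is Hilbert-Schmidt with norm at most
that of X. An error of δ/(n+1) per vector costs at most δ over n vectors. -/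
theorem isTraceClass_mul {X Y : H →L[ℂ] H} (hX : hs b X < ⊤) (hY : hs b Y < ⊤) :
    IsTraceClass (X * Y) := by
  set C := Real.sqrt ((hs b X).toReal * (hs b Y).toReal) with hC
  have key : ∀ (n : ℕ) (e : Fin n → H), Orthonormal ℂ e →
      ∑ i, (inner ℂ (e i) (CFC.abs (X * Y) (e i)) : ℂ).re ≤ C := by
    intro n e he
    refine le_of_forall_pos_le_add fun δ hδ => ?_
    obtain ⟨V, hV, -, hV2⟩ := exists_approx_polar (X * Y) (ε := δ / (n + 1)) (by positivity)
    have h1 : ∑ i, (inner ℂ (e i) (CFC.abs (X * Y) (e i)) : ℂ).re ≤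
        ∑ i, ((inner ℂ (e i) ((star V * X * Y) (e i)) : ℂ).re + δ / (n + 1)) := by
      refine Finset.sum_le_sum fun i _ => ?_
      rw [mul_assoc]
      exact re_inner_le_of_norm_sub_le hV2 (he.norm_eq_one i)
    rw [Finset.sum_add_distrib] at h1
    have h2 : hs b (star V * X) ≤ hs b X := by
      refine (hs_mul_le_left b _ _).trans ?_
      refine mul_le_of_le_one_left' ?_
      rw [← ofReal_norm, norm_star]
      exact pow_le_one' (by simpa only [ENNReal.ofReal_le_one] using hV) 2
    have h3 := sum_re_inner_mul_le b (h2.trans_lt hX) hY he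
    have h4 : Real.sqrt ((hs b (star V * X)).toReal * (hs b Y).toReal) ≤ C := by
      rw [hC]
      gcongr
      exact hX.ne
    have h5 : ∑ i : Fin n, δ / (n + 1) ≤ δ := by
      simp only [Finset.sum_const, Finset.card_univ, Fintype.card_fin, nsmul_eq_mul]
      rw [mul_div_assoc', div_le_iff₀ (by positivity)]
      nlinarith
    linarith
  refine lt_of_le_of_lt (b := ENNReal.ofReal C) ?_ ENNReal.ofReal_lt_top
  refine iSup_le fun n => iSup_le fun e => iSup_le fun he => ?_
  rw [← ENNReal.ofReal_sum_of_nonneg]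
  · exact ENNReal.ofReal_le_ofReal (key n e he)
  · intro i _
    have := (ContinuousLinearMap.nonneg_iff_isPositive _).1 (CFC.abs_nonneg (X * Y))
    exact this.re_inner_nonneg_right (e i)

/-- Diagonal sums of a trace class operator are bounded by its trace norm. -/

theorem exists_sum_re_inner_le (b : HilbertBasis ℕ ℂ H) {T : H →L[ℂ] H} (hT : IsTraceClass T) :
    ∃ C : ℝ, ∀ (n : ℕ) (e : Fin n → H), Orthonormal ℂ e →
      ∑ i, (inner ℂ (e i) (T (e i)) : ℂ).re ≤ C := by
  set P := CFC.abs T with hP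
  have hP0 : 0 ≤ P := CFC.abs_nonneg T
  -- Trace class of T means exactly that S = |T|^(1/2) is Hilbert-Schmidt, and T is close to (VS)S.
  set S := CFC.sqrt P with hS
  have hSS : star S * S = P := by
    rw [(CFC.sqrt_nonneg P).isSelfAdjoint.star_eq]
    exact CFC.sqrt_mul_sqrt_self P
  have hSs : star S = S := (CFC.sqrt_nonneg P).isSelfAdjoint.star_eq
  have hfin : hs b S < ⊤ := (hs_le_posTrace b S).trans_lt (by rw [hSS]; exact hT)
  set C := Real.sqrt ((hs b S).toReal * (hs b S).toReal) with hC
  refine ⟨C, fun n e he => ?_⟩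
  refine le_of_forall_pos_le_add fun δ hδ => ?_
  obtain ⟨V, hV, hV1, -⟩ := exists_approx_polar T (ε := δ / (n + 1)) (by positivity)
  have h1 : ∑ i, (inner ℂ (e i) (T (e i)) : ℂ).re ≤
      ∑ i, ((inner ℂ (e i) ((V * S * S) (e i)) : ℂ).re + δ / (n + 1)) := by
    refine Finset.sum_le_sum fun i _ => ?_
    have h0 : V * S * S = V * P := by rw [mul_assoc]; conv_lhs => rw [← hSs]
                                      rw [hSs, ← hSS, hSs]
    rw [h0]
    exact re_inner_le_of_norm_sub_le hV1 (he.norm_eq_one i)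
  rw [Finset.sum_add_distrib] at h1
  have h2 : hs b (V * S) ≤ hs b S := by
    refine (hs_mul_le_left b _ _).trans (mul_le_of_le_one_left' ?_)
    rw [← ofReal_norm]
    exact pow_le_one' (by simpa only [ENNReal.ofReal_le_one] using hV) 2
  have h3 := sum_re_inner_mul_le b (h2.trans_lt hfin) hfin he
  have h4 : Real.sqrt ((hs b (V * S)).toReal * (hs b S).toReal) ≤ C := by
    rw [hC]
    gcongr
    exact hfin.ne
  have h5 : ∑ i : Fin n, δ / (n + 1) ≤ δ := by
    simp only [Finset.sum_const, Finset.card_univ, Fintype.card_fin, nsmul_eq_mul]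
    rw [mul_div_assoc', div_le_iff₀ (by positivity)]
    nlinarith
  linarith

/-- The operators |A|B and AB have the same absolute value, since B*|A|²B = B*A*AB. This reconciles
the two forms of the trace class condition in the definition of spectral dimension. -/
theorem isTraceClass_abs_mul (A B : H →L[ℂ] H) :
    IsTraceClass (CFC.abs A * B) ↔ IsTraceClass (A * B) := by
  have : CFC.abs (CFC.abs A * B) = CFC.abs (A * B) := by
    unfold CFC.abs
    congr 1
    rw [star_mul, star_mul]
    have h1 : star (CFC.sqrt (star A * A)) = CFC.sqrt (star A * A) :=
      (CFC.sqrt_nonneg _).isSelfAdjoint.star_eq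
    have h2 : CFC.sqrt (star A * A) * CFC.sqrt (star A * A) = star A * A := CFC.abs_mul_abs A
    calc star B * star (CFC.sqrt (star A * A)) * (CFC.sqrt (star A * A) * B)
        = star B * (CFC.sqrt (star A * A) * CFC.sqrt (star A * A)) * B := by
          rw [h1]; simp only [mul_assoc]
      _ = _ := by rw [h2]; simp only [mul_assoc]
  rw [IsTraceClass, this, IsTraceClass]

/-- The continuous functional calculus acts on eigenvectors by evaluation at the eigenvalue. -/
theorem cfc_apply_eigenvector {B : H →L[ℂ] H} (hB : IsSelfAdjoint B) {μ : ℝ} {v : H} (hv : v ≠ 0)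
    (h : B v = (μ : ℂ) • v) (f : ℝ → ℝ) (hf : ContinuousOn f (spectrum ℝ B)) :
    cfc f B v = (f μ : ℂ) • v := by
  have hμ : μ ∈ spectrum ℝ B := by
    intro hu
    rw [spectrum.mem_resolventSet_iff] at hu
    obtain ⟨u, hu⟩ := hu
    have h0 : (u : H →L[ℂ] H) v = 0 := by
      rw [hu, Algebra.algebraMap_eq_smul_one]
      simp [h]
    have h1 : ((↑u⁻¹ : H →L[ℂ] H) * u) v = 0 := by
      rw [mul_apply_eq_comp, h0, map_zero]
    rw [Units.inv_mul] at h1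
    exact hv h1
  have key : ∀ g : C(spectrum ℝ B, ℝ), cfcHom hB g v = (g ⟨μ, hμ⟩ : ℂ) • v := by
    intro g
    induction g using ContinuousMap.induction_on_of_compact with
    | const r =>
      have : (ContinuousMap.const (spectrum ℝ B) r) = algebraMap ℝ C(spectrum ℝ B, ℝ) r := rfl
      rw [this, AlgHomClass.commutes, Algebra.algebraMap_eq_smul_one]
      simp
    | id =>
      have := cfcHom_id (R := ℝ) hB
      change (cfcHom hB (ContinuousMap.restrict (spectrum ℝ B) (ContinuousMap.id ℝ))) v = _
      rw [this, h]; rfl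
    | star_id =>
      have := cfcHom_id (R := ℝ) hB
      rw [star_trivial]
      rw [this, h]; rfl
    | add f g hf hg =>
      rw [map_add, add_apply, hf, hg, ← add_smul]; simp
    | mul f g hf hg =>
      rw [map_mul, mul_apply_eq_comp, hg, map_smul, hf, smul_smul]
      simp [mul_comm]
    | frequently f hf =>
      have hcl : IsClosed {g : C(spectrum ℝ B, ℝ) | cfcHom hB g v = (g ⟨μ, hμ⟩ : ℂ) • v} := by
        refine isClosed_eq ?_ ?_
        · exact (ContinuousLinearMap.apply ℂ H v).continuous.comp (cfcHom_continuous hB)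
        · have : Continuous fun g : C(spectrum ℝ B, ℝ) => g ⟨μ, hμ⟩ := continuous_eval_const _
          fun_prop
      exact hcl.closure_subset (mem_closure_iff_frequently.2 hf)
  rw [cfc_apply f B hB hf, key]
  rfl

theorem rpow_apply_eigenvector {B : H →L[ℂ] H} (hB : 0 ≤ B) {μ : ℝ} {v : H} (hv : v ≠ 0)
    (h : B v = (μ : ℂ) • v) {y : ℝ} (hy : 0 ≤ y) :
    (B ^ y) v = ((μ ^ y : ℝ) : ℂ) • v := by
  rw [CFC.rpow_eq_cfc_real hB]
  exact cfc_apply_eigenvector hB.isSelfAdjoint hv h _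
    (Real.continuous_rpow_const hy).continuousOn

end HilbertSchmidt

/-! ### Bounded and maximal unbounded diagonal operators. -/

section Diagonal

variable {H : Type*} [NormedAddCommGroup H] [InnerProductSpace ℂ H] [CompleteSpace H]
variable (b : HilbertBasis ℕ ℂ H)

theorem mat_eq_ite_of_apply {T : H →L[ℂ] H} {w : ℕ → ℂ} (hT : ∀ n, T (b n) = w n • b n) (m n : ℕ) :
    mat b T m n = if m = n then w n else 0 := by
  rw [mat, hT, inner_smul_right, inner_basis]
  split_ifs <;> simp

theorem inner_diag_apply {T : H →L[ℂ] H} {w : ℕ → ℂ} (hT : ∀ n, T (b n) = w n • b n) (x : H) (n : ℕ) :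
    inner ℂ (b n) (T x) = w n * inner ℂ (b n) x := by
  have h := hasSum_mat_apply b T x n
  have h2 := hasSum_single (f := fun m => mat b T n m * inner ℂ (b m) x) n fun m hm => by
    rw [mat_eq_ite_of_apply b hT, if_neg hm.symm, zero_mul]
  rw [h.unique h2, mat_eq_ite_of_apply b hT, if_pos rfl]

theorem mat_diag_mul {T : H →L[ℂ] H} {w : ℕ → ℂ} (hT : ∀ n, T (b n) = w n • b n) (S : H →L[ℂ] H)
    (m n : ℕ) : mat b (T * S) m n = w m * mat b S m n :=
  inner_diag_apply b hT _ _

theorem mat_mul_diag {T : H →L[ℂ] H} {w : ℕ → ℂ} (hT : ∀ n, T (b n) = w n • b n) (S : H →L[ℂ] H)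
    (m n : ℕ) : mat b (S * T) m n = mat b S m n * w n := by
  rw [mat, mul_apply_eq_comp, hT, map_smul, inner_smul_right, mul_comm]; rfl

theorem exists_diag (w : ℕ → ℂ) (C : ℝ) (hw : ∀ n, ‖w n‖ ≤ C) :
    ∃ T : H →L[ℂ] H, ∀ n, T (b n) = w n • b n := by
  have hC : 0 ≤ C := (norm_nonneg _).trans (hw 0)
  obtain ⟨T, hT⟩ := exists_clm_homogeneous b 0 (fun m n => if m = n then w n else 0) C
    (fun m n h => if_neg fun h2 => h (by simp [h2])) (fun m n => by
      split_ifs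
      · exact hw n
      · simpa using hC)
  refine ⟨T, fun n => basis_ext b fun m => ?_⟩
  rw [inner_smul_right, inner_basis]
  refine (hT m n).trans ?_
  split_ifs <;> simp

theorem star_diag {T : H →L[ℂ] H} {w : ℕ → ℝ} (hT : ∀ n, T (b n) = (w n : ℂ) • b n) : star T = T := by
  refine mat_ext b fun m n => ?_
  rw [mat_star, mat_eq_ite_of_apply b hT, mat_eq_ite_of_apply b hT]
  by_cases h : m = n
  · simp [h]
  · simp [h, Ne.symm h]

/-- `P` is the maximal diagonal operator with the given eigenvalues. -/
def IsDiag (P : H →ₗ.[ℂ] H) (w : ℕ → ℝ) : Prop :=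
  ∀ x y, (x, y) ∈ P.graph ↔ ∀ n, inner ℂ (b n) y = (w n : ℂ) * inner ℂ (b n) x

theorem mem_graph_iff {P : H →ₗ.[ℂ] H} {x y : H} :
    (x, y) ∈ P.graph ↔ ∃ h : x ∈ P.domain, P ⟨x, h⟩ = y := by
  rw [LinearPMap.mem_graph_iff]
  constructor
  · rintro ⟨⟨z, hz⟩, rfl, rfl⟩; exact ⟨hz, rfl⟩
  · rintro ⟨h, rfl⟩; exact ⟨⟨x, h⟩, rfl, rfl⟩

variable {b}

theorem IsDiag.mem_domain_iff {P : H →ₗ.[ℂ] H} {w : ℕ → ℝ} (hP : IsDiag b P w) {x : H} :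
    x ∈ P.domain ↔ ∃ y, ∀ n, inner ℂ (b n) y = (w n : ℂ) * inner ℂ (b n) x := by
  constructor
  · intro h
    exact ⟨P ⟨x, h⟩, (hP _ _).1 (mem_graph_iff.2 ⟨h, rfl⟩)⟩
  · rintro ⟨y, hy⟩
    exact (mem_graph_iff.1 ((hP _ _).2 hy)).1

theorem IsDiag.inner_apply {P : H →ₗ.[ℂ] H} {w : ℕ → ℝ} (hP : IsDiag b P w) {x : H} (h : x ∈ P.domain)
    (n : ℕ) : inner ℂ (b n) (P ⟨x, h⟩) = (w n : ℂ) * inner ℂ (b n) x :=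
  (hP _ _).1 (mem_graph_iff.2 ⟨h, rfl⟩) n

theorem IsDiag.basis_mem {P : H →ₗ.[ℂ] H} {w : ℕ → ℝ} (hP : IsDiag b P w) (n : ℕ) : b n ∈ P.domain := by
  refine hP.mem_domain_iff.2 ⟨(w n : ℂ) • b n, fun m => ?_⟩
  rw [inner_smul_right, inner_basis]
  split_ifs with h
  · rw [h]
  · simp

theorem dense_of_basis_mem {V : Submodule ℂ H} (h : ∀ n, b n ∈ V) : Dense (V : Set H) := by
  refine (Submodule.dense_iff_topologicalClosure_eq_top.mpr b.dense_span).mono ?_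
  exact Submodule.span_le.2 (by rintro _ ⟨n, rfl⟩; exact h n)

/-- Testing the adjoint on basis vectors gives the same coefficientwise relation, as the weights are
real. The graph of `P` consists of all pairs satisfying that relation, so the adjoint cannot be
larger. -/
theorem IsDiag.isSelfAdjoint {P : H →ₗ.[ℂ] H} {w : ℕ → ℝ} (hP : IsDiag b P w) : IsSelfAdjoint P := by
  have hd : Dense (P.domain : Set H) := dense_of_basis_mem hP.basis_mem
  rw [LinearPMap.isSelfAdjoint_def]
  refine LinearPMap.eq_of_eq_graph ?_
  ext ⟨y, z⟩
  rw [hP]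
  constructor
  · intro h n
    obtain ⟨hy, rfl⟩ := mem_graph_iff.1 h
    have h1 := LinearPMap.adjoint_isFormalAdjoint hd ⟨y, hy⟩ ⟨b n, hP.basis_mem n⟩
    have h2 : P ⟨b n, hP.basis_mem n⟩ = (w n : ℂ) • b n := by
      refine basis_ext b fun m => ?_
      rw [hP.inner_apply, inner_smul_right, inner_basis]
      split_ifs with h
      · rw [h]
      · simp
    rw [h2, inner_smul_right] at h1
    rw [← inner_conj_symm, h1, map_mul, inner_conj_symm, Complex.conj_ofReal]
  · intro h
    have h1 : ∀ x : P.domain, inner ℂ z (x : H) = inner ℂ y (P x) := by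
      rintro ⟨x, hx⟩
      have e1 := b.hasSum_inner_mul_inner z x
      have e2 := b.hasSum_inner_mul_inner y (P ⟨x, hx⟩)
      refine e1.unique ?_
      convert! e2 using 2 with n
      rw [hP.inner_apply, ← inner_conj_symm, h, ← inner_conj_symm y, map_mul, Complex.conj_ofReal]
      ring
    have hy := LinearPMap.mem_adjoint_domain_of_exists y ⟨z, h1⟩
    exact mem_graph_iff.2 ⟨hy, LinearPMap.adjoint_apply_eq hd ⟨y, hy⟩ h1⟩

theorem closure_eq_self {P : H →ₗ.[ℂ] H} (hP : P.IsClosed) : P.closure = P := by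
  refine LinearPMap.eq_of_eq_graph ?_
  rw [← hP.isClosable.graph_closure_eq_closure_graph]
  exact IsClosed.submodule_topologicalClosure_eq hP

theorem IsDiag.isEssentiallySelfAdjoint {P : H →ₗ.[ℂ] H} {w : ℕ → ℝ} (hP : IsDiag b P w) :
    IsEssentiallySelfAdjoint P := by
  have h := hP.isSelfAdjoint
  have hc := h.isClosed
  exact ⟨h.dense_domain, hc.isClosable, by rw [closure_eq_self hc]; exact h⟩

end Diagonal

/-! ### Powers of 1 + N, Sobolev spaces and iterated commutators for eigenvalues 2n + 1. -/

section Oscillator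

variable {H : Type*} [NormedAddCommGroup H] [InnerProductSpace ℂ H] [CompleteSpace H]
variable {b : HilbertBasis ℕ ℂ H} {N : H →ₗ.[ℂ] H}

/-- The eigenvalues of `(1 + N)^(1/2)`, where `N` has the eigenvalues `2 n + 1`. -/
def lam (n : ℕ) : ℝ := Real.sqrt (2 * n + 2)

theorem lam_sq (n : ℕ) : lam n ^ 2 = 2 * n + 2 := Real.sq_sqrt (by positivity)

theorem one_le_lam (n : ℕ) : 1 ≤ lam n := Real.one_le_sqrt.2 (by linarith [n.cast_nonneg (α := ℝ)])

theorem lam_pos (n : ℕ) : 0 < lam n := zero_lt_one.trans_le (one_le_lam n)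

theorem lam_rpow_neg_le_one (n : ℕ) {s : ℝ} (hs : 0 ≤ s) : lam n ^ (-s) ≤ 1 :=
  Real.rpow_le_one_of_one_le_of_nonpos (one_le_lam n) (by linarith)

theorem isInvOnePlus_unique {B B' : H →L[ℂ] H} (h : IsInvOnePlus N B) (h' : IsInvOnePlus N B') :
    B = B' := by
  ext x
  obtain ⟨h1, h2⟩ := h.1 x
  conv_rhs => rw [← h2]
  exact (h'.2 ⟨B x, h1⟩).symm

theorem exists_lam_diag {s : ℝ} (hs : 0 ≤ s) (b : HilbertBasis ℕ ℂ H) :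
    ∃ T : H →L[ℂ] H, ∀ n, T (b n) = ((lam n ^ (-s) : ℝ) : ℂ) • b n := by
  refine exists_diag b _ 1 fun n => ?_
  rw [Complex.norm_real, Real.norm_of_nonneg (Real.rpow_nonneg (lam_pos n).le _)]
  exact lam_rpow_neg_le_one n hs

theorem invOnePlus_apply (hN : IsDiag b N fun n => 2 * n + 1) (n : ℕ) :
    invOnePlus N (b n) = ((lam n ^ (-2 : ℝ) : ℝ) : ℂ) • b n := by
  obtain ⟨B, hB⟩ := exists_lam_diag (s := 2) (by norm_num) b
  have hl : ∀ n, ((lam n ^ (-2 : ℝ) : ℝ) : ℂ) * (2 * n + 2) = 1 := by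
    intro n
    have : lam n ^ (-2 : ℝ) * (2 * n + 2) = 1 := by
      rw [Real.rpow_neg (lam_pos n).le, Real.rpow_two, lam_sq, inv_mul_cancel₀ (by positivity)]
    exact_mod_cast this
  have hinv : IsInvOnePlus N B := by
    constructor
    · intro x
      have h1 : (B x, x - B x) ∈ N.graph := by
        rw [hN]
        intro n
        rw [inner_sub_right, inner_diag_apply b hB]
        push_cast
        linear_combination -(hl n) * inner ℂ (b n) x
      obtain ⟨h, h2⟩ := mem_graph_iff.1 h1
      exact ⟨h, by rw [h2]; abel⟩
    · rintro ⟨y, hy⟩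
      refine basis_ext b fun n => ?_
      rw [inner_diag_apply b hB, inner_add_right, hN.inner_apply]
      push_cast
      linear_combination (hl n) * inner ℂ (b n) y
  have hex : ∃ B, IsInvOnePlus N B := ⟨B, hinv⟩
  have : invOnePlus N = B := by
    rw [invOnePlus, dif_pos hex]
    exact isInvOnePlus_unique hex.choose_spec hinv
  rw [this, hB]

theorem negPow_apply (hN : IsDiag b N fun n => 2 * n + 1) {s : ℝ} (hs : 0 ≤ s) (n : ℕ) :
    negPow N s (b n) = ((lam n ^ (-s) : ℝ) : ℂ) • b n := by
  -- The real power is a meaningful functional calculus only for a positive operator; positivity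
  -- comes from the diagonal square root Λ⁻¹.
  have hpos : 0 ≤ invOnePlus N := by
    obtain ⟨C, hC⟩ := exists_lam_diag (s := 1) (by norm_num) b
    have : invOnePlus N = star C * C := by
      rw [star_diag b hC]
      refine clm_ext_basis b fun n => ?_
      rw [invOnePlus_apply hN, mul_apply_eq_comp, hC, map_smul, hC, smul_smul]
      congr 1
      rw [← Complex.ofReal_mul, ← Real.rpow_add (lam_pos n)]
      norm_num
    rw [this]
    exact star_mul_self_nonneg C
  have hne : b n ≠ 0 := b.orthonormal.ne_zero n
  rw [negPow, rpow_apply_eigenvector hpos hne (invOnePlus_apply hN n) (by positivity),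
    ← Real.rpow_mul (lam_pos n).le]
  congr 3
  ring

theorem star_negPow (hN : IsDiag b N fun n => 2 * n + 1) {s : ℝ} (hs : 0 ≤ s) :
    star (negPow N s) = negPow N s :=
  star_diag b (negPow_apply hN hs)

theorem inner_negPow (hN : IsDiag b N fun n => 2 * n + 1) {s : ℝ} (hs : 0 ≤ s) (x : H) (n : ℕ) :
    inner ℂ (b n) (negPow N s x) = ((lam n ^ (-s) : ℝ) : ℂ) * inner ℂ (b n) x :=
  inner_diag_apply b (negPow_apply hN hs) x n

theorem posPow_isDiag (hN : IsDiag b N fun n => 2 * n + 1) {s : ℝ} (hs : 0 ≤ s) :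
    IsDiag b (posPow N s) fun n => lam n ^ s := by
  have hl : ∀ n, ((lam n ^ (-s) : ℝ) : ℂ) * ((lam n ^ s : ℝ) : ℂ) = 1 := by
    intro n
    rw [← Complex.ofReal_mul, ← Real.rpow_add (lam_pos n)]
    simp
  -- The graph of `LinearPMap.inverse` is the swapped graph only when the map is injective.
  have hker : LinearMap.ker (ofBdd (negPow N s)).toFun = ⊥ := by
    rw [LinearMap.ker_eq_bot']
    rintro ⟨x, hx⟩ h
    have h' : negPow N s x = 0 := h
    refine Subtype.ext (basis_ext b fun n => ?_)
    have h2 := inner_negPow hN hs x n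
    rw [h', inner_zero_right] at h2
    change inner ℂ (b n) x = inner ℂ (b n) 0
    rw [inner_zero_right]
    linear_combination -((lam n ^ s : ℝ) : ℂ) * h2 - inner ℂ (b n) x * hl n
  intro x y
  have h0 : (x, y) ∈ (posPow N s).graph ↔ negPow N s y = x := by
    rw [posPow, LinearPMap.inverse_graph hker]
    simp only [Submodule.mem_map, Prod.exists]
    constructor
    · rintro ⟨u, v, huv, h⟩
      obtain ⟨rfl, rfl⟩ := Prod.mk.inj h
      obtain ⟨_, h2⟩ := mem_graph_iff.1 huv
      exact h2
    · rintro h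
      exact ⟨y, x, mem_graph_iff.2 ⟨trivial, h⟩, rfl⟩
  rw [h0]
  constructor
  · rintro rfl n
    rw [inner_negPow hN hs]
    linear_combination -(hl n) * inner ℂ (b n) y
  · intro h
    refine basis_ext b fun n => ?_
    rw [inner_negPow hN hs, h]
    linear_combination (hl n) * inner ℂ (b n) x

theorem mem_sobolev_iff (hN : IsDiag b N fun n => 2 * n + 1) (l : ℕ) (x : H) :
    x ∈ sobolev N l ↔ ∃ y, ∀ n, inner ℂ (b n) y = ((lam n ^ l : ℝ) : ℂ) * inner ℂ (b n) x := by
  rw [sobolev, (posPow_isDiag hN (Nat.cast_nonneg l)).mem_domain_iff]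
  simp only [Real.rpow_natCast]

theorem mem_smoothVectors_iff (x : H) :
    x ∈ smoothVectors N ↔ ∀ l, x ∈ sobolev N l := by
  simp [smoothVectors, Submodule.mem_iInf]

variable (b) in
/-- `S` is the `k`-th iterated commutator of `T` with `(1 + N)^(1/2)`, in terms of matrices. -/
def DelPow (k : ℕ) (T S : H →L[ℂ] H) : Prop :=
  ∀ m n, mat b S m n = ((lam m - lam n : ℝ) : ℂ) ^ k * mat b T m n

theorem DelPow.zero_eq {T S : H →L[ℂ] H} (h : DelPow b 0 T S) : S = T :=
  mat_ext b fun m n => by simpa using h m n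

/-- The coefficient form of ΛTx = Sx + TΛx, with y in the role of Λx. It does not presuppose that Tx
lies in the domain of Λ, which is what it will be used to prove. -/
theorem DelPow.commutator {T S : H →L[ℂ] H} (h : DelPow b 1 T S) {x y : H}
    (hy : ∀ n, inner ℂ (b n) y = (lam n : ℂ) * inner ℂ (b n) x) (m : ℕ) :
    inner ℂ (b m) (S x + T y) = (lam m : ℂ) * inner ℂ (b m) (T x) := by
  have h1 := hasSum_mat_apply b S x m
  have h2 := hasSum_mat_apply b T y m
  have h3 := (hasSum_mat_apply b T x m).mul_left (lam m : ℂ)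
  rw [inner_add_right]
  refine (h1.add h2).unique ?_
  convert! h3 using 2 with n
  rw [h m n, hy n]
  push_cast
  ring

/-- If x is in H_{l+1}, then x and Λx are in H_l, hence so is ΛTx = Sx + TΛx, which means Tx ∈
H_{l+1}. -/
theorem DelPow.map_sobolev_succ (hN : IsDiag b N fun n => 2 * n + 1) {T S : H →L[ℂ] H} (h : DelPow b 1 T S)
    {l : ℕ} (hT : ∀ x ∈ sobolev N l, T x ∈ sobolev N l) (hS : ∀ x ∈ sobolev N l, S x ∈ sobolev N l) {x : H}
    (hx : x ∈ sobolev N (l + 1)) : T x ∈ sobolev N (l + 1) := by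
  obtain ⟨z, hz⟩ := (mem_sobolev_iff hN _ _).1 hx
  have hl : ∀ n, (lam n : ℂ) ≠ 0 := fun n => by exact_mod_cast (lam_pos n).ne'
  have h1 : ∀ n, 1 ≤ lam n := one_le_lam
  have hn : ∀ k ≤ l + 1, ∃ y, ∀ n, inner ℂ (b n) y = ((lam n ^ k : ℝ) : ℂ) * inner ℂ (b n) x := by
    intro k hk
    refine exists_of_norm_le b z 1 fun n => ?_
    rw [hz, one_mul, norm_mul, norm_mul, Complex.norm_real, Complex.norm_real]
    gcongr
    rw [Real.norm_of_nonneg (by have := h1 n; positivity), Real.norm_of_nonneg (by have := h1 n; positivity)]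
    exact pow_le_pow_right₀ (h1 n) hk
  obtain ⟨y, hy⟩ := hn 1 (by omega)
  have hxl : x ∈ sobolev N l := (mem_sobolev_iff hN _ _).2 (hn l (by omega))
  have hyl : y ∈ sobolev N l := (mem_sobolev_iff hN _ _).2 ⟨z, fun n => by
    rw [hz, hy]; push_cast; ring⟩
  obtain ⟨w, hw⟩ := (mem_sobolev_iff hN _ _).1 ((sobolev N l).add_mem (hS x hxl) (hT y hyl))
  refine (mem_sobolev_iff hN _ _).2 ⟨w, fun n => ?_⟩
  rw [hw, h.commutator (y := y) (by simpa using hy)]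
  push_cast
  ring

variable (b) in
/-- All iterated commutators of `T` with `(1 + N)^(1/2)` lie in `E`. -/
def HasDeltas (E : Set (H →L[ℂ] H)) (T : H →L[ℂ] H) : Prop :=
  ∀ k, ∃ S ∈ E, DelPow b k T S

theorem HasDeltas.mono {E F : Set (H →L[ℂ] H)} (hEF : E ⊆ F) {T : H →L[ℂ] H} (h : HasDeltas b E T) :
    HasDeltas b F T := fun k => by
  obtain ⟨S, hS, h2⟩ := h k
  exact ⟨S, hEF hS, h2⟩

theorem HasDeltas.mem {E : Set (H →L[ℂ] H)} {T : H →L[ℂ] H} (h : HasDeltas b E T) : T ∈ E := by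
  obtain ⟨S, hS, h2⟩ := h 0
  rwa [← h2.zero_eq]

theorem DelPow.of_le {j k : ℕ} {T S S' : H →L[ℂ] H} (h : DelPow b j T S) (h' : DelPow b (j + k) T S') :
    DelPow b k S S' := fun m n => by rw [h', h]; ring

theorem HasDeltas.of_delPow {E : Set (H →L[ℂ] H)} {T S : H →L[ℂ] H} (h : HasDeltas b E T) {j : ℕ}
    (hS : DelPow b j T S) : HasDeltas b E S := fun k => by
  obtain ⟨S', hE, h2⟩ := h (j + k)
  exact ⟨S', hE, hS.of_le h2⟩

/-- The operator is quantified inside the induction on l, because the step needs the previous level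
for δ(T) as well as for T. -/
theorem HasDeltas.map_sobolev (hN : IsDiag b N fun n => 2 * n + 1) {E : Set (H →L[ℂ] H)} (l : ℕ) :
    ∀ {T : H →L[ℂ] H}, HasDeltas b E T → ∀ x ∈ sobolev N l, T x ∈ sobolev N l := by
  induction l with
  | zero => exact fun {T} _ x _ => (mem_sobolev_iff hN _ _).2 ⟨T x, by simp⟩
  | succ l ih =>
    intro T hT x hx
    obtain ⟨S, hE, hS⟩ := hT 1
    exact hS.map_sobolev_succ hN (ih hT) (ih (hT.of_delPow hS)) hx

theorem HasDeltas.map_smoothVectors (hN : IsDiag b N fun n => 2 * n + 1) {E : Set (H →L[ℂ] H)}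
    {T : H →L[ℂ] H} (hT : HasDeltas b E T) {x : H} (hx : x ∈ smoothVectors N) : T x ∈ smoothVectors N :=
  (mem_smoothVectors_iff _).2 fun l =>
    hT.map_sobolev hN l x ((mem_smoothVectors_iff _).1 hx l)

theorem DelPow.agreesOn (hN : IsDiag b N fun n => 2 * n + 1) {T S : H →L[ℂ] H} (h : DelPow b 1 T S) :
    AgreesOn (comm (posPow N 1) (ofBdd T)) (smoothVectors N) S := by
  intro x hx
  have hd := posPow_isDiag hN zero_le_one
  have hx1 : x ∈ (posPow N 1).domain := by
    have := (mem_smoothVectors_iff _).1 hx 1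
    simpa [sobolev] using this
  have hTx : (T x, S x + T (posPow N 1 ⟨x, hx1⟩)) ∈ (posPow N 1).graph := by
    rw [hd]
    intro m
    simp only [Real.rpow_one]
    exact h.commutator (fun n => by rw [hd.inner_apply]; simp) m
  obtain ⟨h1, h2⟩ := mem_graph_iff.1 hTx
  refine ⟨⟨⟨trivial, h1⟩, ⟨hx1, trivial⟩⟩, ?_⟩
  change posPow N 1 ⟨T x, h1⟩ - T (posPow N 1 ⟨x, hx1⟩) = S x
  rw [h2]
  abel

theorem HasDeltas.isDeltaIter (hN : IsDiag b N fun n => 2 * n + 1) {E : Set (H →L[ℂ] H)} {T : H →L[ℂ] H}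
    (hT : HasDeltas b E T) (k : ℕ) : ∀ {S}, DelPow b k T S → IsDeltaIter N k T S := by
  induction k with
  | zero => exact fun h => h.zero_eq
  | succ k ih =>
    intro S hS
    obtain ⟨T', -, hT'⟩ := hT k
    exact ⟨T', ih hT', (hT'.of_le hS).agreesOn hN⟩

theorem HasDeltas.mem_OP0 (hN : IsDiag b N fun n => 2 * n + 1) {E : Set (H →L[ℂ] H)} {T : H →L[ℂ] H}
    (hT : HasDeltas b E T) : T ∈ OP0 N :=
  ⟨fun _ hx => hT.map_smoothVectors hN hx, fun k => by
    obtain ⟨S, -, hS⟩ := hT k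
    exact ⟨S, hT.isDeltaIter hN k hS⟩⟩

theorem HasDeltas.mem_B1smooth (hN : IsDiag b N fun n => 2 * n + 1) {p : ℝ} {T : H →L[ℂ] H}
    (hT : HasDeltas b (B1 N p) T) : T ∈ B1smooth N p :=
  ⟨fun l _ hx => hT.map_sobolev hN l _ hx, fun k => by
    obtain ⟨S, hE, hS⟩ := hT k
    exact ⟨S, hE, hT.isDeltaIter hN k hS⟩⟩

theorem HasDeltas.add {E : Submodule ℂ (H →L[ℂ] H)} {T T' : H →L[ℂ] H} (hT : HasDeltas b E T)
    (hT' : HasDeltas b E T') : HasDeltas b E (T + T') := fun k => by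
  obtain ⟨S, hE, hS⟩ := hT k
  obtain ⟨S', hE', hS'⟩ := hT' k
  exact ⟨S + S', E.add_mem hE hE', fun m n => by rw [mat_add, mat_add, hS, hS']; ring⟩

theorem HasDeltas.smul {E : Submodule ℂ (H →L[ℂ] H)} (c : ℂ) {T : H →L[ℂ] H} (hT : HasDeltas b E T) :
    HasDeltas b E (c • T) := fun k => by
  obtain ⟨S, hE, hS⟩ := hT k
  exact ⟨c • S, E.smul_mem c hE, fun m n => by rw [mat_smul, mat_smul, hS]; ring⟩

theorem HasDeltas.zero (E : Submodule ℂ (H →L[ℂ] H)) : HasDeltas b E (0 : H →L[ℂ] H) := fun k =>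
  ⟨0, E.zero_mem, fun m n => by simp [mat_zero]⟩

theorem mat_sum {ι : Type*} (s : Finset ι) (T : ι → H →L[ℂ] H) (m n : ℕ) :
    mat b (∑ i ∈ s, T i) m n = ∑ i ∈ s, mat b (T i) m n := by
  classical
  induction s using Finset.induction_on with
  | empty => simp [mat_zero]
  | insert i s hi ih => rw [Finset.sum_insert hi, Finset.sum_insert hi, mat_add, ih]

/-- Leibniz rule. -/
theorem HasDeltas.mul {E : Set (H →L[ℂ] H)} {F : Submodule ℂ (H →L[ℂ] H)}
    (hEF : ∀ S ∈ E, ∀ S' ∈ E, S * S' ∈ F) {T T' : H →L[ℂ] H} (hT : HasDeltas b E T) (hT' : HasDeltas b E T') :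
    HasDeltas b F (T * T') := by
  intro k
  choose S hE hS using hT
  choose S' hE' hS' using hT'
  refine ⟨∑ i ∈ Finset.range (k + 1), ((k.choose i : ℕ) : ℂ) • (S i * S' (k - i)),
    F.sum_mem fun i _ => F.smul_mem _ (hEF _ (hE i) _ (hE' _)), fun m n => ?_⟩
  rw [mat_sum]
  simp only [mat_smul]
  have h1 := hasSum_sum (s := Finset.range (k + 1)) fun i _ =>
    (hasSum_mat_mul b (S i) (S' (k - i)) m n).mul_left ((k.choose i : ℕ) : ℂ)
  refine h1.unique ?_
  convert! (hasSum_mat_mul b T T' m n).mul_left (((lam m - lam n : ℝ) : ℂ) ^ k) using 2 with l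
  -- Inserting the intermediate index l splits the difference, so the binomial theorem on matrix
  -- entries is the Leibniz rule.
  have : ((lam m - lam n : ℝ) : ℂ) = ((lam m - lam l : ℝ) : ℂ) + ((lam l - lam n : ℝ) : ℂ) := by
    push_cast; ring
  rw [this, add_pow, Finset.sum_mul]
  refine Finset.sum_congr rfl fun i _ => ?_
  rw [hS, hS']
  ring

/-! ### Square integrable operators -/


/-- The bounded operators which are square integrable with respect to the weights with parameter
`s > p`, expressed with Hilbert-Schmidt norms. -/
def HSB2 (b : HilbertBasis ℕ ℂ H) (N : H →ₗ.[ℂ] H) (p : ℝ) : Submodule ℂ (H →L[ℂ] H) where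
  carrier := {T | ∀ s, p < s → hs b (T * negPow N (s / 2)) < ⊤ ∧ hs b (star T * negPow N (s / 2)) < ⊤}
  zero_mem' := fun s _ => by simp [hs_zero]
  add_mem' := fun {T S} hT hS s h => by
    rw [star_add, add_mul, add_mul]
    exact ⟨hs_add_lt_top b (hT s h).1 (hS s h).1, hs_add_lt_top b (hT s h).2 (hS s h).2⟩
  smul_mem' := fun c {T} hT s h => by
    rw [star_smul, smul_mul_assoc, smul_mul_assoc]
    exact ⟨hs_smul_lt_top b _ (hT s h).1, hs_smul_lt_top b _ (hT s h).2⟩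

theorem weight_le_hs (hN : IsDiag b N fun n => 2 * n + 1) {s : ℝ} (h : 0 ≤ s) (T : H →L[ℂ] H) :
    weight N s (star T * T) ≤ hs b (T * negPow N (s / 2)) := by
  have h1 : negPow N (s / 2) * (star T * T) * negPow N (s / 2)
      = star (T * negPow N (s / 2)) * (T * negPow N (s / 2)) := by
    rw [star_mul, star_negPow hN (by positivity)]
    simp only [mul_assoc]
  rw [weight, h1]
  exact posTrace_star_mul_self_le b _

theorem HSB2_le_B2 (hN : IsDiag b N fun n => 2 * n + 1) {p : ℝ} (hp : 0 ≤ p) :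
    (HSB2 b N p : Set (H →L[ℂ] H)) ⊆ B2 N p := by
  intro T hT s h
  have h1 := weight_le_hs hN (hp.trans h.le) T
  have h2 := weight_le_hs hN (hp.trans h.le) (star T)
  rw [star_star] at h2
  exact ⟨h1.trans_lt (hT s h).1, h2.trans_lt (hT s h).2⟩

/-- Constant sequences suffice: their differences vanish, and the empty representation of 0 shows
that its P-norm is not positive. -/
theorem B2sq_subset_B1 (p : ℝ) : (B2sq N p : Set (H →L[ℂ] H)) ⊆ B1 N p := by
  intro T hT
  refine ⟨fun _ => T, fun _ => hT, fun n _ ε hε => ⟨0, fun k _ l _ => ?_⟩, tendsto_const_nhds⟩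
  refine lt_of_le_of_lt (csInf_le ⟨0, ?_⟩ ?_) hε
  · rintro r ⟨k, T₁, T₂, -, -, -, rfl⟩
    exact Finset.sum_nonneg fun i _ => mul_nonneg (Real.sqrt_nonneg _) (Real.sqrt_nonneg _)
  · exact ⟨0, Fin.elim0, Fin.elim0, fun i => i.elim0, fun i => i.elim0, by simp, by simp⟩

theorem HasDeltas.mul_mem_B2sq (hN : IsDiag b N fun n => 2 * n + 1) {p : ℝ} (hp : 0 ≤ p)
    {T T' : H →L[ℂ] H} (hT : HasDeltas b (HSB2 b N p) T) (hT' : HasDeltas b (HSB2 b N p) T') :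
    HasDeltas b (B2sq N p) (T * T') :=
  HasDeltas.mul (E := HSB2 b N p) (F := B2sq N p) (fun S hS S' hS' => Submodule.subset_span
    ⟨S, HSB2_le_B2 hN hp hS, S', HSB2_le_B2 hN hp hS', rfl⟩) hT hT'

/-- The matrix of `T` is concentrated on the `d`-th diagonal. -/
def IsHomogeneous (b : HilbertBasis ℕ ℂ H) (d : ℤ) (T : H →L[ℂ] H) : Prop :=
  ∀ m n : ℕ, (m : ℤ) ≠ n + d → mat b T m n = 0

theorem IsHomogeneous.star {d : ℤ} {T : H →L[ℂ] H} (h : IsHomogeneous b d T) :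
    IsHomogeneous b (-d) (star T) := fun m n hmn => by
  rw [mat_star, h n m (by omega), star_zero]

theorem norm_mat_le (T : H →L[ℂ] H) (m n : ℕ) : ‖mat b T m n‖ ≤ ‖T‖ := by
  refine (norm_inner_le_norm _ _).trans ?_
  rw [b.orthonormal.norm_eq_one, one_mul]
  exact (T.le_opNorm _).trans (by rw [b.orthonormal.norm_eq_one, mul_one])

theorem lam_le_mul_lam (d : ℤ) {m n : ℕ} (h : (m : ℤ) = n + d) : lam m ≤ (1 + |(d : ℝ)|) * lam n := by
  have h1 : (m : ℝ) = n + d := by exact_mod_cast h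
  refine Real.sqrt_le_iff.2 ⟨by have := lam_pos n; positivity, ?_⟩
  rw [mul_pow, lam_sq, h1]
  have h2 := le_abs_self (d : ℝ)
  have h3 := abs_nonneg (d : ℝ)
  have h4 : (0 : ℝ) ≤ n := n.cast_nonneg
  nlinarith [mul_nonneg h3 h4, sq_nonneg (|(d : ℝ)|), mul_nonneg (sq_nonneg (|(d : ℝ)|)) h4]

/-- A homogeneous operator can be moved past a power of `1 + N`. -/
theorem IsHomogeneous.exists_mul_negPow (hN : IsDiag b N fun n => 2 * n + 1) {d : ℤ} {T : H →L[ℂ] H}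
    (h : IsHomogeneous b d T) {s : ℝ} (hs : 0 ≤ s) :
    ∃ T' : H →L[ℂ] H, T * negPow N s = negPow N s * T' := by
  obtain ⟨T', hT'⟩ := exists_clm_homogeneous b d
    (fun m n => ((lam m ^ s : ℝ) : ℂ) * mat b T m n * ((lam n ^ (-s) : ℝ) : ℂ))
    ((1 + |(d : ℝ)|) ^ s * ‖T‖) (fun m n hmn => by simp [h m n hmn]) (fun m n => by
      by_cases hmn : (m : ℤ) = n + d
      · rw [norm_mul, norm_mul, Complex.norm_real, Complex.norm_real,
          Real.norm_of_nonneg (Real.rpow_nonneg (lam_pos m).le _),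
          Real.norm_of_nonneg (Real.rpow_nonneg (lam_pos n).le _)]
        have h1 : lam m ^ s ≤ (1 + |(d : ℝ)|) ^ s * lam n ^ s := by
          rw [← Real.mul_rpow (by positivity) (lam_pos n).le]
          exact Real.rpow_le_rpow (lam_pos m).le (lam_le_mul_lam d hmn) hs
        have h2 : lam n ^ s * lam n ^ (-s) = 1 := by
          rw [← Real.rpow_add (lam_pos n)]; simp
        have h3 := Real.rpow_nonneg (lam_pos n).le (-s)
        calc lam m ^ s * ‖mat b T m n‖ * lam n ^ (-s)
            ≤ ((1 + |(d : ℝ)|) ^ s * lam n ^ s) * ‖T‖ * lam n ^ (-s) := by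
              gcongr
              · have := lam_pos n
                positivity
              · exact norm_mat_le T m n
          _ = (1 + |(d : ℝ)|) ^ s * ‖T‖ * (lam n ^ s * lam n ^ (-s)) := by ring
          _ = _ := by rw [h2, mul_one]
      · simp only [h m n hmn, mul_zero, zero_mul, norm_zero]
        positivity)
  refine ⟨T', mat_ext b fun m n => ?_⟩
  rw [mat_mul_diag b (negPow_apply hN hs), mat_diag_mul b (negPow_apply hN hs), hT']
  have h2 : ((lam m ^ (-s) : ℝ) : ℂ) * ((lam m ^ s : ℝ) : ℂ) = 1 := by
    rw [← Complex.ofReal_mul, ← Real.rpow_add (lam_pos m)]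
    simp
  linear_combination -(mat b T m n * ((lam n ^ (-s) : ℝ) : ℂ)) * h2

/-- On the right, Z'Λ^(−s/2) = Λ^(−s/2)Z'' with Z'' bounded, so Z' can be moved past the weight. The
rest is the ideal property of Hilbert-Schmidt operators, applied also to the adjoint. -/
theorem mul_mem_HSB2 (hN : IsDiag b N fun n => 2 * n + 1) {p : ℝ} (hp : 0 ≤ p) {d d' : ℤ}
    {Z T Z' : H →L[ℂ] H} (hZ : IsHomogeneous b d Z) (hT : T ∈ HSB2 b N p) (hZ' : IsHomogeneous b d' Z') :
    Z * T * Z' ∈ HSB2 b N p := by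
  have key : ∀ {d : ℤ} {Z T Z' : H →L[ℂ] H}, IsHomogeneous b d Z' → ∀ s, p < s →
      hs b (T * negPow N (s / 2)) < ⊤ → hs b (Z * T * Z' * negPow N (s / 2)) < ⊤ := by
    intro d Z T Z' hZ' s h hT
    obtain ⟨Z'', h2⟩ := hZ'.exists_mul_negPow hN (s := s / 2) (by linarith)
    have : Z * T * Z' * negPow N (s / 2) = Z * (T * negPow N (s / 2) * Z'') := by
      rw [mul_assoc, h2]; simp only [mul_assoc]
    rw [this]
    exact hs_mul_left_lt_top b _ (hs_mul_right_lt_top b _ hT)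
  intro s h
  refine ⟨key hZ' s h (hT s h).1, ?_⟩
  rw [star_mul, star_mul, ← mul_assoc]
  exact key hZ.star s h (hT s h).2

end Oscillator

/-! ### Schur multipliers and closure of square integrable operators under δ. -/

section Multiplier

variable {H : Type*} [NormedAddCommGroup H] [InnerProductSpace ℂ H] [CompleteSpace H]
variable {b : HilbertBasis ℕ ℂ H} {N : H →ₗ.[ℂ] H}

theorem integrableOn_mul_exp_neg {a : ℝ} (ha : 0 < a) :
    IntegrableOn (fun t : ℝ => t * Real.exp (-a * t)) (Set.Ioi 0) := by
  have h := integrableOn_rpow_mul_exp_neg_mul_rpow (s := 1) (p := 1) (by norm_num) one_pos ha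
  simpa using h

theorem integral_mul_exp_neg {a : ℝ} (ha : 0 < a) :
    ∫ t in Set.Ioi (0 : ℝ), t * Real.exp (-a * t) = 1 / a ^ 2 := by
  have h := Real.integral_rpow_mul_exp_neg_mul_Ioi (a := 2) (r := a) (by norm_num) ha
  rw [Real.Gamma_two, mul_one, Real.rpow_two, div_pow, one_pow] at h
  rw [← h]
  refine setIntegral_congr_fun measurableSet_Ioi fun t _ => ?_
  norm_num

/-- The Schur multiplier `x y / (x + y)²` is bounded. -/
theorem exists_schur_multiplier (b : HilbertBasis ℕ ℂ H) (x : ℕ → ℝ) (hx : ∀ n, 0 < x n) (T : H →L[ℂ] H) :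
    ∃ T' : H →L[ℂ] H, ∀ m n, mat b T' m n = ((x m * x n / (x m + x n) ^ 2 : ℝ) : ℂ) * mat b T m n := by
  -- The formula xy/(x+y)² = ∫₀^∞ t (x e^(−xt)) (y e^(−yt)) dt makes the new form a superposition of
  -- forms of T at the vectors `U v t` and `U u t`. Since ∫ t x² e^(−2xt) dt = 1/4, the constant is
  -- (‖T‖/2)(1/4).
  refine exists_clm_of_form b _ (‖T‖ / 8) fun s u v => ?_
  set U : (ℕ → ℂ) → ℝ → H := fun u t => ∑ n ∈ s, (((x n * Real.exp (-x n * t) : ℝ) : ℂ) * u n) • b n with hU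
  have hform : ∀ t : ℝ, ((t : ℂ)) * inner ℂ (U v t) (T (U u t)) = ∑ m ∈ s, ∑ n ∈ s,
      ((t * Real.exp (-(x m + x n) * t) : ℝ) : ℂ) * (star (v m) * (((x m * x n : ℝ) : ℂ) * mat b T m n) * u n) := by
    intro t
    simp only [hU, map_sum, map_smul, sum_inner, inner_sum, inner_smul_left, inner_smul_right, Finset.mul_sum]
    rw [Finset.sum_comm]
    refine Finset.sum_congr rfl fun m _ => Finset.sum_congr rfl fun n _ => ?_
    rw [map_mul, Complex.conj_ofReal, starRingEnd_apply]
    have : Real.exp (-(x m + x n) * t) = Real.exp (-x m * t) * Real.exp (-x n * t) := by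
      rw [← Real.exp_add]; congr 1; ring
    rw [this, mat]
    simp only [Complex.ofReal_mul]
    ring
  have hsum : ∑ m ∈ s, ∑ n ∈ s, star (v m) * (((x m * x n / (x m + x n) ^ 2 : ℝ) : ℂ) * mat b T m n) * u n
      = ∫ t in Set.Ioi (0 : ℝ), (t : ℂ) * inner ℂ (U v t) (T (U u t)) := by
    simp only [hform]
    have hint : ∀ m n, IntegrableOn (fun t : ℝ => ((t * Real.exp (-(x m + x n) * t) : ℝ) : ℂ) *
        (star (v m) * (((x m * x n : ℝ) : ℂ) * mat b T m n) * u n)) (Set.Ioi 0) := fun m n =>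
      ((integrableOn_mul_exp_neg (add_pos (hx m) (hx n))).ofReal).mul_const _
    rw [integral_finsetSum _ fun m _ => integrable_finsetSum _ fun n _ => hint m n]
    refine Finset.sum_congr rfl fun m _ => ?_
    rw [integral_finsetSum _ fun n _ => hint m n]
    refine Finset.sum_congr rfl fun n _ => ?_
    rw [integral_mul_const, integral_complex_ofReal, integral_mul_exp_neg (add_pos (hx m) (hx n))]
    push_cast
    ring
  have hnorm : ∀ (u : ℕ → ℂ) (t : ℝ), t * ‖U u t‖ ^ 2
      = ∑ n ∈ s, (t * Real.exp (-(2 * x n) * t)) * (x n ^ 2 * ‖u n‖ ^ 2) := by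
    intro u t
    have h1 : ‖U u t‖ ^ 2 = ∑ n ∈ s, ‖((x n * Real.exp (-x n * t) : ℝ) : ℂ) * u n‖ ^ 2 := by
      have h4 := inner_self_eq_norm_sq_to_K (𝕜 := ℂ) (U u t)
      rw [hU] at h4
      simp only at h4
      rw [b.orthonormal.inner_sum] at h4
      have h5 : ((‖U u t‖ ^ 2 : ℝ) : ℂ)
          = ((∑ n ∈ s, ‖((x n * Real.exp (-x n * t) : ℝ) : ℂ) * u n‖ ^ 2 : ℝ) : ℂ) := by
        push_cast
        refine h4.symm.trans (Finset.sum_congr rfl fun n _ => ?_)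
        rw [Complex.conj_mul']
        push_cast
        rfl
      exact_mod_cast h5
    rw [h1, Finset.mul_sum]
    refine Finset.sum_congr rfl fun n _ => ?_
    have : Real.exp (-(2 * x n) * t) = Real.exp (-x n * t) ^ 2 := by
      rw [← Real.exp_nat_mul]; congr 1; push_cast; ring
    rw [norm_mul, Complex.norm_real, mul_pow, Real.norm_eq_abs, sq_abs, this]
    ring
  have hintU : ∀ u, IntegrableOn (fun t : ℝ => t * ‖U u t‖ ^ 2) (Set.Ioi 0) := by
    intro u
    simp only [hnorm]
    exact integrable_finsetSum _ fun n _ =>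
      (integrableOn_mul_exp_neg (by have := hx n; positivity)).mul_const _
  have hvalU : ∀ u, ∫ t in Set.Ioi (0 : ℝ), t * ‖U u t‖ ^ 2 = (∑ n ∈ s, ‖u n‖ ^ 2) / 4 := by
    intro u
    simp only [hnorm]
    rw [integral_finsetSum _ fun n _ =>
      (integrableOn_mul_exp_neg (by have := hx n; positivity)).mul_const _, Finset.sum_div]
    refine Finset.sum_congr rfl fun n _ => ?_
    have := hx n
    rw [integral_mul_const, integral_mul_exp_neg (by positivity)]
    field_simp
    ring
  rw [hsum]
  calc ‖∫ t in Set.Ioi (0 : ℝ), (t : ℂ) * inner ℂ (U v t) (T (U u t))‖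
      ≤ ∫ t in Set.Ioi (0 : ℝ), ‖T‖ / 2 * (t * ‖U u t‖ ^ 2 + t * ‖U v t‖ ^ 2) := by
        refine norm_integral_le_of_norm_le (((hintU u).add (hintU v)).const_mul _) ?_
        refine (ae_restrict_iff' measurableSet_Ioi).2 (Filter.Eventually.of_forall fun t ht => ?_)
        have ht' : (0 : ℝ) < t := ht
        rw [norm_mul, Complex.norm_real, Real.norm_of_nonneg ht'.le]
        have h1 : ‖(inner ℂ (U v t) (T (U u t)) : ℂ)‖ ≤ ‖U v t‖ * (‖T‖ * ‖U u t‖) :=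
          (norm_inner_le_norm _ _).trans (by gcongr; exact T.le_opNorm _)
        have h2 : ‖U v t‖ * (‖T‖ * ‖U u t‖) ≤ ‖T‖ / 2 * (‖U u t‖ ^ 2 + ‖U v t‖ ^ 2) := by
          nlinarith [mul_nonneg (norm_nonneg T) (sq_nonneg (‖U u t‖ - ‖U v t‖))]
        calc _ ≤ t * (‖T‖ / 2 * (‖U u t‖ ^ 2 + ‖U v t‖ ^ 2)) := by gcongr; exact h1.trans h2
          _ = _ := by ring
    _ = _ := by
        rw [integral_const_mul, integral_add (hintU u) (hintU v), hvalU, hvalU]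
        ring

theorem hs_mul_diag_le {T T' : H →L[ℂ] H} (h : ∀ m n, ‖mat b T' m n‖ ≤ ‖mat b T m n‖) {L : H →L[ℂ] H}
    {w : ℕ → ℂ} (hL : ∀ n, L (b n) = w n • b n) : hs b (T' * L) ≤ hs b (T * L) := by
  rw [hs_eq_tsum_mat, hs_eq_tsum_mat]
  refine ENNReal.tsum_le_tsum fun n => ENNReal.tsum_le_tsum fun m => ?_
  rw [mat_mul_diag b hL, mat_mul_diag b hL]
  gcongr
  rw [← ofReal_norm, ← ofReal_norm, norm_mul, norm_mul]
  exact ENNReal.ofReal_le_ofReal (by gcongr; exact h m n)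

/-- With diagonal weights the Hilbert-Schmidt norm sees only the absolute values of the entries, so
entrywise domination is enough once boundedness is known. -/
theorem mem_HSB2_of_norm_le (hN : IsDiag b N fun n => 2 * n + 1) {p : ℝ} (hp : 0 ≤ p)
    {T T' : H →L[ℂ] H} (hT : T ∈ HSB2 b N p) (h : ∀ m n, ‖mat b T' m n‖ ≤ ‖mat b T m n‖) :
    T' ∈ HSB2 b N p := by
  intro s hs
  have hL := negPow_apply hN (s := s / 2) (by linarith)
  refine ⟨(hs_mul_diag_le h hL).trans_lt (hT s hs).1,
    (hs_mul_diag_le (fun m n => ?_) hL).trans_lt (hT s hs).2⟩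
  rw [mat_star, mat_star, norm_star, norm_star]
  exact h n m

/-- The symbol of the Schur multiplier relating commutators with `Λ` and with `Λ²`. -/
def schurWeight (m n : ℕ) : ℝ := lam m * lam n / (lam m + lam n) ^ 2

/-- Boundedness is the Schur multiplier estimate; square integrability holds because the multiplier
lies between 0 and 1. -/
theorem exists_schurWeight_mul (hN : IsDiag b N fun n => 2 * n + 1) {p : ℝ} (hp : 0 ≤ p)
    {T : H →L[ℂ] H} (hT : T ∈ HSB2 b N p) :
    ∃ T' ∈ HSB2 b N p, ∀ m n, mat b T' m n = (schurWeight m n : ℂ) * mat b T m n := by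
  obtain ⟨T', hT'⟩ := exists_schur_multiplier b lam lam_pos T
  refine ⟨T', mem_HSB2_of_norm_le hN hp hT fun m n => ?_, hT'⟩
  rw [hT', norm_mul, Complex.norm_real]
  have hm := lam_pos m
  have hn := lam_pos n
  refine mul_le_of_le_one_left (norm_nonneg _) ?_
  rw [Real.norm_of_nonneg (by positivity), div_le_one (by positivity)]
  nlinarith [mul_pos hm hn]

/-- The weights of the shifts `D` and `D*`. -/
def shiftWeight (n : ℕ) : ℝ := Real.sqrt (2 * n)

theorem shiftWeight_zero : shiftWeight 0 = 0 := by simp [shiftWeight]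

theorem shiftWeight_succ (n : ℕ) : shiftWeight (n + 1) = lam n := by
  rw [shiftWeight, lam]; push_cast; ring_nf

theorem shiftWeight_sq (n : ℕ) : shiftWeight n ^ 2 = 2 * n := Real.sq_sqrt (by positivity)

theorem shiftWeight_nonneg (n : ℕ) : 0 ≤ shiftWeight n := Real.sqrt_nonneg _

theorem shiftWeight_le_lam (n : ℕ) : shiftWeight n ≤ lam n := Real.sqrt_le_sqrt (by linarith)

/-! ### The derivations [D, ·] and [D*, ·] in matrix form. -/

variable (b) in
/-- The relations `[D, X] = X'` and `[D*, X] = -X'` in terms of matrices, where `D` and `D*` are the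
weighted shifts. -/
structure DerivRel (X X' : H →L[ℂ] H) : Prop where
  -- The truncated index n − 1 at n = 0 is harmless, since `shiftWeight 0` = 0; the same holds for m
  -- − 1 in `raise`.
  lower : ∀ m n, (shiftWeight (m + 1) : ℂ) * mat b X (m + 1) n
    - (shiftWeight n : ℂ) * mat b X m (n - 1) = mat b X' m n
  raise : ∀ m n, (shiftWeight m : ℂ) * mat b X (m - 1) n
    - (shiftWeight (n + 1) : ℂ) * mat b X m (n + 1) = -mat b X' m n

theorem DerivRel.star {X X' : H →L[ℂ] H} (h : DerivRel b X X') : DerivRel b (star X) (star X') where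
  lower m n := by
    have := congrArg (starRingEnd ℂ) (h.raise n m)
    simp only [map_sub, map_mul, Complex.conj_ofReal, map_neg] at this
    simp only [mat_star]
    change _ * (starRingEnd ℂ) _ - _ * (starRingEnd ℂ) _ = (starRingEnd ℂ) _
    linear_combination -this
  raise m n := by
    have := congrArg (starRingEnd ℂ) (h.lower n m)
    simp only [map_sub, map_mul, Complex.conj_ofReal] at this
    simp only [mat_star]
    change _ * (starRingEnd ℂ) _ - _ * (starRingEnd ℂ) _ = -(starRingEnd ℂ) _
    linear_combination -this

/-- In operator form [D*D, X] = D*X' − X'D = X'(D* − D) − X''. Both ladder operators are pushed to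
the right of X', where Λ⁻¹ will absorb them. -/
theorem DerivRel.comm_sq {X X' X'' : H →L[ℂ] H} (h : DerivRel b X X') (h' : DerivRel b X' X'') (k l : ℕ) :
    (2 * k - 2 * l : ℂ) * mat b X k l = (shiftWeight (l + 1) : ℂ) * mat b X' k (l + 1)
      - (shiftWeight l : ℂ) * mat b X' k (l - 1) - mat b X'' k l := by
  have h1 := h.raise (k + 1) l
  have h2 := h.lower k (l + 1)
  have h3 := h'.lower k l
  simp only [Nat.add_sub_cancel] at h1 h2
  have e : ∀ k : ℕ, (shiftWeight (k + 1) : ℂ) ^ 2 = 2 * k + 2 := fun k => by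
    rw [← Complex.ofReal_pow, shiftWeight_sq]; push_cast; ring
  linear_combination (shiftWeight (k + 1) : ℂ) * h1 + (shiftWeight (l + 1) : ℂ) * h2 - h3
    - mat b X k l * e k + mat b X k l * e l

/-- Operators with iterated derivations in `HSB2`. -/
def IsDerivTower (b : HilbertBasis ℕ ℂ H) (N : H →ₗ.[ℂ] H) (p : ℝ) (X : H →L[ℂ] H) : Prop :=
  ∃ F : ℕ → H →L[ℂ] H, F 0 = X ∧ ∀ k, F k ∈ HSB2 b N p ∧ DerivRel b (F k) (F (k + 1))

theorem IsDerivTower.mem {p : ℝ} {X : H →L[ℂ] H} (h : IsDerivTower b N p X) : X ∈ HSB2 b N p := by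
  obtain ⟨F, rfl, h2⟩ := h
  exact (h2 0).1

theorem IsDerivTower.exists_deriv {p : ℝ} {X : H →L[ℂ] H} (h : IsDerivTower b N p X) :
    ∃ X', IsDerivTower b N p X' ∧ DerivRel b X X' := by
  obtain ⟨F, rfl, h2⟩ := h
  exact ⟨F 1, ⟨fun k => F (k + 1), rfl, fun k => h2 (k + 1)⟩, (h2 0).2⟩

theorem star_mem_HSB2 {p : ℝ} {X : H →L[ℂ] H} (h : X ∈ HSB2 b N p) : star X ∈ HSB2 b N p := fun s hs =>
  ⟨(h s hs).2, by rw [star_star]; exact (h s hs).1⟩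

theorem IsDerivTower.star {p : ℝ} {X : H →L[ℂ] H} (h : IsDerivTower b N p X) :
    IsDerivTower b N p (star X) := by
  obtain ⟨F, rfl, h2⟩ := h
  exact ⟨fun k => Star.star (F k), rfl, fun k => ⟨star_mem_HSB2 (h2 k).1, (h2 k).2.star⟩⟩

theorem IsHomogeneous.mat_mul_of_eq {d : ℤ} {Z : H →L[ℂ] H} (h : IsHomogeneous b d Z) (X : H →L[ℂ] H)
    {m n l : ℕ} (hl : (l : ℤ) = n + d) : mat b (X * Z) m n = mat b X m l * mat b Z l n :=
  (hasSum_mat_mul b X Z m n).unique (hasSum_single l fun k hk => by rw [h k n (by omega), mul_zero])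

theorem IsHomogeneous.mat_mul_of_neg {d : ℤ} {Z : H →L[ℂ] H} (h : IsHomogeneous b d Z) (X : H →L[ℂ] H)
    {m n : ℕ} (hn : (n : ℤ) + d < 0) : mat b (X * Z) m n = 0 := by
  refine (hasSum_mat_mul b X Z m n).unique ?_
  convert! hasSum_zero using 2 with l
  rw [h l n (by omega), mul_zero]

theorem IsHomogeneous.mat_mul_left_of_eq {d : ℤ} {Z : H →L[ℂ] H} (h : IsHomogeneous b d Z) (X : H →L[ℂ] H)
    {m n k : ℕ} (hk : (m : ℤ) = k + d) : mat b (Z * X) m n = mat b Z m k * mat b X k n :=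
  (hasSum_mat_mul b Z X m n).unique (hasSum_single k fun l hl => by rw [h m l (by omega), zero_mul])

theorem IsHomogeneous.mat_mul_left_of_neg {d : ℤ} {Z : H →L[ℂ] H} (h : IsHomogeneous b d Z) (X : H →L[ℂ] H)
    {m n : ℕ} (hm : (m : ℤ) - d < 0) : mat b (Z * X) m n = 0 := by
  refine (hasSum_mat_mul b Z X m n).unique ?_
  convert! hasSum_zero using 2 with l
  rw [h m l (by omega), zero_mul]

theorem norm_mat_div_lam_le (Z : H →L[ℂ] H) (l n : ℕ) : ‖mat b Z l n / (lam n : ℂ)‖ ≤ ‖Z‖ := by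
  rw [norm_div, Complex.norm_real, Real.norm_of_nonneg (lam_pos n).le]
  exact (div_le_self (norm_nonneg _) (one_le_lam n)).trans (norm_mat_le Z l n)

theorem norm_mul_mat_div_lam_le {d : ℤ} {Z : H →L[ℂ] H} (h : IsHomogeneous b d Z) {x : ℝ} (l n : ℕ)
    (hx : 0 ≤ x) (hxl : x ≤ lam l) :
    ‖(x : ℂ) * mat b Z l n / (lam n : ℂ)‖ ≤ (1 + |(d : ℝ)|) * ‖Z‖ := by
  by_cases hl : (l : ℤ) = n + d
  · rw [norm_div, norm_mul, Complex.norm_real, Complex.norm_real, Real.norm_of_nonneg (lam_pos n).le,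
      Real.norm_of_nonneg hx, div_le_iff₀ (lam_pos n)]
    calc x * ‖mat b Z l n‖ ≤ ((1 + |(d : ℝ)|) * lam n) * ‖Z‖ := by
          have := lam_pos n
          gcongr
          · exact hxl.trans (lam_le_mul_lam d hl)
          · exact norm_mat_le Z l n
      _ = _ := by ring
  · rw [h l n hl]
    simp only [mul_zero, zero_div, norm_zero]
    positivity

/-- `Z (1 + N)^(-1/2)`. -/
theorem IsHomogeneous.exists_div_lam {d : ℤ} {Z : H →L[ℂ] H} (h : IsHomogeneous b d Z) :
    ∃ C, IsHomogeneous b d C ∧ ∀ l n, mat b C l n = mat b Z l n / (lam n : ℂ) := by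
  obtain ⟨C, hC⟩ := exists_clm_homogeneous b d (fun l n => mat b Z l n / (lam n : ℂ)) ‖Z‖
    (fun l n hl => by simp [h l n hl]) fun l n => norm_mat_div_lam_le Z l n
  exact ⟨C, fun m n hmn => by simp [hC, h m n hmn], hC⟩

/-- `D Z (1 + N)^(-1/2)`. -/
theorem IsHomogeneous.exists_lower {d : ℤ} {Z : H →L[ℂ] H} (h : IsHomogeneous b d Z) :
    ∃ C, IsHomogeneous b (d - 1) C ∧
      ∀ l n, mat b C l n = (shiftWeight (l + 1) : ℂ) * mat b Z (l + 1) n / (lam n : ℂ) := by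
  obtain ⟨C, hC⟩ := exists_clm_homogeneous b (d - 1)
    (fun l n => (shiftWeight (l + 1) : ℂ) * mat b Z (l + 1) n / (lam n : ℂ)) ((1 + |(d : ℝ)|) * ‖Z‖)
    (fun l n hl => by simp [h (l + 1) n (by push_cast; omega)])
    fun l n => norm_mul_mat_div_lam_le h _ _ (shiftWeight_nonneg _) (shiftWeight_le_lam _)
  exact ⟨C, fun m n hmn => by simp [hC, h (m + 1) n (by push_cast; omega)], hC⟩

/-- `D* Z (1 + N)^(-1/2)`. -/
theorem IsHomogeneous.exists_raise {d : ℤ} {Z : H →L[ℂ] H} (h : IsHomogeneous b d Z) :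
    ∃ C, IsHomogeneous b (d + 1) C ∧
      ∀ l n, mat b C l n = (shiftWeight l : ℂ) * mat b Z (l - 1) n / (lam n : ℂ) := by
  have h0 : ∀ l n : ℕ, (l : ℤ) ≠ n + (d + 1) → (shiftWeight l : ℂ) * mat b Z (l - 1) n / (lam n : ℂ) = 0 := by
    intro l n hl
    rcases l with - | l
    · simp [shiftWeight_zero]
    · simp [h l n (by push_cast at hl; omega)]
  obtain ⟨C, hC⟩ := exists_clm_homogeneous b (d + 1)
    (fun l n => (shiftWeight l : ℂ) * mat b Z (l - 1) n / (lam n : ℂ)) ((1 + |(d : ℝ)|) * ‖Z‖)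
    h0 fun l n => by
      refine norm_mul_mat_div_lam_le h _ _ (shiftWeight_nonneg _) ?_
      rcases l with - | l
      · exact shiftWeight_le_lam _
      · rw [shiftWeight_succ]; rfl
  exact ⟨C, fun m n hmn => by rw [hC, h0 m n hmn], hC⟩

variable (b N) in
/-- The span of the operators `Z₁ X Z₂` with `Z₁, Z₂` homogeneous and `X` in a tower. -/
def towerSpan (p : ℝ) : Submodule ℂ (H →L[ℂ] H) :=
  Submodule.span ℂ {Y | ∃ (d d' : ℤ) (Z X Z' : H →L[ℂ] H), IsHomogeneous b d Z ∧ IsDerivTower b N p X ∧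
    IsHomogeneous b d' Z' ∧ Y = Z * X * Z'}

theorem mem_towerSpan {p : ℝ} {d d' : ℤ} {Z X Z' : H →L[ℂ] H} (hZ : IsHomogeneous b d Z)
    (hX : IsDerivTower b N p X) (hZ' : IsHomogeneous b d' Z') : Z * X * Z' ∈ towerSpan b N p :=
  Submodule.subset_span ⟨d, d', Z, X, Z', hZ, hX, hZ', rfl⟩

theorem towerSpan_le_HSB2 (hN : IsDiag b N fun n => 2 * n + 1) {p : ℝ} (hp : 0 ≤ p) :
    towerSpan b N p ≤ HSB2 b N p := by
  refine Submodule.span_le.2 ?_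
  rintro _ ⟨d, d', Z, X, Z', hZ, hX, hZ', rfl⟩
  exact mul_mem_HSB2 hN hp hZ hX.mem hZ'

theorem star_mem_towerSpan {p : ℝ} {Y : H →L[ℂ] H} (h : Y ∈ towerSpan b N p) : star Y ∈ towerSpan b N p := by
  induction h using Submodule.span_induction with
  | mem Y h =>
    obtain ⟨d, d', Z, X, Z', hZ, hX, hZ', rfl⟩ := h
    rw [star_mul, star_mul, ← mul_assoc]
    exact mem_towerSpan hZ'.star hX.star hZ.star
  | zero => rw [star_zero]; exact Submodule.zero_mem _
  | add Y Y' _ _ h h' => rw [star_add]; exact Submodule.add_mem _ h h'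
  | smul c Y _ h => rw [star_smul]; exact Submodule.smul_mem _ _ h

/-- The operation is Y ↦ [Λ², Y]Λ⁻¹. For Y = ZXZ', the homogeneous factors contribute the scalar 2(d
+ d'), and the middle factor contributes ZX'(D* − D)Z'Λ⁻¹ − ZX''Z'Λ⁻¹. Here D*Z'Λ⁻¹, DZ'Λ⁻¹ and
Z'Λ⁻¹ are again bounded and homogeneous. -/
theorem towerSpan_comm_right {p : ℝ} {Y : H →L[ℂ] H} (h : Y ∈ towerSpan b N p) :
    ∃ Y' ∈ towerSpan b N p, ∀ m n, mat b Y' m n = ((2 * m - 2 * n : ℝ) : ℂ) / (lam n : ℂ) * mat b Y m n := by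
  induction h using Submodule.span_induction with
  | zero => exact ⟨0, Submodule.zero_mem _, fun m n => by simp [mat_zero]⟩
  | add Y Y' _ _ h h' =>
    obtain ⟨A, hA, hA'⟩ := h
    obtain ⟨B, hB, hB'⟩ := h'
    exact ⟨A + B, Submodule.add_mem _ hA hB, fun m n => by rw [mat_add, mat_add, hA', hB']; ring⟩
  | smul c Y _ h =>
    obtain ⟨A, hA, hA'⟩ := h
    exact ⟨c • A, Submodule.smul_mem _ _ hA, fun m n => by rw [mat_smul, mat_smul, hA']; ring⟩
  | mem Y h =>
    obtain ⟨d, d', Z, X, Z', hZ, hX, hZ', rfl⟩ := h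
    obtain ⟨X', hX', hr⟩ := hX.exists_deriv
    obtain ⟨X'', hX'', hr'⟩ := hX'.exists_deriv
    obtain ⟨C, hC, hC'⟩ := hZ'.exists_div_lam
    obtain ⟨A, hA, hA'⟩ := hZ'.exists_raise
    obtain ⟨B, hB, hB'⟩ := hZ'.exists_lower
    refine ⟨(2 * (d + d') : ℂ) • (Z * X * C) + (Z * X' * A + ((-1 : ℂ) • (Z * X' * B)
      + (-1 : ℂ) • (Z * X'' * C))), ?_, fun m n => ?_⟩
    · exact Submodule.add_mem _ (Submodule.smul_mem _ _ (mem_towerSpan hZ hX hC))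
        (Submodule.add_mem _ (mem_towerSpan hZ hX' hA) (Submodule.add_mem _
          (Submodule.smul_mem _ _ (mem_towerSpan hZ hX' hB))
          (Submodule.smul_mem _ _ (mem_towerSpan hZ hX'' hC))))
    · simp only [mat_add, mat_smul]
      by_cases hm : (m : ℤ) - d < 0
      · simp only [mul_assoc, hZ.mat_mul_left_of_neg _ hm]
        simp
      obtain ⟨k, hk⟩ : ∃ k : ℕ, (m : ℤ) = k + d := ⟨(m - d).toNat, by omega⟩
      by_cases hn : (n : ℤ) + d' < 0
      · rw [hC.mat_mul_of_neg _ hn, hC.mat_mul_of_neg _ hn, hZ'.mat_mul_of_neg _ hn,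
          hB.mat_mul_of_neg _ (by omega)]
        -- The raised factor has degree d' + 1, so at n + d' = −1 it reaches row 0; the entry there
        -- vanishes because `shiftWeight 0` = 0.
        have : mat b (Z * X' * A) m n = 0 := by
          by_cases hn1 : (n : ℤ) + (d' + 1) < 0
          · exact hA.mat_mul_of_neg _ hn1
          · rw [hA.mat_mul_of_eq _ (l := 0) (by push_cast; omega), hA', shiftWeight_zero]
            simp
        rw [this]
        simp
      obtain ⟨l, hl⟩ : ∃ l : ℕ, (l : ℤ) = n + d' := ⟨(n + d').toNat, by omega⟩
      have hBl : mat b (Z * X' * B) m n = mat b Z m k *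
          ((shiftWeight l : ℂ) * mat b X' k (l - 1)) * (mat b Z' l n / (lam n : ℂ)) := by
        rcases l with - | l
        · rw [hB.mat_mul_of_neg _ (by push_cast at hl; omega), shiftWeight_zero]
          simp
        · rw [hB.mat_mul_of_eq _ (l := l) (by push_cast at hl; omega), hZ.mat_mul_left_of_eq _ hk, hB',
            Nat.add_sub_cancel]
          ring
      rw [hBl, hC.mat_mul_of_eq _ hl, hC.mat_mul_of_eq _ hl, hZ'.mat_mul_of_eq _ hl,
        hA.mat_mul_of_eq _ (l := l + 1) (by push_cast; omega), hZ.mat_mul_left_of_eq _ hk,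
        hZ.mat_mul_left_of_eq _ hk, hZ.mat_mul_left_of_eq _ hk, hA', hC', Nat.add_sub_cancel]
      have h1 := hr.comm_sq hr' k l
      have h2 : (m : ℂ) = k + d := by exact_mod_cast hk
      have h3 : (l : ℂ) = n + d' := by exact_mod_cast hl
      push_cast
      rw [h2]
      rw [h3] at h1
      linear_combination -(mat b Z m k * mat b Z' l n / (lam n : ℂ)) * h1

/-- Adjoint of the right-handed version; the antisymmetry of 2m − 2n accounts for the sign −1. -/
theorem towerSpan_comm_left {p : ℝ} {Y : H →L[ℂ] H} (h : Y ∈ towerSpan b N p) :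
    ∃ Y' ∈ towerSpan b N p, ∀ m n, mat b Y' m n = ((2 * m - 2 * n : ℝ) : ℂ) / (lam m : ℂ) * mat b Y m n := by
  obtain ⟨Y', hY', h2⟩ := towerSpan_comm_right (star_mem_towerSpan h)
  refine ⟨(-1 : ℂ) • star Y', Submodule.smul_mem _ _ (star_mem_towerSpan hY'), fun m n => ?_⟩
  rw [mat_smul, mat_star, h2, mat_star, star_mul', star_star]
  change -1 * ((starRingEnd ℂ) _ * _) = _
  rw [map_div₀, Complex.conj_ofReal, Complex.conj_ofReal]
  push_cast
  ring

/-- Since 2m − 2n = lam m² − lam n², the difference lam m − lam n equals `schurWeight m n` times (2m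
− 2n)(1/lam m + 1/lam n). The second factor acts k times inside `towerSpan`. The Schur multipliers
come last, as they are only known to preserve `HSB2`. -/
theorem HasDeltas.of_mem_towerSpan (hN : IsDiag b N fun n => 2 * n + 1) {p : ℝ} (hp : 0 ≤ p)
    {Y : H →L[ℂ] H} (h : Y ∈ towerSpan b N p) : HasDeltas b (HSB2 b N p) Y := by
  intro k
  have h1 : ∀ j : ℕ, ∃ Y' ∈ towerSpan b N p, ∀ m n, mat b Y' m n =
      (((2 * m - 2 * n) * (1 / lam m + 1 / lam n) : ℝ) : ℂ) ^ j * mat b Y m n := by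
    intro j
    induction j with
    | zero => exact ⟨Y, h, fun m n => by simp⟩
    | succ j ih =>
      obtain ⟨Y', hY', h2⟩ := ih
      obtain ⟨A, hA, hA'⟩ := towerSpan_comm_left hY'
      obtain ⟨B, hB, hB'⟩ := towerSpan_comm_right hY'
      refine ⟨A + B, Submodule.add_mem _ hA hB, fun m n => ?_⟩
      rw [mat_add, hA', hB', h2]
      push_cast
      ring
  obtain ⟨Y', hY', h2⟩ := h1 k
  have h3 : ∀ j : ℕ, ∃ S ∈ HSB2 b N p, ∀ m n, mat b S m n = (schurWeight m n : ℂ) ^ j * mat b Y' m n := by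
    intro j
    induction j with
    | zero => exact ⟨Y', towerSpan_le_HSB2 hN hp hY', fun m n => by simp⟩
    | succ j ih =>
      obtain ⟨S, hS, h4⟩ := ih
      obtain ⟨S', hS', h5⟩ := exists_schurWeight_mul hN hp hS
      exact ⟨S', hS', fun m n => by rw [h5, h4]; ring⟩
  obtain ⟨S, hS, h4⟩ := h3 k
  refine ⟨S, hS, fun m n => ?_⟩
  rw [h4, h2, ← mul_assoc, ← mul_pow, ← Complex.ofReal_mul]
  congr 3
  have hm := lam_pos m
  have hn := lam_pos n
  have e : (2 * m - 2 * n : ℝ) = lam m ^ 2 - lam n ^ 2 := by rw [lam_sq, lam_sq]; ring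
  rw [schurWeight, e]
  field_simp
  ring

end Multiplier

/-! ### Hermite functions -/

theorem exists_bound_pow_mul_gaussian (k : ℕ) :
    ∃ C, ∀ x : ℝ, |x| ^ k * Real.exp (-(x ^ 2 / 2)) ≤ C := by
  refine ⟨1 + 2 ^ k * k.factorial, fun x => ?_⟩
  have h1 := Real.pow_div_factorial_le_exp (x ^ 2 / 2) (by positivity) k
  have h2 : Real.exp (x ^ 2 / 2) * Real.exp (-(x ^ 2 / 2)) = 1 := by
    rw [← Real.exp_add]; simp
  have h3 : |x| ^ k ≤ 1 + (x ^ 2) ^ k := by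
    have : (x ^ 2) ^ k = (|x| ^ k) ^ 2 := by rw [← sq_abs, ← pow_mul, ← pow_mul, mul_comm]
    rw [this]
    nlinarith [sq_nonneg (|x| ^ k - 1), sq_nonneg (|x| ^ k)]
  have h4 : (x ^ 2) ^ k ≤ 2 ^ k * k.factorial * Real.exp (x ^ 2 / 2) := by
    rw [div_pow, div_div, div_le_iff₀ (by positivity)] at h1
    linarith
  have h5 : Real.exp (-(x ^ 2 / 2)) ≤ 1 := Real.exp_le_one_iff.2 (by nlinarith [sq_nonneg x])
  have h6 := Real.exp_pos (-(x ^ 2 / 2))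
  calc |x| ^ k * Real.exp (-(x ^ 2 / 2))
      ≤ (1 + 2 ^ k * k.factorial * Real.exp (x ^ 2 / 2)) * Real.exp (-(x ^ 2 / 2)) := by
        gcongr; linarith
    _ = Real.exp (-(x ^ 2 / 2)) + 2 ^ k * k.factorial *
        (Real.exp (x ^ 2 / 2) * Real.exp (-(x ^ 2 / 2))) := by ring
    _ ≤ _ := by rw [h2]; linarith

theorem exists_bound_pow_mul_polynomial_mul_gaussian (p : Polynomial ℤ) : ∀ k : ℕ,
    ∃ C, ∀ x : ℝ, |x| ^ k * (|Polynomial.aeval x p| * Real.exp (-(x ^ 2 / 2))) ≤ C := by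
  induction p using Polynomial.induction_on' with
  | add p q hp hq =>
    intro k
    obtain ⟨C, hC⟩ := hp k
    obtain ⟨C', hC'⟩ := hq k
    refine ⟨C + C', fun x => ?_⟩
    rw [map_add]
    calc _ ≤ |x| ^ k * ((|Polynomial.aeval x p| + |Polynomial.aeval x q|) * Real.exp (-(x ^ 2 / 2))) := by
          gcongr; exact abs_add_le _ _
      _ = _ := by ring
      _ ≤ _ := add_le_add (hC x) (hC' x)
  | monomial n a =>
    intro k
    obtain ⟨C, hC⟩ := exists_bound_pow_mul_gaussian (k + n)
    refine ⟨|(a : ℝ)| * C, fun x => ?_⟩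
    rw [Polynomial.aeval_monomial, abs_mul, abs_pow]
    calc _ = |(a : ℝ)| * (|x| ^ (k + n) * Real.exp (-(x ^ 2 / 2))) := by
          rw [pow_add]; simp; ring
      _ ≤ _ := by gcongr; exact hC x

/-- The Gaussian as a Schwartz function. -/
def gaussianReal : 𝓢(ℝ, ℝ) where
  toFun x := Real.exp (-(x ^ 2 / 2))
  smooth' := by fun_prop
  decay' k n := by
    obtain ⟨C, hC⟩ := exists_bound_pow_mul_polynomial_mul_gaussian (Polynomial.hermite n) k
    refine ⟨C, fun x => ?_⟩
    rw [norm_iteratedFDeriv_eq_norm_iteratedDeriv, iteratedDeriv_eq_iterate,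
      Polynomial.deriv_gaussian_eq_hermite_mul_gaussian]
    refine le_trans (le_of_eq ?_) (hC x)
    simp [Real.norm_eq_abs]

/-- The Gaussian as a complex valued Schwartz function. -/
def gaussianC : 𝓢(ℝ, ℂ) := SchwartzMap.postcompCLM (𝕜 := ℝ) Complex.ofRealCLM gaussianReal

theorem gaussianC_apply (x : ℝ) : gaussianC x = (Real.exp (-(x ^ 2 / 2)) : ℂ) := by
  rw [gaussianC, SchwartzMap.postcompCLM_apply]
  rfl

theorem schwartzToL2_coe (φ : 𝓢(ℝ, ℂ)) : (schwartzToL2 φ : ℝ → ℂ) =ᵐ[volume] φ :=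
  φ.coeFn_toLp 2 volume

theorem inner_schwartzToL2 (φ ψ : 𝓢(ℝ, ℂ)) :
    inner ℂ (schwartzToL2 φ) (schwartzToL2 ψ) = ∫ x, star (φ x) * ψ x := by
  refine (SchwartzMap.inner_toL2_toL2_eq φ ψ volume).trans (integral_congr_ae ?_)
  filter_upwards with x
  simp [mul_comm]

/-- `φ ↦ -φ' + x φ` on Schwartz functions. -/
def oscAdjSchwartz : 𝓢(ℝ, ℂ) →ₗ[ℂ] 𝓢(ℝ, ℂ) :=
  (-SchwartzMap.derivCLM ℂ ℂ + SchwartzMap.smulLeftCLM ℂ (fun x : ℝ => (x : ℂ)) :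
    𝓢(ℝ, ℂ) →L[ℂ] 𝓢(ℝ, ℂ))

theorem oscAdjSchwartz_apply (φ : 𝓢(ℝ, ℂ)) (x : ℝ) :
    oscAdjSchwartz φ x = -deriv φ x + x * φ x := by
  simp only [oscAdjSchwartz, ContinuousLinearMap.coe_coe, add_apply, neg_apply,
    SchwartzMap.derivCLM_apply]
  rw [SchwartzMap.smulLeftCLM_apply_apply (by fun_prop)]
  simp

theorem hasDerivAt_oscAdjSchwartz (φ : 𝓢(ℝ, ℂ)) (x : ℝ) :
    HasDerivAt (oscAdjSchwartz φ) (-deriv (deriv φ) x + (φ x + x * deriv φ x)) x := by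
  have h1 : HasDerivAt (deriv φ) (deriv (deriv φ) x) x := by
    have := (SchwartzMap.derivCLM ℂ ℂ φ).hasDerivAt x
    have e : (SchwartzMap.derivCLM ℂ ℂ φ : ℝ → ℂ) = deriv φ := by
      ext y; exact SchwartzMap.derivCLM_apply ℂ φ y
    rwa [e] at this
  have h2 : HasDerivAt (fun y : ℝ => (y : ℂ)) 1 x := Complex.ofRealCLM.hasDerivAt
  have h3 := h1.neg.add (h2.mul (φ.hasDerivAt x))
  have e : (oscAdjSchwartz φ : ℝ → ℂ) = fun y => -deriv φ y + y * φ y := by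
    ext y; exact oscAdjSchwartz_apply φ y
  rw [e]
  convert! h3 using 1
  simp

theorem hasDerivAt_oscSchwartz (φ : 𝓢(ℝ, ℂ)) (x : ℝ) :
    HasDerivAt (oscSchwartz φ) (deriv (deriv φ) x + (φ x + x * deriv φ x)) x := by
  have h1 : HasDerivAt (deriv φ) (deriv (deriv φ) x) x := by
    have := (SchwartzMap.derivCLM ℂ ℂ φ).hasDerivAt x
    have e : (SchwartzMap.derivCLM ℂ ℂ φ : ℝ → ℂ) = deriv φ := by
      ext y; exact SchwartzMap.derivCLM_apply ℂ φ y
    rwa [e] at this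
  have h2 : HasDerivAt (fun y : ℝ => (y : ℂ)) 1 x := Complex.ofRealCLM.hasDerivAt
  have h3 := h1.add (h2.mul (φ.hasDerivAt x))
  have e : (oscSchwartz φ : ℝ → ℂ) = fun y => deriv φ y + y * φ y := by
    ext y; exact oscSchwartz_apply φ y
  rw [e]
  convert! h3 using 1
  simp

theorem oscSchwartz_commutator (φ : 𝓢(ℝ, ℂ)) :
    oscSchwartz (oscAdjSchwartz φ) = oscAdjSchwartz (oscSchwartz φ) + (2 : ℂ) • φ := by
  ext x
  rw [oscSchwartz_apply, (hasDerivAt_oscAdjSchwartz φ x).deriv, oscAdjSchwartz_apply, add_apply,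
    oscAdjSchwartz_apply, (hasDerivAt_oscSchwartz φ x).deriv, oscSchwartz_apply, smul_apply,
    smul_eq_mul]
  ring

theorem integrable_schwartz_mul (φ : 𝓢(ℝ, ℂ)) {f : ℝ → ℂ} (hf : Continuous f) {C : ℝ} (hC : ∀ x, ‖f x‖ ≤ C) :
    Integrable fun x => f x * φ x :=
  (φ.integrable (μ := volume)).bdd_mul hf.aestronglyMeasurable (Filter.Eventually.of_forall hC)

theorem exists_norm_le_schwartz (φ : 𝓢(ℝ, ℂ)) : ∃ C, ∀ x, ‖φ x‖ ≤ C :=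
  ⟨_, φ.norm_le_seminorm ℝ⟩

/-- Integration by parts for Schwartz functions against a bounded function. -/
theorem integral_star_mul_mul_deriv (φ ψ : 𝓢(ℝ, ℂ)) {f f' : ℝ → ℂ} (hf : ∀ x, HasDerivAt f (f' x) x)
    (hf' : Continuous f') {C C' : ℝ} (hC : ∀ x, ‖f x‖ ≤ C) (hC' : ∀ x, ‖f' x‖ ≤ C') :
    (∫ x, star (oscAdjSchwartz φ x) * (f x * ψ x)) - (∫ x, star (φ x) * (f x * oscSchwartz ψ x))
      = ∫ x, star (φ x) * (f' x * ψ x) := by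
  have hfc : Continuous f := continuous_iff_continuousAt.2 fun x => (hf x).continuousAt
  have hint : ∀ (φ ψ : 𝓢(ℝ, ℂ)) (f : ℝ → ℂ) (C : ℝ), Continuous f → (∀ x, ‖f x‖ ≤ C) →
      Integrable fun x => star (φ x) * (f x * ψ x) := by
    intro φ ψ f C hf hC
    obtain ⟨K, hK⟩ := exists_norm_le_schwartz φ
    refine (integrable_schwartz_mul ψ hf hC).bdd_mul (c := K)
      (φ.continuous.star).aestronglyMeasurable (Filter.Eventually.of_forall fun x => ?_)
    rw [norm_star]; exact hK x
  have hd : ∀ x, HasDerivAt (fun x => star (φ x) * (f x * ψ x))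
      (star (φ x) * (f x * oscSchwartz ψ x) + star (φ x) * (f' x * ψ x)
        - star (oscAdjSchwartz φ x) * (f x * ψ x)) x := by
    intro x
    have h := (φ.hasDerivAt x).star.mul ((hf x).mul (ψ.hasDerivAt x))
    convert! h using 1
    rw [oscSchwartz_apply, oscAdjSchwartz_apply]
    simp only [Pi.mul_apply, star_add, star_neg, star_mul', Complex.star_def, Complex.conj_ofReal]
    ring
  have i1 := hint φ (oscSchwartz ψ) f C hfc hC
  have i2 := hint φ ψ f' C' hf' hC'
  have i3 := hint (oscAdjSchwartz φ) ψ f C hfc hC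
  have h0 := integral_eq_zero_of_hasDerivAt_of_integrable hd ((i1.add i2).sub i3) (hint φ ψ f C hfc hC)
  have h1 := integral_sub (i1.add i2) i3
  have h2 := integral_add i1 i2
  simp only [Pi.add_apply] at h1 h2
  rw [h1, h2] at h0
  linear_combination -h0

theorem inner_oscAdjSchwartz (φ ψ : 𝓢(ℝ, ℂ)) :
    inner ℂ (schwartzToL2 (oscAdjSchwartz φ)) (schwartzToL2 ψ)
      = inner ℂ (schwartzToL2 φ) (schwartzToL2 (oscSchwartz ψ)) := by
  have h := integral_star_mul_mul_deriv φ ψ (f := fun _ => 1) (f' := fun _ => 0) (C := 1) (C' := 0)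
    (fun x => hasDerivAt_const x 1) continuous_const (by simp) (by simp)
  simp only [one_mul, zero_mul, mul_zero, integral_zero] at h
  rw [inner_schwartzToL2, inner_schwartzToL2]
  exact sub_eq_zero.1 h

/-- The Hermite functions. -/
def hermiteFun : ℕ → 𝓢(ℝ, ℂ)
  | 0 => ((‖schwartzToL2 gaussianC‖⁻¹ : ℝ) : ℂ) • gaussianC
  | n + 1 => ((shiftWeight (n + 1))⁻¹ : ℂ) • oscAdjSchwartz (hermiteFun n)

theorem shiftWeight_succ_ne_zero (n : ℕ) : (shiftWeight (n + 1) : ℂ) ≠ 0 := by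
  rw [shiftWeight_succ]
  exact_mod_cast (lam_pos n).ne'

theorem oscAdjSchwartz_hermiteFun (n : ℕ) :
    oscAdjSchwartz (hermiteFun n) = (shiftWeight (n + 1) : ℂ) • hermiteFun (n + 1) := by
  rw [hermiteFun, smul_smul, mul_inv_cancel₀ (shiftWeight_succ_ne_zero n), one_smul]

theorem oscSchwartz_gaussianC : oscSchwartz gaussianC = 0 := by
  ext x
  have e : (gaussianC : ℝ → ℂ) = fun y => ((Real.exp (-(y ^ 2 / 2)) : ℝ) : ℂ) := by
    ext y; exact gaussianC_apply y
  have h : HasDerivAt (fun y : ℝ => Real.exp (-(y ^ 2 / 2))) (Real.exp (-(x ^ 2 / 2)) * -(2 * x / 2)) x := by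
    have h1 : HasDerivAt (fun y : ℝ => -(y ^ 2 / 2)) (-(2 * x / 2)) x := by
      convert! ((hasDerivAt_pow 2 x).div_const 2).neg using 1
      simp
    exact h1.exp
  rw [oscSchwartz_apply, e, h.ofReal_comp.deriv]
  push_cast
  simp
  ring

/-- Ladder induction: D kills the Gaussian, and DD* = D*D + 2 moves D past each creation operator.
-/
theorem oscSchwartz_hermiteFun (n : ℕ) :
    oscSchwartz (hermiteFun n) = (shiftWeight n : ℂ) • hermiteFun (n - 1) := by
  induction n with
  | zero => rw [hermiteFun, map_smul, oscSchwartz_gaussianC, shiftWeight_zero]; simp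
  | succ n ih =>
    have e : ∀ k : ℕ, (shiftWeight k : ℂ) * shiftWeight k = 2 * k := fun k => by
      rw [← Complex.ofReal_mul, ← sq, shiftWeight_sq]; push_cast; ring
    have h1 : oscAdjSchwartz (oscSchwartz (hermiteFun n)) = (2 * n : ℂ) • hermiteFun n := by
      rw [ih, map_smul]
      rcases n with - | n
      · simp [shiftWeight_zero]
      · rw [Nat.add_sub_cancel, oscAdjSchwartz_hermiteFun, smul_smul, e]
    rw [hermiteFun, map_smul, oscSchwartz_commutator, h1, ← add_smul, smul_smul, Nat.add_sub_cancel]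
    congr 1
    have := e (n + 1)
    have h0 := shiftWeight_succ_ne_zero n
    field_simp
    push_cast at this
    linear_combination -this

theorem oscAdj_oscSchwartz_hermiteFun (n : ℕ) :
    oscAdjSchwartz (oscSchwartz (hermiteFun n)) = (2 * n : ℂ) • hermiteFun n := by
  have e : ∀ k : ℕ, (shiftWeight k : ℂ) * shiftWeight k = 2 * k := fun k => by
    rw [← Complex.ofReal_mul, ← sq, shiftWeight_sq]; push_cast; ring
  rw [oscSchwartz_hermiteFun, map_smul]
  rcases n with - | n
  · simp [shiftWeight_zero]
  · rw [Nat.add_sub_cancel, oscAdjSchwartz_hermiteFun, smul_smul, e]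

theorem schwartzToL2_gaussianC_ne_zero : schwartzToL2 gaussianC ≠ 0 := by
  intro h
  have h1 : gaussianC = 0 := schwartzToL2_injective (by rw [h, map_zero])
  have h2 := gaussianC_apply 0
  rw [h1] at h2
  simp at h2

theorem inner_oscSchwartz_left (φ ψ : 𝓢(ℝ, ℂ)) :
    inner ℂ (schwartzToL2 (oscSchwartz φ)) (schwartzToL2 ψ)
      = inner ℂ (schwartzToL2 φ) (schwartzToL2 (oscAdjSchwartz ψ)) := by
  rw [← inner_conj_symm, ← inner_oscAdjSchwartz, inner_conj_symm]

/-- Norms follow from ‖D*φ_n‖² = ⟨φ_n, (D*D + 2)φ_n⟩ = 2n + 2. Orthogonality follows from the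
distinct eigenvalues 2n of the symmetric operator D*D. -/
theorem orthonormal_hermiteFun : Orthonormal ℂ fun n => schwartzToL2 (hermiteFun n) := by
  constructor
  · intro n
    induction n with
    | zero =>
      change ‖schwartzToL2 (hermiteFun 0)‖ = 1
      rw [hermiteFun, map_smul, norm_smul, Complex.norm_real, norm_inv, norm_norm,
        inv_mul_cancel₀ (norm_ne_zero_iff.2 schwartzToL2_gaussianC_ne_zero)]
    | succ n ih =>
      have h1 : inner ℂ (schwartzToL2 (oscAdjSchwartz (hermiteFun n)))
          (schwartzToL2 (oscAdjSchwartz (hermiteFun n))) = (2 * n + 2 : ℂ) := by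
        rw [inner_oscAdjSchwartz, oscSchwartz_commutator, oscAdj_oscSchwartz_hermiteFun, ← add_smul,
          map_smul, inner_smul_right, inner_self_eq_norm_sq_to_K, ih]
        simp
      rw [inner_self_eq_norm_sq_to_K] at h1
      have h2 : ‖schwartzToL2 (oscAdjSchwartz (hermiteFun n))‖ ^ 2 = lam n ^ 2 := by
        rw [lam_sq]
        have h3 : ((‖schwartzToL2 (oscAdjSchwartz (hermiteFun n))‖ ^ 2 : ℝ) : ℂ) = ((2 * n + 2 : ℝ) : ℂ) := by
          push_cast
          exact h1
        exact Complex.ofReal_injective h3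
      have h3 := (sq_eq_sq₀ (norm_nonneg _) (lam_pos n).le).1 h2
      change ‖schwartzToL2 (hermiteFun (n + 1))‖ = 1
      rw [hermiteFun, map_smul, norm_smul, h3, norm_inv, Complex.norm_real, shiftWeight_succ,
        Real.norm_of_nonneg (lam_pos n).le, inv_mul_cancel₀ (lam_pos n).ne']
  · intro m n hmn
    have h1 : inner ℂ (schwartzToL2 (oscAdjSchwartz (oscSchwartz (hermiteFun m)))) (schwartzToL2 (hermiteFun n))
        = inner ℂ (schwartzToL2 (hermiteFun m))
          (schwartzToL2 (oscAdjSchwartz (oscSchwartz (hermiteFun n)))) := by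
      rw [inner_oscAdjSchwartz, inner_oscSchwartz_left]
    rw [oscAdj_oscSchwartz_hermiteFun, oscAdj_oscSchwartz_hermiteFun, map_smul, map_smul, inner_smul_left,
      inner_smul_right] at h1
    have h2 : (2 * m - 2 * n : ℂ) * inner ℂ (schwartzToL2 (hermiteFun m)) (schwartzToL2 (hermiteFun n)) = 0 := by
      simp only [map_mul, Complex.conj_natCast, Complex.conj_ofNat] at h1
      linear_combination h1
    refine (mul_eq_zero.1 h2).resolve_left fun h => hmn ?_
    have : (m : ℂ) = n := by linear_combination h / 2
    exact_mod_cast this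

/-- Multiplication by `x` on Schwartz functions. -/
theorem exists_pow_mul_gaussian_mem (k : ℕ) : ∃ φ ∈ Submodule.span ℂ (Set.range hermiteFun),
    ∀ x : ℝ, φ x = (x : ℂ) ^ k * gaussianC x := by
  set W := Submodule.span ℂ (Set.range hermiteFun) with hW
  have hA : ∀ φ ∈ W, oscSchwartz φ ∈ W := by
    intro φ hφ
    have : W ≤ W.comap oscSchwartz := by
      rw [hW]
      refine Submodule.span_le.2 ?_
      rintro _ ⟨n, rfl⟩
      change oscSchwartz (hermiteFun n) ∈ W
      rw [oscSchwartz_hermiteFun]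
      exact W.smul_mem _ (Submodule.subset_span ⟨_, rfl⟩)
    exact this hφ
  have hB : ∀ φ ∈ W, oscAdjSchwartz φ ∈ W := by
    intro φ hφ
    have : W ≤ W.comap oscAdjSchwartz := by
      rw [hW]
      refine Submodule.span_le.2 ?_
      rintro _ ⟨n, rfl⟩
      change oscAdjSchwartz (hermiteFun n) ∈ W
      rw [oscAdjSchwartz_hermiteFun]
      exact W.smul_mem _ (Submodule.subset_span ⟨_, rfl⟩)
    exact this hφ
  induction k with
  | zero =>
    refine ⟨gaussianC, ?_, fun x => by simp⟩
    have h0 : hermiteFun 0 ∈ W := Submodule.subset_span ⟨0, rfl⟩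
    have h1 := W.smul_mem ((‖schwartzToL2 gaussianC‖ : ℝ) : ℂ) h0
    rw [hermiteFun, smul_smul, ← Complex.ofReal_mul,
      mul_inv_cancel₀ (norm_ne_zero_iff.2 schwartzToL2_gaussianC_ne_zero)] at h1
    simpa using h1
  | succ k ih =>
    obtain ⟨φ, hφ, h⟩ := ih
    -- Multiplication by x is (D + D*)/2, and both terms preserve the span of the Hermite functions.
    refine ⟨(1 / 2 : ℂ) • (oscSchwartz φ + oscAdjSchwartz φ),
      W.smul_mem _ (W.add_mem (hA φ hφ) (hB φ hφ)), fun x => ?_⟩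
    rw [smul_apply, add_apply, oscSchwartz_apply, oscAdjSchwartz_apply, h, smul_eq_mul]
    ring

/-- From |cx| ≤ c² + x²/4 a Gaussian e^(−x²/4) is left over. This provides the dominating function
for integrating an exponential series term by term. -/
theorem memLp_exp_mul_gaussian (c : ℝ) :
    MemLp (fun x : ℝ => Real.exp (|c * x|) * Real.exp (-(x ^ 2 / 2))) 2 volume := by
  have h1 : MemLp (fun x : ℝ => Real.exp (c ^ 2) * Real.exp (-(1 / 4) * x ^ 2)) 2 volume := by
    refine MemLp.const_mul ?_ _
    rw [memLp_two_iff_integrable_sq (by fun_prop)]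
    have h := integrable_exp_neg_mul_sq (b := 1 / 2) (by norm_num)
    refine h.congr (Filter.Eventually.of_forall fun x => ?_)
    simp only
    rw [← Real.exp_nat_mul]
    congr 1
    push_cast
    ring
  refine h1.of_le (by fun_prop) (Filter.Eventually.of_forall fun x => ?_)
  rw [← Real.exp_add, ← Real.exp_add, Real.norm_of_nonneg (Real.exp_pos _).le,
    Real.norm_of_nonneg (Real.exp_pos _).le]
  refine Real.exp_le_exp.2 ?_
  rw [abs_mul]
  nlinarith [sq_nonneg (|c| - |x| / 2), sq_abs c, sq_abs x]

/-- Expand the character in powers of x: every moment of the Gaussian times f vanishes, and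
dominated convergence allows summation under the integral. -/
theorem integral_exp_mul_gaussian_mul_eq_zero {f : ℝ → ℂ} (hf : MemLp f 2 volume)
    (h : ∀ k : ℕ, ∫ x : ℝ, ((x : ℂ) ^ k * gaussianC x) * f x = 0) (ξ : ℝ) :
    ∫ x : ℝ, Complex.exp (((-2 * Real.pi * x * ξ : ℝ) : ℂ) * Complex.I) * (gaussianC x * f x) = 0 := by
  set c : ℝ := 2 * Real.pi * ξ with hc
  set F : ℕ → ℝ → ℂ := fun k x => ((-(c : ℂ) * Complex.I) ^ k / k.factorial) * ((x : ℂ) ^ k * gaussianC x * f x)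
    with hF
  have hint : Integrable fun x : ℝ => (Real.exp (|c * x|) * Real.exp (-(x ^ 2 / 2))) * ‖f x‖ :=
    (memLp_exp_mul_gaussian c).integrable_mul hf.norm
  have hbound : ∀ (k : ℕ) (x : ℝ), ‖F k x‖ = (|c * x| ^ k / k.factorial) * (Real.exp (-(x ^ 2 / 2)) * ‖f x‖) := by
    intro k x
    simp only [hF, norm_mul, norm_div, norm_pow, norm_neg, Complex.norm_I, Complex.norm_real, gaussianC_apply,
      Complex.norm_natCast, abs_mul, mul_one, Real.norm_eq_abs]
    rw [abs_of_pos (Real.exp_pos _), mul_pow]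
    ring
  have hexp : ∀ y : ℝ, HasSum (fun k : ℕ => y ^ k / k.factorial) (Real.exp y) := fun y => by
    have := NormedSpace.expSeries_div_hasSum_exp y
    rwa [← Real.exp_eq_exp_ℝ] at this
  have hs := hasSum_integral_of_dominated_convergence (μ := volume) (F := F)
    (f := fun x : ℝ => Complex.exp (((-2 * Real.pi * x * ξ : ℝ) : ℂ) * Complex.I) * (gaussianC x * f x))
    (fun k x => (|c * x| ^ k / k.factorial) * (Real.exp (-(x ^ 2 / 2)) * ‖f x‖))
    (fun k => ((((by fun_prop : Continuous fun x : ℝ => (x : ℂ) ^ k).mul gaussianC.continuous).aestronglyMeasurable.mul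
      hf.aestronglyMeasurable).const_mul _))
    (fun k => Filter.Eventually.of_forall fun x => (hbound k x).le)
    (Filter.Eventually.of_forall fun x => (hexp _).summable.mul_right _)
    (hint.congr (Filter.Eventually.of_forall fun x => by
      simp only
      rw [tsum_mul_right, (hexp _).tsum_eq, mul_assoc]))
    (Filter.Eventually.of_forall fun x => by
      have h1 := NormedSpace.expSeries_div_hasSum_exp (((-2 * Real.pi * x * ξ : ℝ) : ℂ) * Complex.I)
      rw [← Complex.exp_eq_exp_ℂ] at h1
      convert! h1.mul_right (gaussianC x * f x) using 2 with k
      simp only [hF, hc]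
      have : ((-2 * Real.pi * x * ξ : ℝ) : ℂ) * Complex.I = (-((2 * Real.pi * ξ : ℝ) : ℂ) * Complex.I) * x := by
        push_cast; ring
      rw [this, mul_pow]
      ring)
  refine hs.unique ?_
  convert! hasSum_zero using 2 with k
  simp only [hF]
  rw [integral_const_mul, h, mul_zero]

/-- A function f orthogonal to all Hermite functions has vanishing moments against the Gaussian, so
the integrable function e^(−x²/2) f has zero Fourier transform and is zero. The Gaussian never
vanishes, hence f = 0. -/
theorem orthogonal_hermiteFun_eq_bot :
    (Submodule.span ℂ (Set.range fun n => schwartzToL2 (hermiteFun n)))ᗮ = ⊥ := by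
  refine (Submodule.eq_bot_iff _).2 fun f hf => ?_
  have hfm : MemLp (f : ℝ → ℂ) 2 volume := Lp.memLp f
  have h1 : ∀ k : ℕ, ∫ x : ℝ, ((x : ℂ) ^ k * gaussianC x) * f x = 0 := by
    intro k
    obtain ⟨φ, hφ, h⟩ := exists_pow_mul_gaussian_mem k
    have hmem : schwartzToL2 φ ∈ Submodule.span ℂ (Set.range fun n => schwartzToL2 (hermiteFun n)) := by
      have := Submodule.mem_map_of_mem (f := schwartzToL2) hφ
      rw [Submodule.map_span, ← Set.range_comp] at this
      exact this
    have h2 := (Submodule.mem_orthogonal _ _).1 hf _ hmem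
    rw [L2.inner_def] at h2
    rw [← h2]
    refine integral_congr_ae ?_
    filter_upwards [schwartzToL2_coe φ] with x hx
    rw [hx, h, gaussianC_apply]
    simp [-Complex.ofReal_exp, mul_comm]
  set G : ℝ → ℂ := fun x => gaussianC x * f x with hG
  have hGi : Integrable G := (gaussianC.memLp 2 volume).integrable_mul hfm
  have hF : ∀ ξ, FourierTransform.fourier G ξ = 0 := by
    intro ξ
    rw [Real.fourier_real_eq_integral_exp_smul]
    exact integral_exp_mul_gaussian_mul_eq_zero hfm h1 ξ
  -- Injectivity by duality: write φ as the Fourier transform of ψ and move the transform onto G.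
  have h2 : ∀ φ : 𝓢(ℝ, ℂ), ∫ x, φ x * G x = 0 := by
    intro φ
    set ψ : 𝓢(ℝ, ℂ) := FourierTransform.fourierInv φ with hψ
    have h3 : FourierTransform.fourier ψ = φ := by simp [hψ]
    have h4 := VectorFourier.integral_fourierIntegral_smul_eq_flip (e := Real.fourierChar) (μ := volume)
      (ν := volume) (L := innerₗ ℝ) (f := (ψ : ℝ → ℂ)) (g := G) Real.continuous_fourierChar
      (continuous_inner (𝕜 := ℝ) (E := ℝ)) ψ.integrable hGi
    have h5 : ∀ ξ, VectorFourier.fourierIntegral Real.fourierChar volume (innerₗ ℝ) (ψ : ℝ → ℂ) ξ = φ ξ := by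
      intro ξ
      rw [← h3]
      rfl
    have h6 : ∀ ξ, VectorFourier.fourierIntegral Real.fourierChar volume (innerₗ ℝ) G ξ = 0 := by
      intro ξ
      rw [← hF ξ]
      rfl
    rw [flip_innerₗ] at h4
    simp only [h5, h6, smul_zero, integral_zero] at h4
    exact h4
  have h7 : ∀ᵐ x ∂(volume : Measure ℝ), G x = 0 := by
    refine ae_eq_zero_of_integral_contDiff_smul_eq_zero hGi.locallyIntegrable fun g hg hgc => ?_
    have hgc' : HasCompactSupport fun x => (g x : ℂ) := hgc.comp_left (g := fun y : ℝ => (y : ℂ)) (by simp)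
    have h8 := h2 (hgc'.toSchwartzMap (Complex.ofRealCLM.contDiff.comp hg))
    refine Eq.trans (integral_congr_ae (Filter.Eventually.of_forall fun x => ?_)) h8
    exact Complex.real_smul
  rw [Lp.eq_zero_iff_ae_eq_zero]
  filter_upwards [h7] with x hx
  refine (mul_eq_zero.1 hx).resolve_left ?_
  rw [gaussianC_apply]
  exact_mod_cast (Real.exp_pos _).ne'

/-- The Hermite basis of `L²(ℝ)`. -/
def hermiteBasis : HilbertBasis ℕ ℂ L2 :=
  HilbertBasis.mkOfOrthogonalEqBot orthonormal_hermiteFun orthogonal_hermiteFun_eq_bot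

theorem hermiteBasis_apply (n : ℕ) : hermiteBasis n = schwartzToL2 (hermiteFun n) := by
  rw [hermiteBasis, HilbertBasis.coe_mkOfOrthogonalEqBot]

/-! ### Weighted shifts -/

section Shifts

variable {H : Type*} [NormedAddCommGroup H] [InnerProductSpace ℂ H] [CompleteSpace H]
variable {b : HilbertBasis ℕ ℂ H} {N D : H →ₗ.[ℂ] H}

variable (b) in
theorem exists_of_norm_le_succ {c : ℕ → ℂ} (x : H) (C : ℝ)
    (hc : ∀ n, ‖c n‖ ≤ C * ‖(inner ℂ (b (n + 1)) x : ℂ)‖) : ∃ y : H, ∀ n, inner ℂ (b n) y = c n := by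
  refine exists_of_summable b (Summable.of_nonneg_of_le (fun n => by positivity) (fun n => ?_)
    (((summable_nat_add_iff 1).2 (norm_sq_eq_tsum b x).summable).mul_left (C ^ 2)))
  rw [← mul_pow]
  gcongr
  exact hc n

variable (b) in
theorem exists_of_norm_le_pred {c : ℕ → ℂ} (x : H) (C : ℝ)
    (hc : ∀ n, ‖c (n + 1)‖ ≤ C * ‖(inner ℂ (b n) x : ℂ)‖) : ∃ y : H, ∀ n, inner ℂ (b n) y = c n := by
  refine exists_of_summable b ((summable_nat_add_iff 1).1 ?_)
  refine Summable.of_nonneg_of_le (fun n => by positivity) (fun n => ?_)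
    ((norm_sq_eq_tsum b x).summable.mul_left (C ^ 2))
  rw [← mul_pow]
  gcongr
  exact hc n

/-- `P` is the maximal operator lowering the basis vector `b n` to `√(2 n) b (n - 1)`. -/
def IsLowering (b : HilbertBasis ℕ ℂ H) (P : H →ₗ.[ℂ] H) : Prop :=
  ∀ x y, (x, y) ∈ P.graph ↔ ∀ n, inner ℂ (b n) y = (shiftWeight (n + 1) : ℂ) * inner ℂ (b (n + 1)) x

/-- `P` is the maximal operator raising the basis vector `b n` to `√(2 n + 2) b (n + 1)`. -/
def IsRaising (b : HilbertBasis ℕ ℂ H) (P : H →ₗ.[ℂ] H) : Prop :=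
  ∀ x y, (x, y) ∈ P.graph ↔ ∀ n, inner ℂ (b n) y = (shiftWeight n : ℂ) * inner ℂ (b (n - 1)) x

theorem IsLowering.inner_apply {P : H →ₗ.[ℂ] H} (hP : IsLowering b P) {x : H} (h : x ∈ P.domain) (n : ℕ) :
    inner ℂ (b n) (P ⟨x, h⟩) = (shiftWeight (n + 1) : ℂ) * inner ℂ (b (n + 1)) x :=
  (hP _ _).1 (mem_graph_iff.2 ⟨h, rfl⟩) n

theorem IsRaising.inner_apply {P : H →ₗ.[ℂ] H} (hP : IsRaising b P) {x : H} (h : x ∈ P.domain) (n : ℕ) :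
    inner ℂ (b n) (P ⟨x, h⟩) = (shiftWeight n : ℂ) * inner ℂ (b (n - 1)) x :=
  (hP _ _).1 (mem_graph_iff.2 ⟨h, rfl⟩) n

theorem IsLowering.mem_domain_iff {P : H →ₗ.[ℂ] H} (hP : IsLowering b P) {x : H} :
    x ∈ P.domain ↔ ∃ y, ∀ n, inner ℂ (b n) y = (shiftWeight (n + 1) : ℂ) * inner ℂ (b (n + 1)) x :=
  ⟨fun h => ⟨_, hP.inner_apply h⟩, fun ⟨_, hy⟩ => (mem_graph_iff.1 ((hP _ _).2 hy)).1⟩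

theorem IsRaising.mem_domain_iff {P : H →ₗ.[ℂ] H} (hP : IsRaising b P) {x : H} :
    x ∈ P.domain ↔ ∃ y, ∀ n, inner ℂ (b n) y = (shiftWeight n : ℂ) * inner ℂ (b (n - 1)) x :=
  ⟨fun h => ⟨_, hP.inner_apply h⟩, fun ⟨_, hy⟩ => (mem_graph_iff.1 ((hP _ _).2 hy)).1⟩

theorem IsLowering.basis_mem {P : H →ₗ.[ℂ] H} (hP : IsLowering b P) (n : ℕ) : b n ∈ P.domain := by
  refine hP.mem_domain_iff.2 ⟨(shiftWeight n : ℂ) • b (n - 1), fun m => ?_⟩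
  rw [inner_smul_right, inner_basis, inner_basis]
  rcases n with - | n
  · simp [shiftWeight_zero]
  · by_cases h : m = n
    · simp [h]
    · simp [h]

theorem IsLowering.apply_basis {P : H →ₗ.[ℂ] H} (hP : IsLowering b P) (n : ℕ) :
    P ⟨b n, hP.basis_mem n⟩ = (shiftWeight n : ℂ) • b (n - 1) := by
  refine basis_ext b fun m => ?_
  rw [hP.inner_apply, inner_smul_right, inner_basis, inner_basis]
  rcases n with - | n
  · simp [shiftWeight_zero]
  · by_cases h : m = n
    · simp [h]
    · simp [h]

theorem IsLowering.adjoint {P : H →ₗ.[ℂ] H} (hP : IsLowering b P) : IsRaising b P.adjoint := by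
  have hd : Dense (P.domain : Set H) := dense_of_basis_mem hP.basis_mem
  intro y z
  constructor
  · intro h n
    obtain ⟨hy, rfl⟩ := mem_graph_iff.1 h
    have h1 := LinearPMap.adjoint_isFormalAdjoint hd ⟨y, hy⟩ ⟨b n, hP.basis_mem n⟩
    rw [hP.apply_basis, inner_smul_right] at h1
    rw [← inner_conj_symm, h1, map_mul, inner_conj_symm, Complex.conj_ofReal]
  · intro h
    have h1 : ∀ x : P.domain, inner ℂ z (x : H) = inner ℂ y (P x) := by
      rintro ⟨x, hx⟩
      have e1 := (hasSum_nat_add_iff' 1).2 (b.hasSum_inner_mul_inner z x)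
      have e2 := b.hasSum_inner_mul_inner y (P ⟨x, hx⟩)
      -- A raised vector has no component on the lowest basis vector, so the two Parseval sums agree
      -- after a shift of the index by one.
      have e0 : inner ℂ z (b 0) = 0 := by
        rw [← inner_conj_symm, h, shiftWeight_zero]; simp
      rw [Finset.sum_range_one, e0, zero_mul, sub_zero] at e1
      refine e1.unique ?_
      convert! e2 using 2 with n
      rw [hP.inner_apply, ← inner_conj_symm, h, ← inner_conj_symm y, map_mul, Complex.conj_ofReal,
        Nat.add_sub_cancel]
      ring
    have hy := LinearPMap.mem_adjoint_domain_of_exists y ⟨z, h1⟩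
    exact mem_graph_iff.2 ⟨hy, LinearPMap.adjoint_apply_eq hd ⟨y, hy⟩ h1⟩

theorem pcomp_apply {S T : H →ₗ.[ℂ] H} {x : H} (h : x ∈ (pcomp S T).domain) :
    pcomp S T ⟨x, h⟩ = S ⟨T ⟨x, h.1⟩, h.2⟩ := rfl

theorem shiftWeight_mul_self (n : ℕ) : (shiftWeight n : ℂ) * shiftWeight n = 2 * n := by
  rw [← Complex.ofReal_mul, ← sq, shiftWeight_sq]; push_cast; ring

/-- The natural domain dom DD* ∩ dom D*D is already the maximal diagonal domain. Indeed, if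
(2n+1)x_n is square summable then so are the coefficients of Dx, D*x, DD*x and D*Dx, whose weights
are dominated by multiples of 2n + 1. So the operator is self-adjoint before taking any closure. -/
theorem IsLowering.preAngleSq_isDiag (hD : IsLowering b D) : IsDiag b (preAngleSq D) fun n => 2 * n + 1 := by
  have hA := hD.adjoint
  have e1 : ∀ x (h : x ∈ (pcomp D D.adjoint).domain) (n : ℕ),
      inner ℂ (b n) (pcomp D D.adjoint ⟨x, h⟩) = (2 * n + 2 : ℂ) * inner ℂ (b n) x := by
    intro x h n
    rw [pcomp_apply, hD.inner_apply, hA.inner_apply, ← mul_assoc, shiftWeight_mul_self, Nat.add_sub_cancel]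
    push_cast; ring
  have e2 : ∀ x (h : x ∈ (pcomp D.adjoint D).domain) (n : ℕ),
      inner ℂ (b n) (pcomp D.adjoint D ⟨x, h⟩) = (2 * n : ℂ) * inner ℂ (b n) x := by
    intro x h n
    rw [pcomp_apply, hA.inner_apply, hD.inner_apply]
    rcases n with - | n
    · simp [shiftWeight_zero]
    · rw [Nat.add_sub_cancel, ← mul_assoc, shiftWeight_mul_self]
  intro x y
  constructor
  · intro h n
    obtain ⟨⟨h1, h2⟩, rfl⟩ := mem_graph_iff.1 h
    change inner ℂ (b n) ((1 / 2 : ℂ) • (pcomp D D.adjoint ⟨x, h1⟩ + pcomp D.adjoint D ⟨x, h2⟩)) = _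
    rw [inner_smul_right, inner_add_right, e1, e2]
    push_cast; ring
  · intro h
    have hw : ∀ n, ‖(inner ℂ (b n) y : ℂ)‖ = (2 * n + 1) * ‖(inner ℂ (b n) x : ℂ)‖ := fun n => by
      rw [h, norm_mul, Complex.norm_real, Real.norm_of_nonneg (by positivity)]
    have hsw : ∀ n : ℕ, ‖(shiftWeight n : ℂ)‖ ≤ 2 * n := fun n => by
      rw [Complex.norm_real, Real.norm_of_nonneg (shiftWeight_nonneg n)]
      rcases n with - | n
      · simp [shiftWeight_zero]
      · have h1 := shiftWeight_sq (n + 1)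
        push_cast at h1 ⊢
        nlinarith [shiftWeight_nonneg (n + 1), n.cast_nonneg (α := ℝ)]
    have hx1 : x ∈ D.domain := by
      refine hD.mem_domain_iff.2 (exists_of_norm_le_succ b y 1 fun n => ?_)
      rw [norm_mul, hw, one_mul]
      have := hsw (n + 1)
      gcongr
      linarith
    have hx2 : x ∈ D.adjoint.domain := by
      refine hA.mem_domain_iff.2 (exists_of_norm_le_pred b y 2 fun n => ?_)
      rw [norm_mul, hw, Nat.add_sub_cancel, ← mul_assoc]
      have := hsw (n + 1)
      push_cast at this
      gcongr
      linarith
    have h1 : x ∈ (pcomp D D.adjoint).domain := by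
      refine ⟨hx2, hD.mem_domain_iff.2 (exists_of_norm_le b y 2 fun n => ?_)⟩
      rw [hA.inner_apply, ← mul_assoc, shiftWeight_mul_self, Nat.add_sub_cancel, norm_mul, hw, ← mul_assoc]
      gcongr
      rw [norm_mul, Complex.norm_natCast]
      push_cast
      simp
      linarith
    have h2 : x ∈ (pcomp D.adjoint D).domain := by
      refine ⟨hx1, hA.mem_domain_iff.2 (exists_of_norm_le b y 1 fun n => ?_)⟩
      rw [hD.inner_apply]
      rcases n with - | n
      · simp [shiftWeight_zero]
      · rw [Nat.add_sub_cancel, ← mul_assoc, shiftWeight_mul_self, norm_mul, hw, one_mul]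
        gcongr
        rw [norm_mul, Complex.norm_natCast]
        simp
    have hx : x ∈ (preAngleSq D).domain := ⟨h1, h2⟩
    refine mem_graph_iff.2 ⟨hx, basis_ext b fun n => ?_⟩
    change inner ℂ (b n) ((1 / 2 : ℂ) • (pcomp D D.adjoint ⟨x, h1⟩ + pcomp D.adjoint D ⟨x, h2⟩)) = _
    rw [inner_smul_right, inner_add_right, e1, e2, h]
    push_cast; ring

theorem IsLowering.angleSq_isDiag (hD : IsLowering b D) : IsDiag b (angleSq D) fun n => 2 * n + 1 := by
  have h := hD.preAngleSq_isDiag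
  rw [angleSq, closure_eq_self h.isSelfAdjoint.isClosed]
  exact h

theorem mem_smoothVectors_iff_exists (hN : IsDiag b N fun n => 2 * n + 1) {x : H} :
    x ∈ smoothVectors N ↔ ∀ l : ℕ, ∃ y, ∀ n, inner ℂ (b n) y = ((lam n ^ l : ℝ) : ℂ) * inner ℂ (b n) x := by
  rw [mem_smoothVectors_iff]
  exact forall_congr' fun l => mem_sobolev_iff hN l x

theorem lam_le_lam_succ (n : ℕ) : lam n ≤ lam (n + 1) := Real.sqrt_le_sqrt (by push_cast; linarith)

theorem lam_succ_le (n : ℕ) : lam (n + 1) ≤ 2 * lam n := by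
  have h1 := lam_sq n
  have h2 := lam_sq (n + 1)
  push_cast at h2
  nlinarith [lam_pos n, lam_pos (n + 1), n.cast_nonneg (α := ℝ)]

theorem smooth_of_norm_le_succ (hN : IsDiag b N fun n => 2 * n + 1) {x y : H} (hx : x ∈ smoothVectors N) (k : ℕ)
    (h : ∀ n, ‖(inner ℂ (b n) y : ℂ)‖ ≤ lam (n + 1) ^ k * ‖(inner ℂ (b (n + 1)) x : ℂ)‖) :
    y ∈ smoothVectors N := by
  rw [mem_smoothVectors_iff_exists hN] at hx ⊢
  intro l
  obtain ⟨z, hz⟩ := hx (l + k)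
  refine exists_of_norm_le_succ b z 1 fun n => ?_
  have h0 := lam_pos n
  have h1 := lam_pos (n + 1)
  rw [hz, norm_mul, norm_mul, Complex.norm_real, Complex.norm_real, Real.norm_of_nonneg (by positivity),
    Real.norm_of_nonneg (by positivity), one_mul, pow_add, mul_assoc]
  gcongr
  · exact lam_le_lam_succ n
  · exact h n

theorem smooth_of_norm_le_pred (hN : IsDiag b N fun n => 2 * n + 1) {x y : H} (hx : x ∈ smoothVectors N) (k : ℕ)
    (h : ∀ n, ‖(inner ℂ (b (n + 1)) y : ℂ)‖ ≤ lam n ^ k * ‖(inner ℂ (b n) x : ℂ)‖) :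
    y ∈ smoothVectors N := by
  rw [mem_smoothVectors_iff_exists hN] at hx ⊢
  intro l
  obtain ⟨z, hz⟩ := hx (l + k)
  refine exists_of_norm_le_pred b z (2 ^ l) fun n => ?_
  have h0 := lam_pos n
  have h1 := lam_pos (n + 1)
  rw [hz, norm_mul, norm_mul, Complex.norm_real, Complex.norm_real, Real.norm_of_nonneg (by positivity),
    Real.norm_of_nonneg (by positivity)]
  calc lam (n + 1) ^ l * ‖(inner ℂ (b (n + 1)) y : ℂ)‖
      ≤ (2 * lam n) ^ l * (lam n ^ k * ‖(inner ℂ (b n) x : ℂ)‖) := by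
        gcongr
        · exact lam_succ_le n
        · exact h n
    _ = _ := by rw [mul_pow, pow_add]; ring

theorem IsLowering.mem_smoothVectors (hN : IsDiag b N fun n => 2 * n + 1) (hD : IsLowering b D) {x : H}
    (hx : x ∈ smoothVectors N) : ∃ h : x ∈ D.domain, D ⟨x, h⟩ ∈ smoothVectors N := by
  have hsw : ∀ n, ‖(shiftWeight n : ℂ)‖ ≤ lam n := fun n => by
    rw [Complex.norm_real, Real.norm_of_nonneg (shiftWeight_nonneg n)]; exact shiftWeight_le_lam n
  have h : x ∈ D.domain := by
    obtain ⟨z, hz⟩ := (mem_smoothVectors_iff_exists hN).1 hx 1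
    refine hD.mem_domain_iff.2 (exists_of_norm_le_succ b z 1 fun n => ?_)
    rw [hz, norm_mul, norm_mul, one_mul, pow_one, Complex.norm_real (lam (n + 1)),
      Real.norm_of_nonneg (lam_pos _).le]
    gcongr
    exact hsw _
  refine ⟨h, smooth_of_norm_le_succ hN hx 1 fun n => ?_⟩
  rw [hD.inner_apply, norm_mul, pow_one]
  gcongr
  exact hsw _

theorem IsRaising.mem_smoothVectors (hN : IsDiag b N fun n => 2 * n + 1) (hD : IsRaising b D) {x : H}
    (hx : x ∈ smoothVectors N) : ∃ h : x ∈ D.domain, D ⟨x, h⟩ ∈ smoothVectors N := by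
  have hsw : ∀ n, ‖(shiftWeight (n + 1) : ℂ)‖ = lam n := fun n => by
    rw [Complex.norm_real, Real.norm_of_nonneg (shiftWeight_nonneg _), shiftWeight_succ]
  have h : x ∈ D.domain := by
    obtain ⟨z, hz⟩ := (mem_smoothVectors_iff_exists hN).1 hx 1
    refine hD.mem_domain_iff.2 (exists_of_norm_le_pred b z 1 fun n => ?_)
    rw [hz, norm_mul, norm_mul, one_mul, pow_one, Complex.norm_real (lam n),
      Real.norm_of_nonneg (lam_pos _).le, hsw, Nat.add_sub_cancel]
  refine ⟨h, smooth_of_norm_le_pred hN hx 1 fun n => ?_⟩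
  rw [hD.inner_apply, norm_mul, pow_one, hsw, Nat.add_sub_cancel]

end Shifts

/-- Let L be the closed subspace of pairs obeying the coefficient relation. Adjointness on Schwartz
functions puts the graph of `preOsc` inside L, and truncated Hermite expansions are dense in L, so L
is the closure of that graph. -/
theorem isLowering_osc : IsLowering hermiteBasis osc := by
  set b := hermiteBasis with hb
  let L : Submodule ℂ (L2 × L2) :=
    { carrier := {z | ∀ n, inner ℂ (b n) z.2 = (shiftWeight (n + 1) : ℂ) * inner ℂ (b (n + 1)) z.1}
      zero_mem' := fun n => by simp
      add_mem' := fun {z w} hz hw n => by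
        simp only [Prod.fst_add, Prod.snd_add, inner_add_right, hz n, hw n]; ring
      smul_mem' := fun c z hz n => by
        simp only [Prod.smul_fst, Prod.smul_snd, inner_smul_right, hz n]; ring }
  have hLc : IsClosed (L : Set (L2 × L2)) := by
    have : (L : Set (L2 × L2)) = ⋂ n, {z | inner ℂ (b n) z.2 = (shiftWeight (n + 1) : ℂ) * inner ℂ (b (n + 1)) z.1} := by
      ext z
      rw [Set.mem_iInter]
      exact Iff.rfl
    rw [this]
    exact isClosed_iInter fun n => isClosed_eq (by fun_prop) (by fun_prop)
  have hgr : ∀ φ, (schwartzToL2 φ, schwartzToL2 (oscSchwartz φ)) ∈ preOsc.graph := by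
    intro φ
    refine mem_graph_iff.2 ⟨⟨φ, rfl⟩, ?_⟩
    change schwartzToL2 (oscSchwartz ((LinearEquiv.ofInjective schwartzToL2 schwartzToL2_injective).symm
      ((LinearEquiv.ofInjective schwartzToL2 schwartzToL2_injective) φ))) = _
    rw [LinearEquiv.symm_apply_apply]
  have h1 : preOsc.graph ≤ L := by
    rintro ⟨x, y⟩ hxy n
    obtain ⟨⟨φ, hφ⟩, rfl⟩ := mem_graph_iff.1 hxy
    subst hφ
    have := (mem_graph_iff.1 (hgr φ)).2
    rw [this]
    simp only [hb]
    rw [hermiteBasis_apply, hermiteBasis_apply, ← inner_oscAdjSchwartz, oscAdjSchwartz_hermiteFun, map_smul,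
      inner_smul_left, Complex.conj_ofReal]
  have h2 : preOsc.graph.topologicalClosure ≤ L := Submodule.topologicalClosure_minimal _ h1 hLc
  have h3 : L ≤ preOsc.graph.topologicalClosure := by
    rintro ⟨x, y⟩ hxy
    -- One more term is kept for x than for y, because lowering kills the bottom vector and shifts
    -- the others down by one.
    have hx : Filter.Tendsto (fun k => ∑ n ∈ Finset.range (k + 1), (inner ℂ (b n) x : ℂ) • b n) Filter.atTop (nhds x) := by
      have := (b.hasSum_repr x).tendsto_sum_nat
      simp only [b.repr_apply_apply] at this
      exact this.comp (Filter.tendsto_add_atTop_nat 1)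
    have hy : Filter.Tendsto (fun k => ∑ n ∈ Finset.range k, (inner ℂ (b n) y : ℂ) • b n) Filter.atTop (nhds y) := by
      have := (b.hasSum_repr y).tendsto_sum_nat
      simpa only [b.repr_apply_apply] using this
    refine mem_closure_of_tendsto (hx.prodMk_nhds hy) (Filter.Eventually.of_forall fun k => ?_)
    have h4 := hgr (∑ n ∈ Finset.range (k + 1), (inner ℂ (b n) x : ℂ) • hermiteFun n)
    convert! h4 using 2
    · rw [map_sum]
      refine Finset.sum_congr rfl fun n _ => ?_
      rw [map_smul, hb, hermiteBasis_apply]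
    · rw [map_sum, map_sum, Finset.sum_range_succ']
      simp only [map_smul, oscSchwartz_hermiteFun, shiftWeight_zero]
      rw [Complex.ofReal_zero, zero_smul, smul_zero, add_zero]
      refine Finset.sum_congr rfl fun n _ => ?_
      rw [hxy n, Nat.add_sub_cancel, smul_smul, hb, hermiteBasis_apply n, mul_comm]
  have h5 : preOsc.graph.topologicalClosure = L := le_antisymm h2 h3
  -- Closability ensures that `LinearPMap.closure` has the closed graph; it holds because a pair (0,
  -- y) in L has y = 0.
  have hcl : preOsc.IsClosable := by
    refine ⟨L.toLinearPMap, ?_⟩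
    rw [h5]
    refine (Submodule.toLinearPMap_graph_eq L ?_).symm
    rintro ⟨x, y⟩ hxy (hx : x = 0)
    refine basis_ext b fun n => ?_
    rw [hxy n, hx]
    simp
  intro x y
  rw [osc, ← hcl.graph_closure_eq_closure_graph, h5]
  exact Iff.rfl

theorem osc_isClosed : osc.IsClosed := by
  have h : IsClosed {z : L2 × L2 | ∀ n, inner ℂ (hermiteBasis n) z.2 =
      (shiftWeight (n + 1) : ℂ) * inner ℂ (hermiteBasis (n + 1)) z.1} := by
    rw [Set.ofPred_forall]
    exact isClosed_iInter fun n => isClosed_eq (by fun_prop) (by fun_prop)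
  have e : (osc.graph : Set (L2 × L2)) = {z : L2 × L2 | ∀ n, inner ℂ (hermiteBasis n) z.2 =
      (shiftWeight (n + 1) : ℂ) * inner ℂ (hermiteBasis (n + 1)) z.1} := by
    ext ⟨x, y⟩
    exact isLowering_osc x y
  rw [LinearPMap.IsClosed, e]
  exact h

theorem dense_domain_osc : Dense (osc.domain : Set L2) :=
  dense_of_basis_mem isLowering_osc.basis_mem

theorem isRaising_osc_adjoint : IsRaising hermiteBasis osc.adjoint := isLowering_osc.adjoint

theorem isDiag_angleSq_osc : IsDiag hermiteBasis (angleSq osc) fun n => 2 * n + 1 :=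
  isLowering_osc.angleSq_isDiag

/-! ### Multiplication operators -/

open Classical in
/-- Multiplication by an essentially bounded function on `L²(ℝ)` (zero if it is not). -/
def mulL (a : ℝ → ℂ) : L2 →L[ℂ] L2 :=
  if h : MemLp a ∞ volume then (ContinuousLinearMap.mul ℂ ℂ).holderL volume ∞ 2 2 h.toLp else 0

theorem mulOp_eq_mulL (a : C1inf) : mulOp a = mulL (a : ℝ → ℂ) := by
  rw [mulL, dif_pos (C1inf.memLp_top a)]
  rfl

theorem mulL_apply {a : ℝ → ℂ} (h : MemLp a ∞ volume) (f : L2) :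
    (mulL a f : ℝ → ℂ) =ᵐ[volume] fun x => a x * f x := by
  have h1 := (ContinuousLinearMap.mul ℂ ℂ).coeFn_holder (r := 2) h.toLp f
  rw [mulL, dif_pos h]
  filter_upwards [h1, h.coeFn_toLp] with x h1 h2
  rw [← h2]
  exact h1

theorem memLp_top_of_continuous {a : ℝ → ℂ} (ha : Continuous a) {C : ℝ} (hC : ∀ x, ‖a x‖ ≤ C) :
    MemLp a ∞ volume :=
  memLp_top_of_bound ha.aestronglyMeasurable C (Filter.Eventually.of_forall hC)

theorem mulL_mul {a c : ℝ → ℂ} (ha : MemLp a ∞ volume) (hc : MemLp c ∞ volume)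
    (hac : MemLp (fun x => a x * c x) ∞ volume) : mulL (fun x => a x * c x) = mulL a * mulL c := by
  ext f
  change _ =ᵐ[volume] (mulL a (mulL c f) : ℝ → ℂ)
  filter_upwards [mulL_apply hac f, mulL_apply ha (mulL c f), mulL_apply hc f] with x h1 h2 h3
  rw [h1, h2, h3]
  ring

theorem star_mulL {a : ℝ → ℂ} (ha : MemLp a ∞ volume) (ha' : MemLp (fun x => star (a x)) ∞ volume) :
    star (mulL a) = mulL fun x => star (a x) := by
  rw [ContinuousLinearMap.star_eq_adjoint, eq_comm, ContinuousLinearMap.eq_adjoint_iff]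
  intro f g
  rw [L2.inner_def, L2.inner_def]
  refine integral_congr_ae ?_
  filter_upwards [mulL_apply ha' f, mulL_apply ha g] with x h1 h2
  rw [h1, h2]
  simp
  ring

theorem norm_mulL_le {a : ℝ → ℂ} (ha : MemLp a ∞ volume) {C : ℝ} (hC0 : 0 ≤ C) (hC : ∀ x, ‖a x‖ ≤ C) :
    ‖mulL a‖ ≤ C := by
  refine ContinuousLinearMap.opNorm_le_bound _ hC0 fun f => ?_
  refine Lp.norm_le_mul_norm_of_ae_le_mul ?_
  filter_upwards [mulL_apply ha f] with x h1
  rw [h1, norm_mul]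
  gcongr
  exact hC x

theorem inner_schwartzToL2_mulL {a : ℝ → ℂ} (ha : MemLp a ∞ volume) (φ ψ : 𝓢(ℝ, ℂ)) :
    inner ℂ (schwartzToL2 φ) (mulL a (schwartzToL2 ψ)) = ∫ x, star (φ x) * (a x * ψ x) := by
  rw [L2.inner_def]
  refine integral_congr_ae ?_
  filter_upwards [mulL_apply ha (schwartzToL2 ψ), schwartzToL2_coe φ, schwartzToL2_coe ψ] with x h1 h2 h3
  rw [h1, h2, h3]
  simp
  ring

theorem mat_mulL {a : ℝ → ℂ} (ha : MemLp a ∞ volume) (m n : ℕ) :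
    mat hermiteBasis (mulL a) m n = ∫ x, star (hermiteFun m x) * (a x * hermiteFun n x) := by
  rw [mat, hermiteBasis_apply, hermiteBasis_apply, inner_schwartzToL2_mulL ha]

/-- Integration by parts against Hermite functions gives the relation for D. The one for D* is its
complex conjugate, with f replaced by its conjugate and the indices exchanged. -/
theorem derivRel_mulL {f f' : ℝ → ℂ} (hf : ∀ x, HasDerivAt f (f' x) x) (hf' : Continuous f') {C C' : ℝ}
    (hC : ∀ x, ‖f x‖ ≤ C) (hC' : ∀ x, ‖f' x‖ ≤ C') : DerivRel hermiteBasis (mulL f) (mulL f') := by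
  have key : ∀ {f f' : ℝ → ℂ}, (∀ x, HasDerivAt f (f' x) x) → Continuous f' → (∀ x, ‖f x‖ ≤ C) →
      (∀ x, ‖f' x‖ ≤ C') → ∀ m n, (shiftWeight (m + 1) : ℂ) * mat hermiteBasis (mulL f) (m + 1) n
        - (shiftWeight n : ℂ) * mat hermiteBasis (mulL f) m (n - 1) = mat hermiteBasis (mulL f') m n := by
    intro f f' hf hf' hC hC' m n
    have hfc : Continuous f := continuous_iff_continuousAt.2 fun x => (hf x).continuousAt
    have h := integral_star_mul_mul_deriv (hermiteFun m) (hermiteFun n) hf hf' hC hC'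
    rw [mat_mulL (memLp_top_of_continuous hfc hC), mat_mulL (memLp_top_of_continuous hfc hC),
      mat_mulL (memLp_top_of_continuous hf' hC'), ← h, oscAdjSchwartz_hermiteFun, oscSchwartz_hermiteFun,
      ← integral_const_mul, ← integral_const_mul]
    congr 1
    · refine integral_congr_ae (Filter.Eventually.of_forall fun x => ?_)
      simp only [smul_apply, smul_eq_mul, star_mul', Complex.star_def, Complex.conj_ofReal]
      ring
    · refine integral_congr_ae (Filter.Eventually.of_forall fun x => ?_)
      simp only [smul_apply, smul_eq_mul]
      ring
  have hfc : Continuous f := continuous_iff_continuousAt.2 fun x => (hf x).continuousAt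
  refine ⟨key hf hf' hC hC', fun m n => ?_⟩
  have h1 := key (f := fun x => star (f x)) (f' := fun x => star (f' x)) (fun x => (hf x).star) hf'.star
    (fun x => by rw [norm_star]; exact hC x) (fun x => by rw [norm_star]; exact hC' x) n m
  rw [← star_mulL (memLp_top_of_continuous hfc hC) (memLp_top_of_continuous hfc.star (C := C) fun x => by
      rw [norm_star]; exact hC x), ← star_mulL (memLp_top_of_continuous hf' hC')
      (memLp_top_of_continuous hf'.star (C := C') fun x => by rw [norm_star]; exact hC' x), mat_star, mat_star,
      mat_star] at h1
  have h2 := congrArg (starRingEnd ℂ) h1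
  simp only [map_sub, map_mul, Complex.conj_ofReal, ← Complex.star_def, star_star] at h2
  linear_combination -h2

/-! ### Square integrable bounds -/

/-- Integrate (|u|²)' = 2 Re(ū u') from −∞ and apply the weighted arithmetic-geometric inequality.
The parameter t is left free so that it can be matched to the frequency of u. -/
theorem sq_norm_le_of_memLp {u u' : ℝ → ℂ} (hu : MemLp u 2 volume) (hu' : MemLp u' 2 volume)
    (hd : ∀ x, HasDerivAt u (u' x) x) {t : ℝ} (ht : 0 < t) (x : ℝ) :
    ‖u x‖ ^ 2 ≤ t * (∫ y, ‖u y‖ ^ 2) + t⁻¹ * ∫ y, ‖u' y‖ ^ 2 := by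
  have i1 := (memLp_two_iff_integrable_sq_norm hu.aestronglyMeasurable).1 hu
  have i2 := (memLp_two_iff_integrable_sq_norm hu'.aestronglyMeasurable).1 hu'
  have hdf : ∀ y, HasDerivAt (fun y => ‖u y‖ ^ 2) (2 * inner ℝ (u y) (u' y)) y := fun y => (hd y).norm_sq
  have hle : ∀ y, ‖2 * (inner ℝ (u y) (u' y) : ℝ)‖ ≤ t * ‖u y‖ ^ 2 + t⁻¹ * ‖u' y‖ ^ 2 := by
    intro y
    have h1 := norm_inner_le_norm (𝕜 := ℝ) (u y) (u' y)
    have h2 : 2 * (‖u y‖ * ‖u' y‖) ≤ t * ‖u y‖ ^ 2 + t⁻¹ * ‖u' y‖ ^ 2 := by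
      have h3 : t * ‖u y‖ ^ 2 + t⁻¹ * ‖u' y‖ ^ 2 - 2 * (‖u y‖ * ‖u' y‖) = t⁻¹ * (t * ‖u y‖ - ‖u' y‖) ^ 2 := by
        field_simp
        ring
      have : 0 ≤ t⁻¹ * (t * ‖u y‖ - ‖u' y‖) ^ 2 := by positivity
      linarith
    rw [norm_mul, Real.norm_of_nonneg zero_le_two]
    linarith
  have i3 : Integrable fun y => 2 * (inner ℝ (u y) (u' y) : ℝ) := by
    refine ((i1.const_mul t).add (i2.const_mul t⁻¹)).mono' ?_ (Filter.Eventually.of_forall hle)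
    exact (hu.aestronglyMeasurable.inner hu'.aestronglyMeasurable).const_mul 2
  have h0 := tendsto_zero_of_hasDerivAt_of_integrableOn_Iic (a := x) (fun y _ => hdf y) i3.integrableOn
    i1.integrableOn
  have h1 := integral_Iic_of_hasDerivAt_of_tendsto (a := x) (hdf x).continuousAt.continuousWithinAt
    (fun y _ => hdf y) i3.integrableOn h0
  rw [sub_zero] at h1
  rw [← h1, ← integral_const_mul, ← integral_const_mul, ← integral_add (i1.const_mul t) (i2.const_mul t⁻¹)]
  refine (Real.le_norm_self _).trans ((norm_integral_le_integral_norm _).trans ?_)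
  refine (setIntegral_le_integral i3.norm (Filter.Eventually.of_forall fun _ => norm_nonneg _)).trans ?_
  exact integral_mono i3.norm ((i1.const_mul t).add (i2.const_mul t⁻¹)) hle

theorem integral_norm_sq_schwartz (φ : 𝓢(ℝ, ℂ)) : (∫ x, ‖φ x‖ ^ 2) = ‖schwartzToL2 φ‖ ^ 2 := by
  have h := inner_schwartzToL2 φ φ
  rw [inner_self_eq_norm_sq_to_K] at h
  have h2 : ((∫ x, ‖φ x‖ ^ 2 : ℝ) : ℂ) = ((‖schwartzToL2 φ‖ ^ 2 : ℝ) : ℂ) := by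
    rw [← integral_complex_ofReal]
    push_cast
    refine Eq.trans ?_ h.symm
    refine integral_congr_ae (Filter.Eventually.of_forall fun x => ?_)
    simp only [Complex.star_def]
    rw [← Complex.normSq_eq_conj_mul_self, Complex.normSq_eq_norm_sq]
    push_cast
    rfl
  exact Complex.ofReal_injective h2

/-- Apply the pointwise bound to the reproducing kernel u = Σ_{n<N} conj(φ_n(x)) φ_n. Both u(x) and
‖u‖² equal the sum S. Since u' = (D − D*)u/2, also ‖u'‖² ≤ 2N S. With t = √(2N) the two terms
balance to S² ≤ 2√(2N) S. -/
theorem sum_norm_sq_hermiteFun_le (N : ℕ) (x : ℝ) :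
    ∑ n ∈ Finset.range N, ‖hermiteFun n x‖ ^ 2 ≤ 2 * Real.sqrt (2 * N) := by
  rcases Nat.eq_zero_or_pos N with rfl | hN
  · simp
  set c : ℕ → ℂ := fun n => star (hermiteFun n x) with hc
  set u : 𝓢(ℝ, ℂ) := ∑ n ∈ Finset.range N, c n • hermiteFun n with hu
  set S : ℝ := ∑ n ∈ Finset.range N, ‖hermiteFun n x‖ ^ 2 with hS
  have hN0 : (0 : ℝ) < N := by exact_mod_cast hN
  have hS0 : 0 ≤ S := Finset.sum_nonneg fun _ _ => by positivity
  have hL : ∀ d : ℕ → ℂ, schwartzToL2 (∑ n ∈ Finset.range N, d n • hermiteFun n)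
      = ∑ n ∈ Finset.range N, d n • schwartzToL2 (hermiteFun n) := fun d => by simp [map_sum]
  have hcc : ∀ n, (starRingEnd ℂ) (c n) * c n = ((‖hermiteFun n x‖ ^ 2 : ℝ) : ℂ) := fun n => by
    rw [← Complex.normSq_eq_conj_mul_self, Complex.normSq_eq_norm_sq, hc, norm_star]
  have hAu : oscAdjSchwartz (oscSchwartz u) = ∑ n ∈ Finset.range N, ((2 * n : ℂ) * c n) • hermiteFun n := by
    rw [hu, map_sum, map_sum]
    refine Finset.sum_congr rfl fun n _ => ?_
    rw [map_smul, map_smul, oscAdj_oscSchwartz_hermiteFun, smul_smul, mul_comm]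
  have n0 : ‖schwartzToL2 u‖ ^ 2 = S := by
    have h := inner_self_eq_norm_sq_to_K (𝕜 := ℂ) (schwartzToL2 u)
    rw [hu, hL, orthonormal_hermiteFun.inner_sum, Finset.sum_congr rfl fun n _ => hcc n, ← Complex.ofReal_sum,
      ← hL, ← hu] at h
    have h' : ((‖schwartzToL2 u‖ ^ 2 : ℝ) : ℂ) = (S : ℂ) := by rw [h]; push_cast; rfl
    exact Complex.ofReal_injective h'
  have n1 : ‖schwartzToL2 (oscSchwartz u)‖ ^ 2 ≤ (2 * N - 2) * S := by
    have h := inner_self_eq_norm_sq_to_K (𝕜 := ℂ) (schwartzToL2 (oscSchwartz u))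
    rw [inner_oscSchwartz_left, hAu, hu, hL, hL, orthonormal_hermiteFun.inner_sum, ← hu] at h
    have h' : ((‖schwartzToL2 (oscSchwartz u)‖ ^ 2 : ℝ) : ℂ)
        = ((∑ n ∈ Finset.range N, (2 * n) * ‖hermiteFun n x‖ ^ 2 : ℝ) : ℂ) := by
      push_cast
      refine Eq.trans h.symm (Finset.sum_congr rfl fun n _ => ?_)
      have := hcc n
      push_cast at this
      rw [← this]
      ring
    rw [Complex.ofReal_injective h', hS, Finset.mul_sum]
    refine Finset.sum_le_sum fun n hn => ?_
    have : (n : ℝ) + 1 ≤ N := by exact_mod_cast Finset.mem_range.1 hn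
    gcongr
    linarith
  have n2 : ‖schwartzToL2 (oscAdjSchwartz u)‖ ^ 2 = ‖schwartzToL2 (oscSchwartz u)‖ ^ 2 + 2 * S := by
    have h := inner_self_eq_norm_sq_to_K (𝕜 := ℂ) (schwartzToL2 (oscAdjSchwartz u))
    rw [inner_oscAdjSchwartz, oscSchwartz_commutator, map_add, map_smul, inner_add_right, inner_smul_right,
      ← inner_oscSchwartz_left, inner_self_eq_norm_sq_to_K, inner_self_eq_norm_sq_to_K] at h
    have h' : ((‖schwartzToL2 (oscAdjSchwartz u)‖ ^ 2 : ℝ) : ℂ)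
        = ((‖schwartzToL2 (oscSchwartz u)‖ ^ 2 + 2 * S : ℝ) : ℂ) := by
      rw [← n0]
      push_cast
      exact h.symm
    exact Complex.ofReal_injective h'
  set v : 𝓢(ℝ, ℂ) := SchwartzMap.derivCLM ℂ ℂ u with hv
  have hv' : v = (1 / 2 : ℂ) • (oscSchwartz u - oscAdjSchwartz u) := by
    ext y
    rw [hv, SchwartzMap.derivCLM_apply, smul_apply, sub_apply, oscSchwartz_apply, oscAdjSchwartz_apply, smul_eq_mul]
    ring
  have n3 : ‖schwartzToL2 v‖ ^ 2 ≤ 2 * N * S := by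
    have h1 : ‖schwartzToL2 v‖ ≤ 1 / 2 * (‖schwartzToL2 (oscSchwartz u)‖ + ‖schwartzToL2 (oscAdjSchwartz u)‖) := by
      rw [hv', map_smul, map_sub, norm_smul]
      have : ‖(1 / 2 : ℂ)‖ = 1 / 2 := by simp
      rw [this]
      gcongr
      exact norm_sub_le _ _
    have h2 := sq_nonneg (‖schwartzToL2 (oscSchwartz u)‖ - ‖schwartzToL2 (oscAdjSchwartz u)‖)
    have h3 := pow_le_pow_left₀ (norm_nonneg _) h1 2
    nlinarith
  have hsob := sq_norm_le_of_memLp (u.memLp 2 volume) (v.memLp 2 volume) (fun y => by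
    rw [hv, SchwartzMap.derivCLM_apply]; exact u.hasDerivAt y) (t := Real.sqrt (2 * N)) (by positivity) x
  rw [integral_norm_sq_schwartz, integral_norm_sq_schwartz, n0] at hsob
  have hux : u x = (S : ℂ) := by
    have e : ∀ s : Finset ℕ, (∑ n ∈ s, c n • hermiteFun n) x = ∑ n ∈ s, c n * hermiteFun n x := by
      intro s
      induction s using Finset.induction_on with
      | empty => simp
      | insert a s ha ih => rw [Finset.sum_insert ha, Finset.sum_insert ha, add_apply, ih, smul_apply, smul_eq_mul]
    rw [hu, e, hS, Complex.ofReal_sum]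
    refine Finset.sum_congr rfl fun n _ => ?_
    rw [hc]
    change (starRingEnd ℂ) _ * _ = _
    rw [← Complex.normSq_eq_conj_mul_self, Complex.normSq_eq_norm_sq]
  rw [hux, Complex.norm_real, Real.norm_of_nonneg hS0] at hsob
  have hsq : Real.sqrt (2 * N) ^ 2 = 2 * N := Real.sq_sqrt (by positivity)
  have ht : 0 < Real.sqrt (2 * N) := by positivity
  have h5 : (Real.sqrt (2 * N))⁻¹ * ‖schwartzToL2 v‖ ^ 2 ≤ Real.sqrt (2 * N) * S := by
    rw [inv_mul_le_iff₀ ht, ← mul_assoc, ← sq, hsq]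
    exact n3
  have h6 : S * S ≤ 2 * Real.sqrt (2 * N) * S := by nlinarith
  rcases hS0.eq_or_lt with h | h
  · rw [← h]; positivity
  · exact le_of_mul_le_mul_right h6 h

/-- Of the tail, only the n + 2 terms with index from n + 1 to 2n + 2 are needed; each is at least
(2n+2)^(−s/2 − 1). This form prepares a summation by parts. -/
theorem rpow_le_tsum {s : ℝ} (hs : 0 < s) (n : ℕ) :
    ENNReal.ofReal ((2 * n + 2 : ℝ) ^ (-(s / 2))) ≤
      2 * ∑' k : ℕ, ENNReal.ofReal (((n + 1 + k : ℕ) : ℝ) ^ (-(s / 2) - 1)) := by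
  have h1 : ∑ k ∈ Finset.range (n + 2), ENNReal.ofReal (((n + 1 + k : ℕ) : ℝ) ^ (-(s / 2) - 1)) ≤
      ∑' k : ℕ, ENNReal.ofReal (((n + 1 + k : ℕ) : ℝ) ^ (-(s / 2) - 1)) := ENNReal.sum_le_tsum _
  refine le_trans ?_ (mul_le_mul_right h1 2)
  rw [← ENNReal.ofReal_sum_of_nonneg fun k _ => by positivity]
  have : (2 : ℝ≥0∞) = ENNReal.ofReal 2 := by simp
  rw [this, ← ENNReal.ofReal_mul zero_le_two]
  refine ENNReal.ofReal_le_ofReal ?_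
  have h2 : ∀ k ∈ Finset.range (n + 2), (2 * n + 2 : ℝ) ^ (-(s / 2) - 1) ≤ ((n + 1 + k : ℕ) : ℝ) ^ (-(s / 2) - 1) := by
    intro k hk
    have : (k : ℝ) ≤ n + 1 := by exact_mod_cast Nat.lt_succ_iff.1 (Finset.mem_range.1 hk)
    refine Real.rpow_le_rpow_of_nonpos (by positivity) ?_ (by linarith)
    push_cast
    linarith
  have h3 := Finset.card_nsmul_le_sum _ _ _ h2
  rw [Finset.card_range, nsmul_eq_mul] at h3
  have h4 : (2 * n + 2 : ℝ) ^ (-(s / 2) - 1) * (2 * n + 2) = (2 * n + 2 : ℝ) ^ (-(s / 2)) := by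
    rw [Real.rpow_sub_one (by positivity)]
    field_simp
  have h5 : 0 ≤ (2 * n + 2 : ℝ) ^ (-(s / 2) - 1) := by positivity
  set T := ∑ k ∈ Finset.range (n + 2), ((n + 1 + k : ℕ) : ℝ) ^ (-(s / 2) - 1)
  push_cast at h3
  nlinarith

/-- Summation by parts: replace the weight by a tail sum and exchange the sums. The O(√N) bound then
leaves Σ N^(−s/2 − 1/2), which converges precisely when s > 1. -/
theorem exists_tsum_hermiteFun_le {s : ℝ} (hs : 1 < s) : ∃ C : ℝ≥0∞, C < ⊤ ∧ ∀ x,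
    ∑' n, ENNReal.ofReal (lam n ^ (-s)) * ‖hermiteFun n x‖ₑ ^ 2 ≤ C := by
  set w : ℕ → ℝ≥0∞ := fun N => ENNReal.ofReal ((N : ℝ) ^ (-(s / 2) - 1)) with hw
  have hterm : ∀ N : ℕ, w N * ENNReal.ofReal (2 * Real.sqrt (2 * N))
      = ENNReal.ofReal (2 * Real.sqrt 2 * (N : ℝ) ^ (-(s / 2) - 1 / 2)) := by
    intro N
    rw [hw, ← ENNReal.ofReal_mul (by positivity)]
    congr 1
    rcases Nat.eq_zero_or_pos N with rfl | hN
    · simp only [Nat.cast_zero, mul_zero, Real.sqrt_zero]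
      rw [Real.zero_rpow (by linarith)]
      simp
    · have hN0 : (0 : ℝ) < N := by exact_mod_cast hN
      rw [Real.sqrt_mul zero_le_two, Real.sqrt_eq_rpow (N : ℝ)]
      have : (N : ℝ) ^ (-(s / 2) - 1 / 2) = (N : ℝ) ^ (-(s / 2) - 1) * (N : ℝ) ^ (1 / 2 : ℝ) := by
        rw [← Real.rpow_add hN0]; congr 1; ring
      rw [this]
      ring
  refine ⟨2 * ∑' N : ℕ, w N * ENNReal.ofReal (2 * Real.sqrt (2 * N)), ?_, fun x => ?_⟩
  · refine ENNReal.mul_lt_top (by simp) (lt_top_iff_ne_top.2 ?_)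
    simp only [hterm]
    exact ((Real.summable_nat_rpow.2 (by linarith)).mul_left _).tsum_ofReal_ne_top
  · set a : ℕ → ℝ≥0∞ := fun n => ‖hermiteFun n x‖ₑ ^ 2 with ha
    have h1 : ∀ n, ENNReal.ofReal (lam n ^ (-s)) ≤ 2 * ∑' N : ℕ, if n < N then w N else 0 := by
      intro n
      have e : lam n ^ (-s) = (2 * n + 2 : ℝ) ^ (-(s / 2)) := by
        rw [lam, Real.sqrt_eq_rpow, ← Real.rpow_mul (by positivity)]
        congr 1
        ring
      rw [e]
      refine (rpow_le_tsum (by linarith) n).trans (mul_le_mul_right ?_ 2)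
      have hinj : Function.Injective fun k : ℕ => n + 1 + k := fun k l h => by simpa using h
      refine le_trans (le_of_eq ?_) (ENNReal.tsum_comp_le_tsum_of_injective hinj _)
      refine tsum_congr fun k => ?_
      rw [if_pos (by omega)]
    calc ∑' n, ENNReal.ofReal (lam n ^ (-s)) * a n
        ≤ ∑' n, (2 * ∑' N : ℕ, if n < N then w N else 0) * a n :=
          ENNReal.tsum_le_tsum fun n => mul_le_mul_left (h1 n) _
      _ = 2 * ∑' n, ∑' N : ℕ, (if n < N then w N else 0) * a n := by
          rw [← ENNReal.tsum_mul_left]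
          refine tsum_congr fun n => ?_
          rw [mul_assoc, ENNReal.tsum_mul_right]
      _ = 2 * ∑' N : ℕ, ∑' n, (if n < N then w N else 0) * a n := by rw [ENNReal.tsum_comm]
      _ ≤ _ := by
          refine mul_le_mul_right (ENNReal.tsum_le_tsum fun N => ?_) 2
          have h2 : ∑' n, (if n < N then w N else 0) * a n = w N * ∑ n ∈ Finset.range N, a n := by
            rw [Finset.mul_sum, tsum_eq_sum (s := Finset.range N)]
            · refine Finset.sum_congr rfl fun n hn => ?_
              rw [if_pos (Finset.mem_range.1 hn)]
            · intro n hn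
              rw [if_neg (by simpa using hn), zero_mul]
          rw [h2]
          refine mul_le_mul_right ?_ (w N)
          have h3 : ∑ n ∈ Finset.range N, a n = ENNReal.ofReal (∑ n ∈ Finset.range N, ‖hermiteFun n x‖ ^ 2) := by
            rw [ENNReal.ofReal_sum_of_nonneg fun n _ => by positivity]
            refine Finset.sum_congr rfl fun n _ => ?_
            rw [ha, ENNReal.ofReal_pow (norm_nonneg _), ofReal_norm]
          rw [h3]
          exact ENNReal.ofReal_le_ofReal (sum_norm_sq_hermiteFun_le N x)

theorem enorm_sq_L2 (f : L2) : ‖f‖ₑ ^ 2 = ∫⁻ x, ‖f x‖ₑ ^ 2 := by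
  have h := eLpNorm_nnreal_pow_eq_lintegral (f := (f : ℝ → ℂ)) (μ := volume) (p := 2) (by norm_num)
  rw [Lp.enorm_def]
  simpa using h

/-- A function with a bound on its `L²` norm has a bounded multiplication operator which is
Hilbert-Schmidt with respect to the weights. -/
theorem hs_mulL_lt_top {a : ℝ → ℂ} (ha : MemLp a ∞ volume) (ha2 : MemLp a 2 volume) {s : ℝ} (hs1 : 1 < s) :
    hs hermiteBasis (mulL a * negPow (angleSq osc) (s / 2)) < ⊤ := by
  obtain ⟨C, hC, hle⟩ := exists_tsum_hermiteFun_le hs1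
  have hn := negPow_apply isDiag_angleSq_osc (s := s / 2) (by linarith)
  have h1 : ∀ n, ‖(mulL a * negPow (angleSq osc) (s / 2)) (hermiteBasis n)‖ₑ ^ 2
      = ∫⁻ x, ENNReal.ofReal (lam n ^ (-s)) * (‖a x‖ₑ ^ 2 * ‖hermiteFun n x‖ₑ ^ 2) := by
    intro n
    change ‖mulL a (negPow (angleSq osc) (s / 2) (hermiteBasis n))‖ₑ ^ 2 = _
    rw [hn, map_smul, enorm_smul, mul_pow, enorm_sq_L2, hermiteBasis_apply]
    rw [lintegral_const_mul' _ _ ENNReal.ofReal_ne_top]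
    congr 1
    · rw [← ofReal_norm, Complex.norm_real, Real.norm_of_nonneg (by have := lam_pos n; positivity),
        ← ENNReal.ofReal_pow (by have := lam_pos n; positivity), ← Real.rpow_natCast,
        ← Real.rpow_mul (lam_pos n).le]
      congr 2
      push_cast
      ring
    · refine lintegral_congr_ae ?_
      filter_upwards [mulL_apply ha (schwartzToL2 (hermiteFun n)), schwartzToL2_coe (hermiteFun n)] with x h1 h2
      rw [h1, h2, enorm_mul, mul_pow]
  have hmeas : AEMeasurable (fun x => ‖a x‖ₑ ^ 2) volume := (ha2.aestronglyMeasurable.enorm).pow_const 2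
  rw [hs]
  simp only [h1]
  have hm : ∀ n : ℕ, AEMeasurable (fun x => ENNReal.ofReal (lam n ^ (-s)) * (‖a x‖ₑ ^ 2 * ‖hermiteFun n x‖ₑ ^ 2))
      volume := fun n => (hmeas.mul
    ((hermiteFun n).continuous.enorm.measurable.pow_const 2).aemeasurable).const_mul _
  -- Tonelli reduces the Hilbert-Schmidt norm to ∫ |a|² times the uniformly bounded weighted sum of
  -- squared Hermite functions.
  rw [← lintegral_tsum hm]
  have h2 : ∀ x, ∑' n, ENNReal.ofReal (lam n ^ (-s)) * (‖a x‖ₑ ^ 2 * ‖hermiteFun n x‖ₑ ^ 2) ≤ ‖a x‖ₑ ^ 2 * C := by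
    intro x
    refine le_trans (le_of_eq ?_) (mul_le_mul_right (hle x) (‖a x‖ₑ ^ 2))
    rw [← ENNReal.tsum_mul_left]
    refine tsum_congr fun n => ?_
    ring
  refine (lintegral_mono h2).trans_lt ?_
  rw [lintegral_mul_const' _ _ hC.ne]
  refine ENNReal.mul_lt_top ?_ hC
  have h3 := enorm_sq_L2 ha2.toLp
  have h4 : ∫⁻ x, ‖ha2.toLp a x‖ₑ ^ 2 = ∫⁻ x, ‖a x‖ₑ ^ 2 := by
    refine lintegral_congr_ae ?_
    filter_upwards [ha2.coeFn_toLp] with x hx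
    rw [hx]
  rw [← h4, ← h3]
  exact ENNReal.pow_lt_top enorm_lt_top

/-- Smooth functions all of whose derivatives are square integrable. -/
def IsSmoothL2 (h : ℝ → ℂ) : Prop :=
  ∃ F : ℕ → ℝ → ℂ, F 0 = h ∧ ∀ k, MemLp (F k) 2 volume ∧ ∀ x, HasDerivAt (F k) (F (k + 1) x) x

theorem bounded_of_memLp {u u' : ℝ → ℂ} (hu : MemLp u 2 volume) (hu' : MemLp u' 2 volume)
    (hd : ∀ x, HasDerivAt u (u' x) x) : ∃ C, ∀ x, ‖u x‖ ≤ C := by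
  refine ⟨Real.sqrt (1 * (∫ y, ‖u y‖ ^ 2) + 1⁻¹ * ∫ y, ‖u' y‖ ^ 2), fun x => ?_⟩
  exact Real.le_sqrt_of_sq_le (sq_norm_le_of_memLp hu hu' hd one_pos x)

theorem IsSmoothL2.continuous {h : ℝ → ℂ} (hh : IsSmoothL2 h) : Continuous h := by
  obtain ⟨F, rfl, hF⟩ := hh
  exact continuous_iff_continuousAt.2 fun x => ((hF 0).2 x).continuousAt

theorem IsSmoothL2.bounded {h : ℝ → ℂ} (hh : IsSmoothL2 h) : ∃ C, ∀ x, ‖h x‖ ≤ C := by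
  obtain ⟨F, rfl, hF⟩ := hh
  exact bounded_of_memLp (hF 0).1 (hF 1).1 (hF 0).2

theorem IsSmoothL2.memLp_top {h : ℝ → ℂ} (hh : IsSmoothL2 h) : MemLp h ∞ volume := by
  obtain ⟨C, hC⟩ := hh.bounded
  exact memLp_top_of_continuous hh.continuous hC

theorem IsSmoothL2.memLp {h : ℝ → ℂ} (hh : IsSmoothL2 h) : MemLp h 2 volume := by
  obtain ⟨F, rfl, hF⟩ := hh
  exact (hF 0).1

theorem IsSmoothL2.star {h : ℝ → ℂ} (hh : IsSmoothL2 h) : IsSmoothL2 fun x => star (h x) := by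
  obtain ⟨F, rfl, hF⟩ := hh
  exact ⟨fun k x => Star.star (F k x), rfl, fun k => ⟨(hF k).1.star, fun x => ((hF k).2 x).star⟩⟩

theorem IsSmoothL2.mulL_mem_HSB2 {h : ℝ → ℂ} (hh : IsSmoothL2 h) :
    mulL h ∈ HSB2 hermiteBasis (angleSq osc) 1 := fun s hs => by
  refine ⟨hs_mulL_lt_top hh.memLp_top hh.memLp hs, ?_⟩
  rw [star_mulL hh.memLp_top hh.star.memLp_top]
  exact hs_mulL_lt_top hh.star.memLp_top hh.star.memLp hs

theorem IsSmoothL2.isDerivTower_mulL {h : ℝ → ℂ} (hh : IsSmoothL2 h) :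
    IsDerivTower hermiteBasis (angleSq osc) 1 (mulL h) := by
  obtain ⟨F, rfl, hF⟩ := hh
  have hs : ∀ k, IsSmoothL2 (F k) := fun k => ⟨fun j => F (j + k), by simp, fun j => by
    have h := hF (j + k)
    rw [show j + k + 1 = j + 1 + k by ring] at h
    exact h⟩
  refine ⟨fun k => mulL (F k), rfl, fun k => ⟨(hs k).mulL_mem_HSB2, ?_⟩⟩
  obtain ⟨C, hC⟩ := (hs k).bounded
  obtain ⟨C', hC'⟩ := (hs (k + 1)).bounded
  exact derivRel_mulL (hF k).2 (hs (k + 1)).continuous hC hC'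

/-! ### Factorization of smooth integrable functions -/

/-- Smoothness is obtained from a class of functions closed under differentiation, so no formula for
higher derivatives is ever needed. -/
theorem exists_derivative_tower {E : Type*} [NormedAddCommGroup E] [NormedSpace ℝ E] {S : Set (ℝ → E)}
    (h : ∀ u ∈ S, ∃ u' ∈ S, ∀ x, HasDerivAt u (u' x) x) {u : ℝ → E} (hu : u ∈ S) :
    ∃ F : ℕ → ℝ → E, F 0 = u ∧ ∀ k, F k ∈ S ∧ ∀ x, HasDerivAt (F k) (F (k + 1) x) x := by
  choose! d hd hd' using h
  have hm : ∀ k, d^[k] u ∈ S := fun k => by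
    induction k with
    | zero => exact hu
    | succ k ih => rw [Function.iterate_succ_apply']; exact hd _ ih
  refine ⟨fun k => d^[k] u, rfl, fun k => ⟨hm k, fun x => ?_⟩⟩
  simp only [Function.iterate_succ_apply']
  exact hd' _ (hm k) x

/-- Boundedness and stability under differentiation pass to sums and products, so they need only be
checked on generators of the algebra. -/
theorem bounded_and_deriv_of_mem_adjoin {S : Set (ℝ → ℝ)} (hb : ∀ p ∈ S, ∃ C, ∀ x, |p x| ≤ C)
    (hd : ∀ p ∈ S, ∃ p' ∈ Algebra.adjoin ℝ S, ∀ x, HasDerivAt p (p' x) x) {p : ℝ → ℝ}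
    (hp : p ∈ Algebra.adjoin ℝ S) :
    (∃ C, ∀ x, |p x| ≤ C) ∧ ∃ p' ∈ Algebra.adjoin ℝ S, ∀ x, HasDerivAt p (p' x) x := by
  induction hp using Algebra.adjoin_induction with
  | mem p h => exact ⟨hb p h, hd p h⟩
  | algebraMap r => exact ⟨⟨|r|, fun x => le_rfl⟩, 0, Subalgebra.zero_mem _, fun x => hasDerivAt_const x r⟩
  | add p q hp hq ihp ihq =>
    obtain ⟨⟨C, hC⟩, p', hp', hdp⟩ := ihp
    obtain ⟨⟨C', hC'⟩, q', hq', hdq⟩ := ihq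
    exact ⟨⟨C + C', fun x => (abs_add_le _ _).trans (add_le_add (hC x) (hC' x))⟩, p' + q',
      Subalgebra.add_mem _ hp' hq', fun x => (hdp x).add (hdq x)⟩
  | mul p q hp hq ihp ihq =>
    obtain ⟨⟨C, hC⟩, p', hp', hdp⟩ := ihp
    obtain ⟨⟨C', hC'⟩, q', hq', hdq⟩ := ihq
    refine ⟨⟨C * C', fun x => ?_⟩, p' * q + p * q',
      Subalgebra.add_mem _ (Subalgebra.mul_mem _ hp' hq) (Subalgebra.mul_mem _ hp hq'),
      fun x => (hdp x).mul (hdq x)⟩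
    rw [Pi.mul_apply, abs_mul]
    exact mul_le_mul (hC x) (hC' x) (abs_nonneg _) ((abs_nonneg _).trans (hC x))

/-- The function `1 / (1 + x²)` and its derivatives, which it dominates. -/
theorem exists_kernel_tower : ∃ K : ℕ → ℝ → ℝ, (K 0 = fun x => (1 + x ^ 2)⁻¹) ∧
    (∀ k x, HasDerivAt (K k) (K (k + 1) x) x) ∧ ∀ k, ∃ C, 0 ≤ C ∧ ∀ x, |K k x| ≤ C * (1 + x ^ 2)⁻¹ := by
  -- With c = 1/(1+x²) and a = xc one has c' = −2ac and a' = 2c² − c. The bounded algebra they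
  -- generate is thus stable under d/dx, and every derivative of c is an element of it times c.
  set a : ℝ → ℝ := fun x => x * (1 + x ^ 2)⁻¹ with ha
  set c : ℝ → ℝ := fun x => (1 + x ^ 2)⁻¹ with hc
  set S : Set (ℝ → ℝ) := {a, c} with hS
  have haS : a ∈ Algebra.adjoin ℝ S := Algebra.subset_adjoin (Or.inl rfl)
  have hcS : c ∈ Algebra.adjoin ℝ S := Algebra.subset_adjoin (Or.inr rfl)
  have hpos : ∀ x : ℝ, 0 < 1 + x ^ 2 := fun x => by positivity
  have hdc : ∀ x, HasDerivAt c (((-2 : ℝ) • (a * c)) x) x := by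
    intro x
    have h := ((hasDerivAt_pow 2 x).const_add 1).inv (hpos x).ne'
    convert! h using 1
    simp only [ha, hc, Pi.smul_apply, Pi.mul_apply, smul_eq_mul]
    have := (hpos x).ne'
    field_simp
    simp
  have hda : ∀ x, HasDerivAt a (((2 : ℝ) • (c * c) - c) x) x := by
    intro x
    have h := (hasDerivAt_id x).mul (hdc x)
    convert! h using 1
    simp only [ha, hc, Pi.smul_apply, Pi.mul_apply, Pi.sub_apply, smul_eq_mul, id]
    have := (hpos x).ne'
    field_simp
    ring
  have key : ∀ p ∈ Algebra.adjoin ℝ S, (∃ C, ∀ x, |p x| ≤ C) ∧ ∃ p' ∈ Algebra.adjoin ℝ S, ∀ x, HasDerivAt p (p' x) x := by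
    intro p hp
    refine bounded_and_deriv_of_mem_adjoin ?_ ?_ hp
    · rintro p (rfl | rfl)
      · refine ⟨1, fun x => ?_⟩
        rw [ha, abs_mul, abs_inv, abs_of_pos (hpos x), ← div_eq_mul_inv, div_le_one (hpos x)]
        nlinarith [sq_abs x, sq_nonneg (|x| - 1)]
      · refine ⟨1, fun x => ?_⟩
        rw [hc, abs_inv, abs_of_pos (hpos x)]
        exact inv_le_one_of_one_le₀ (by nlinarith [sq_nonneg x])
    · rintro p (rfl | rfl)
      · exact ⟨_, Subalgebra.sub_mem _ (Subalgebra.smul_mem _ (Subalgebra.mul_mem _ hcS hcS) _) hcS, hda⟩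
      · exact ⟨_, Subalgebra.smul_mem _ (Subalgebra.mul_mem _ haS hcS) _, hdc⟩
  obtain ⟨K, hK0, hK⟩ := exists_derivative_tower (S := {u | ∃ p ∈ Algebra.adjoin ℝ S, u = p * c}) (u := c) (by
    rintro _ ⟨p, hp, rfl⟩
    obtain ⟨p', hp', hd⟩ := (key p hp).2
    refine ⟨_, ⟨p' + (-2 : ℝ) • (p * a), Subalgebra.add_mem _ hp'
      (Subalgebra.smul_mem _ (Subalgebra.mul_mem _ hp haS) _), rfl⟩, fun x => ?_⟩
    convert! (hd x).mul (hdc x) using 1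
    simp only [Pi.smul_apply, Pi.mul_apply, Pi.add_apply, smul_eq_mul]
    ring) ⟨1, Subalgebra.one_mem _, (one_mul c).symm⟩
  refine ⟨K, hK0, fun k => (hK k).2, fun k => ?_⟩
  obtain ⟨p, hp, e⟩ := (hK k).1
  obtain ⟨C, hC⟩ := (key p hp).1
  refine ⟨C, (abs_nonneg _).trans (hC 0), fun x => ?_⟩
  rw [e, Pi.mul_apply, abs_mul, hc, abs_inv, abs_of_pos (hpos x)]
  have := hpos x
  gcongr
  exact hC x

/-- Average |f(x)| ≤ |f(t)| + ∫ₜˣ |f'| over t in the unit interval (x − 1, x]. Pointwise values are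
thereby controlled by local masses. -/
theorem norm_le_setIntegral_add {f f' : ℝ → ℂ} (hf : Integrable f) (hf' : Integrable f')
    (hd : ∀ x, HasDerivAt f (f' x) x) (x : ℝ) :
    ‖f x‖ ≤ (∫ t in Set.Ioc (x - 1) x, ‖f t‖) + ∫ t in Set.Ioc (x - 1) x, ‖f' t‖ := by
  set I := ∫ t in Set.Ioc (x - 1) x, ‖f' t‖ with hI
  have h1 : ∀ t ∈ Set.Ioc (x - 1) x, ‖f x‖ ≤ ‖f t‖ + I := by
    intro t ht
    have h := intervalIntegral.integral_eq_sub_of_hasDerivAt (a := t) (b := x) (fun y _ => hd y)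
      hf'.intervalIntegrable
    have h2 : ‖∫ y in t..x, f' y‖ ≤ I := by
      rw [intervalIntegral.integral_of_le ht.2]
      refine (norm_integral_le_integral_norm _).trans ?_
      refine setIntegral_mono_set hf'.norm.integrableOn (Filter.Eventually.of_forall fun _ => norm_nonneg _) ?_
      exact (Set.Ioc_subset_Ioc_left ht.1.le).eventuallyLE
    have h3 : f x = f t + ∫ y in t..x, f' y := by rw [h]; ring
    calc ‖f x‖ ≤ ‖f t‖ + ‖∫ y in t..x, f' y‖ := by rw [h3]; exact norm_add_le _ _
      _ ≤ _ := by gcongr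
  have h2 : ∫ t in Set.Ioc (x - 1) x, ‖f x‖ ≤ ∫ t in Set.Ioc (x - 1) x, (‖f t‖ + I) :=
    setIntegral_mono_on (by simp) (hf.norm.integrableOn.add (by simp)) measurableSet_Ioc h1
  rw [integral_add hf.norm.integrableOn (by simp)] at h2
  simpa using h2

/-- A finite measure dominating multiples of all the measures `‖f k‖ dx`. -/
theorem exists_dominating_measure {f : ℕ → ℝ → ℂ} (hf : ∀ k, Integrable (f k)) :
    ∃ μ : Measure ℝ, IsFiniteMeasure μ ∧ Measure.dirac 0 ≤ μ ∧
      ∀ k, ∃ C : ℝ, 0 ≤ C ∧ ∀ s : Set ℝ, MeasurableSet s → ∫ t in s, ‖f k t‖ ≤ C * μ.real s := by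
  obtain ⟨ε, hε, hsum⟩ := ENNReal.exists_pos_sum_of_countable one_ne_zero ℕ
  set ν : ℕ → Measure ℝ := fun k => volume.withDensity fun t => ‖f k t‖ₑ with hν
  have hνfin : ∀ k, ν k Set.univ < ⊤ := fun k => by
    rw [hν, withDensity_apply _ MeasurableSet.univ, Measure.restrict_univ]
    exact (hf k).2
  set M : ℕ → NNReal := fun k => (ν k Set.univ).toNNReal with hM
  have hMν : ∀ k, (M k : ℝ≥0∞) = ν k Set.univ := fun k => ENNReal.coe_toNNReal (hνfin k).ne
  -- This weight gives the k-th measure mass at most ε k, a summable sequence; the added 1 avoids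
  -- dividing by zero.
  set c : ℕ → NNReal := fun k => ε k / (1 + M k) with hc
  have hcpos : ∀ k, 0 < c k := fun k => div_pos (hε k) (by positivity)
  have hcM : ∀ k, c k * M k ≤ ε k := fun k => by
    rw [hc, div_mul_eq_mul_div, div_le_iff₀ (by positivity)]
    gcongr
    exact le_add_of_nonneg_left zero_le_one
  -- The Dirac mass keeps the measure nonzero, hence its convolution with a positive kernel strictly
  -- positive, even when every f k vanishes.
  set μ : Measure ℝ := Measure.dirac 0 + Measure.sum fun k => c k • ν k with hμ
  have hfin : IsFiniteMeasure μ := by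
    refine ⟨?_⟩
    rw [hμ, Measure.add_apply, Measure.sum_apply _ MeasurableSet.univ]
    refine ENNReal.add_lt_top.2 ⟨by simp, lt_of_le_of_lt (ENNReal.tsum_le_tsum fun k => ?_)
      (hsum.trans ENNReal.one_lt_top)⟩
    rw [Measure.smul_apply, ← hMν, ENNReal.smul_def, smul_eq_mul]
    exact_mod_cast hcM k
  refine ⟨μ, hfin, Measure.le_add_right le_rfl, fun k => ⟨(c k)⁻¹, by positivity, fun s hs => ?_⟩⟩
  have h1 : c k • ν k ≤ μ := (Measure.le_sum (fun k => c k • ν k) k).trans (Measure.le_add_left le_rfl)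
  have h2 := h1 s
  have h3 : ν k s = ENNReal.ofReal (∫ t in s, ‖f k t‖) := by
    rw [hν, withDensity_apply _ hs, ofReal_integral_norm_eq_lintegral_enorm (hf k).integrableOn]
  rw [Measure.smul_apply, h3, ENNReal.smul_def, smul_eq_mul] at h2
  have h4 := ENNReal.toReal_mono (measure_ne_top μ s) h2
  have hnn : 0 ≤ ∫ t in s, ‖f k t‖ := integral_nonneg fun _ => norm_nonneg _
  rw [ENNReal.toReal_mul, ENNReal.toReal_ofReal hnn, ENNReal.coe_toReal] at h4
  have hck : (0 : ℝ) < c k := by exact_mod_cast hcpos k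
  rw [inv_mul_eq_div, le_div_iff₀ hck, mul_comm]
  exact h4

/-- Take G as the convolution of the finite dominating measure μ with 1/(1+x²). Derivatives fall on
the kernel, whose derivatives it dominates, so |G⁽ᵏ⁾| ≤ C G. On (x − 1, x] the kernel centred at x
is at least 1/2, so μ of that interval is at most 2G(x), and this controls |f⁽ᵏ⁾(x)|. -/
theorem exists_smooth_majorant {f : ℕ → ℝ → ℂ} (hf : ∀ k, Integrable (f k))
    (hd : ∀ k x, HasDerivAt (f k) (f (k + 1) x) x) :
    ∃ G : ℕ → ℝ → ℝ, (∀ x, 0 < G 0 x) ∧ Integrable (G 0) ∧ (∀ k x, HasDerivAt (G k) (G (k + 1) x) x) ∧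
      (∀ k, ∃ C, ∀ x, |G k x| ≤ C * G 0 x) ∧ ∀ k, ∃ C, ∀ x, ‖f k x‖ ≤ C * G 0 x := by
  obtain ⟨μ, hfin, hdirac, hμ⟩ := exists_dominating_measure hf
  obtain ⟨K, hK0, hKd, hKb⟩ := exists_kernel_tower
  have hpos : ∀ x : ℝ, 0 < (1 + x ^ 2)⁻¹ := fun x => by positivity
  have hle1 : ∀ x : ℝ, (1 + x ^ 2)⁻¹ ≤ 1 := fun x => inv_le_one_of_one_le₀ (by nlinarith [sq_nonneg x])
  have hKc : ∀ k, Continuous (K k) := fun k => continuous_iff_continuousAt.2 fun x => (hKd k x).continuousAt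
  have hKm : ∀ k x, AEStronglyMeasurable (fun y => K k (x - y)) μ := fun k x =>
    ((hKc k).comp (continuous_const.sub continuous_id)).aestronglyMeasurable
  have hKb' : ∀ k, ∃ C, ∀ x, ‖K k x‖ ≤ C := fun k => by
    obtain ⟨C, hC0, hC⟩ := hKb k
    exact ⟨C, fun x => (hC x).trans (mul_le_of_le_one_right hC0 (hle1 x))⟩
  have hKi : ∀ k x, Integrable (fun y => K k (x - y)) μ := fun k x => by
    obtain ⟨C, hC⟩ := hKb' k
    exact Integrable.of_bound (hKm k x) C (Filter.Eventually.of_forall fun y => hC _)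
  set G : ℕ → ℝ → ℝ := fun k x => ∫ y, K k (x - y) ∂μ with hG
  have hG0 : ∀ x, G 0 x = ∫ y, (1 + (x - y) ^ 2)⁻¹ ∂μ := fun x => by rw [hG]; simp only [hK0]
  have hi0 : ∀ x, Integrable (fun y => (1 + (x - y) ^ 2)⁻¹) μ := fun x => by simpa only [hK0] using hKi 0 x
  refine ⟨G, fun x => ?_, ?_, fun k x => ?_, fun k => ?_, fun k => ?_⟩
  · have h1 := integral_mono_measure hdirac (Filter.Eventually.of_forall fun y => (hpos (x - y)).le) (hi0 x)
    rw [integral_dirac] at h1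
    rw [hG0]
    exact (hpos _).trans_le h1
  · have hi : Integrable (fun z : ℝ × ℝ => (1 + (z.1 - z.2) ^ 2)⁻¹) (volume.prod μ) := by
      have hm : Continuous fun z : ℝ × ℝ => (1 + (z.1 - z.2) ^ 2)⁻¹ :=
        Continuous.inv₀ (by fun_prop) fun z => by positivity
      refine (integrable_prod_iff' hm.aestronglyMeasurable).2
        ⟨Filter.Eventually.of_forall fun y => integrable_inv_one_add_sq.comp_sub_right y, ?_⟩
      have e : ∀ y : ℝ, (∫ x : ℝ, ‖(1 + (x - y) ^ 2)⁻¹‖) = ∫ x : ℝ, ‖(1 + x ^ 2)⁻¹‖ := fun y =>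
        integral_sub_right_eq_self (fun x : ℝ => ‖(1 + x ^ 2)⁻¹‖) y
      simp only [e]
      exact integrable_const _
    have h2 := hi.integral_prod_left
    refine h2.congr (Filter.Eventually.of_forall fun x => ?_)
    exact (hG0 x).symm
  · obtain ⟨C, hC⟩ := hKb' (k + 1)
    refine (hasDerivAt_integral_of_dominated_loc_of_deriv_le (μ := μ) (s := Set.univ) (bound := fun _ => C)
      (F := fun x y => K k (x - y)) (F' := fun x y => K (k + 1) (x - y)) Filter.univ_mem
      (Filter.Eventually.of_forall (hKm k)) (hKi k x) (hKm (k + 1) x)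
      (Filter.Eventually.of_forall fun y x _ => hC _) (integrable_const _)
      (Filter.Eventually.of_forall fun y x _ => ?_)).2
    exact (hKd k (x - y)).comp_sub_const x y
  · obtain ⟨C, hC0, hC⟩ := hKb k
    refine ⟨C, fun x => ?_⟩
    rw [hG0, ← integral_const_mul]
    refine (abs_integral_le_integral_abs).trans (integral_mono (hKi k x).abs ((hi0 x).const_mul C) fun y => hC _)
  · obtain ⟨C, hC0, hC⟩ := hμ k
    obtain ⟨C', hC0', hC'⟩ := hμ (k + 1)
    refine ⟨2 * (C + C'), fun x => ?_⟩
    have h1 := norm_le_setIntegral_add (hf k) (hf (k + 1)) (hd k) x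
    have h2 := hC (Set.Ioc (x - 1) x) measurableSet_Ioc
    have h3 := hC' (Set.Ioc (x - 1) x) measurableSet_Ioc
    have h4 : μ.real (Set.Ioc (x - 1) x) * (1 / 2) ≤ G 0 x := by
      rw [hG0]
      have h5 : ∫ y in Set.Ioc (x - 1) x, (1 / 2 : ℝ) ∂μ ≤ ∫ y in Set.Ioc (x - 1) x, (1 + (x - y) ^ 2)⁻¹ ∂μ := by
        refine setIntegral_mono_on (by simp) (hi0 x).integrableOn measurableSet_Ioc fun y hy => ?_
        rw [one_div]
        have : (x - y) ^ 2 ≤ 1 := by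
          have h6 := hy.1
          have h7 := hy.2
          nlinarith
        exact inv_anti₀ (by positivity) (by linarith)
      have h6 := setIntegral_le_integral (s := Set.Ioc (x - 1) x) (hi0 x)
        (Filter.Eventually.of_forall fun y => (hpos (x - y)).le)
      rw [setIntegral_const, smul_eq_mul] at h5
      exact h5.trans h6
    have h5 : 0 ≤ C + C' := add_nonneg hC0 hC0'
    nlinarith

theorem isSmoothL2_of_closed {S : Set (ℝ → ℂ)} (h2 : ∀ u ∈ S, MemLp u 2 volume)
    (hd : ∀ u ∈ S, ∃ u' ∈ S, ∀ x, HasDerivAt u (u' x) x) {u : ℝ → ℂ} (hu : u ∈ S) : IsSmoothL2 u := by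
  obtain ⟨F, hF0, hF⟩ := exists_derivative_tower hd hu
  exact ⟨F, hF0, fun k => ⟨h2 _ (hF k).1, (hF k).2⟩⟩

theorem IsC1inf.hasDerivAt {f : ℝ → ℂ} (hf : IsC1inf f) (k : ℕ) (x : ℝ) :
    HasDerivAt (iteratedDeriv k f) (iteratedDeriv (k + 1) f x) x := by
  rw [iteratedDeriv_succ]
  exact ((hf.1.differentiable_iteratedDeriv k (by exact_mod_cast WithTop.coe_lt_top _)) x).hasDerivAt

/-- Put h = √G and g = f/√G. The ratios G⁽ᵏ⁾/G generate a bounded algebra stable under d/dx.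
Derivatives of h are elements of it times √G, and those of g are combinations of such elements times
f⁽ᵏ⁾/√G. All are O(√G), hence square integrable. -/
theorem IsC1inf.exists_mul {f : ℝ → ℂ} (hf : IsC1inf f) :
    ∃ g h : ℝ → ℂ, IsSmoothL2 g ∧ IsSmoothL2 h ∧ f = fun x => g x * h x := by
  set φ : ℕ → ℝ → ℂ := fun k => iteratedDeriv k f with hφ
  obtain ⟨G, hG0, hGi, hGd, hGb, hGf⟩ := exists_smooth_majorant (f := φ) hf.2 hf.hasDerivAt
  set v : ℕ → ℝ → ℝ := fun k x => G k x / G 0 x with hv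
  set 𝒜 := Algebra.adjoin ℝ (Set.range v) with h𝒜
  have hvm : ∀ k, v k ∈ 𝒜 := fun k => Algebra.subset_adjoin ⟨k, rfl⟩
  have key : ∀ p ∈ 𝒜, (∃ C, ∀ x, |p x| ≤ C) ∧ ∃ p' ∈ 𝒜, ∀ x, HasDerivAt p (p' x) x := by
    intro p hp
    refine bounded_and_deriv_of_mem_adjoin ?_ ?_ hp
    · rintro _ ⟨k, rfl⟩
      obtain ⟨C, hC⟩ := hGb k
      refine ⟨C, fun x => ?_⟩
      rw [hv, abs_div, abs_of_pos (hG0 x), div_le_iff₀ (hG0 x)]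
      exact hC x
    · rintro _ ⟨k, rfl⟩
      refine ⟨v (k + 1) - v k * v 1, Subalgebra.sub_mem _ (hvm _) (Subalgebra.mul_mem _ (hvm _) (hvm _)), fun x => ?_⟩
      convert! (hGd k x).div (hGd 0 x) (hG0 x).ne' using 1
      simp only [hv, Pi.sub_apply, Pi.mul_apply]
      have := (hG0 x).ne'
      field_simp
  set w : ℝ → ℝ := fun x => Real.sqrt (G 0 x) with hw
  have hwpos : ∀ x, 0 < w x := fun x => Real.sqrt_pos.2 (hG0 x)
  have hwsq : ∀ x, w x ^ 2 = G 0 x := fun x => Real.sq_sqrt (hG0 x).le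
  have hGv : ∀ x, G 1 x = v 1 x * w x ^ 2 := fun x => by
    rw [hwsq, hv]; field_simp [(hG0 x).ne']
  have hwd : ∀ x, HasDerivAt w (1 / 2 * v 1 x * w x) x := by
    intro x
    convert! (hGd 0 x).sqrt (hG0 x).ne' using 1
    have := (hwpos x).ne'
    rw [zero_add, hGv]
    change _ = _ / (2 * w x)
    field_simp
  have hwc : Continuous w := continuous_iff_continuousAt.2 fun x => (hwd x).continuousAt
  have hw2 : MemLp w 2 volume := by
    refine (memLp_two_iff_integrable_sq_norm hwc.aestronglyMeasurable).2
      (hGi.congr (Filter.Eventually.of_forall fun x => ?_))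
    simp only
    rw [Real.norm_of_nonneg (hwpos x).le, hwsq]
  have hpc : ∀ p ∈ 𝒜, Continuous p := fun p hp => by
    obtain ⟨p', _, h⟩ := (key p hp).2
    exact continuous_iff_continuousAt.2 fun x => (h x).continuousAt
  have hφc : ∀ k, Continuous (φ k) := fun k => continuous_iff_continuousAt.2 fun x => (hf.hasDerivAt k x).continuousAt
  have hh : IsSmoothL2 fun x => (w x : ℂ) := by
    refine isSmoothL2_of_closed (S := {u | ∃ p ∈ 𝒜, u = fun x => ((p x * w x : ℝ) : ℂ)}) ?_ ?_
      ⟨1, Subalgebra.one_mem _, by simp⟩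
    · rintro _ ⟨p, hp, rfl⟩
      obtain ⟨C, hC⟩ := (key p hp).1
      refine hw2.of_le_mul (c := C)
        (Complex.continuous_ofReal.comp ((hpc p hp).mul hwc)).aestronglyMeasurable
        (Filter.Eventually.of_forall fun x => ?_)
      rw [Complex.norm_real, norm_mul]
      gcongr
      exact hC x
    · rintro _ ⟨p, hp, rfl⟩
      obtain ⟨p', hp', h⟩ := (key p hp).2
      refine ⟨_, ⟨p' + (1 / 2 : ℝ) • (p * v 1), Subalgebra.add_mem _ hp'
        (Subalgebra.smul_mem _ (Subalgebra.mul_mem _ hp (hvm 1)) _), rfl⟩, fun x => ?_⟩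
      convert! ((h x).mul (hwd x)).ofReal_comp using 2
      simp only [Pi.add_apply, Pi.smul_apply, Pi.mul_apply, smul_eq_mul]
      ring
  set r : ℝ → ℝ := fun x => (w x)⁻¹ with hr
  have hrd : ∀ x, HasDerivAt r (-(1 / 2) * v 1 x * r x) x := by
    intro x
    convert! (hwd x).inv (hwpos x).ne' using 1
    have := (hwpos x).ne'
    simp only [hr]
    field_simp
  have hrc : Continuous r := continuous_iff_continuousAt.2 fun x => (hrd x).continuousAt
  -- A linear span is needed here: differentiating p r φ_k gives one term with φ_k and another with
  -- φ_{k+1}.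
  set W : Submodule ℝ (ℝ → ℂ) := Submodule.span ℝ {u | ∃ p ∈ 𝒜, ∃ k, u = fun x => (p x * r x) • φ k x} with hW
  have hWm : ∀ p ∈ 𝒜, ∀ k, (fun x => (p x * r x) • φ k x) ∈ W := fun p hp k =>
    Submodule.subset_span ⟨p, hp, k, rfl⟩
  have hg : IsSmoothL2 fun x => ((1 : ℝ) * r x) • φ 0 x := by
    refine isSmoothL2_of_closed (S := W) ?_ ?_ (hWm 1 (Subalgebra.one_mem _) 0)
    · intro u hu
      induction hu using Submodule.span_induction with
      | zero => exact MemLp.zero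
      | add u v _ _ hu hv => exact hu.add hv
      | smul c u _ hu => exact hu.const_smul c
      | mem u hu =>
        obtain ⟨p, hp, k, rfl⟩ := hu
        obtain ⟨C, hC⟩ := (key p hp).1
        obtain ⟨C', hC'⟩ := hGf k
        refine hw2.of_le_mul (c := C * C') (((hpc p hp).mul hrc).smul (hφc k)).aestronglyMeasurable
          (Filter.Eventually.of_forall fun x => ?_)
        rw [norm_smul, norm_mul]
        have h1 : 0 ≤ C := (abs_nonneg _).trans (hC x)
        have h2 : ‖r x‖ * ‖φ k x‖ ≤ C' * w x := by
          rw [hr, norm_inv, Real.norm_of_nonneg (hwpos x).le, inv_mul_le_iff₀ (hwpos x)]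
          refine (hC' x).trans (le_of_eq ?_)
          rw [← hwsq]
          ring
        calc ‖p x‖ * ‖r x‖ * ‖φ k x‖ = ‖p x‖ * (‖r x‖ * ‖φ k x‖) := by ring
          _ ≤ C * (C' * w x) := mul_le_mul (hC x) h2 (by positivity) h1
          _ = _ := by rw [Real.norm_of_nonneg (hwpos x).le]; ring
    · intro u hu
      induction hu using Submodule.span_induction with
      | zero => exact ⟨0, W.zero_mem, fun x => hasDerivAt_const x 0⟩
      | add u v _ _ hu hv =>
        obtain ⟨u', hu', h1⟩ := hu
        obtain ⟨v', hv', h2⟩ := hv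
        exact ⟨u' + v', W.add_mem hu' hv', fun x => (h1 x).add (h2 x)⟩
      | smul c u _ hu =>
        obtain ⟨u', hu', h1⟩ := hu
        exact ⟨c • u', W.smul_mem c hu', fun x => (h1 x).const_smul c⟩
      | mem u hu =>
        obtain ⟨p, hp, k, rfl⟩ := hu
        obtain ⟨p', hp', h⟩ := (key p hp).2
        refine ⟨_, W.add_mem (hWm (p' - (1 / 2 : ℝ) • (p * v 1)) (Subalgebra.sub_mem _ hp'
          (Subalgebra.smul_mem _ (Subalgebra.mul_mem _ hp (hvm 1)) _)) k) (hWm p hp (k + 1)), fun x => ?_⟩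
        convert! ((h x).mul (hrd x)).smul (hf.hasDerivAt k x) using 1
        simp only [Pi.add_apply, Pi.sub_apply, Pi.smul_apply, Pi.mul_apply, smul_eq_mul, Complex.real_smul]
        push_cast
        ring
  refine ⟨_, _, hg, hh, ?_⟩
  ext x
  have h0 : φ 0 x = f x := by simp [hφ]
  have h1 : (w x : ℂ) ≠ 0 := by exact_mod_cast (hwpos x).ne'
  rw [h0, one_mul, hr, Complex.real_smul]
  push_cast
  field_simp

/-! ### Commutators with quadratic expressions in two operators with scalar commutator -/

section Ladder

variable {R : Type*} [Ring R] [Algebra ℂ R] {A B : R} {F : Submodule ℂ R}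

/-- The span of `1`, `A` and `B`. -/
def ladder (A B : R) : Submodule ℂ R := Submodule.span ℂ {1, A, B}

theorem one_mem_ladder : (1 : R) ∈ ladder A B := Submodule.subset_span (by simp)

theorem mem_ladder_of_mem {a : R} (ha : a ∈ ({A, B} : Set R)) : a ∈ ladder A B :=
  Submodule.subset_span (Or.inr ha)

theorem ladder_pow_le_succ (n : ℕ) : ladder A B ^ n ≤ ladder A B ^ (n + 1) := by
  intro w hw
  rw [pow_succ, ← mul_one w]
  exact Submodule.mul_mem_mul hw one_mem_ladder

theorem exists_smul_one_of_mem_ladder (hAB : A * B - B * A = (2 : ℂ) • (1 : R)) {a c : R}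
    (ha : a ∈ ({A, B} : Set R)) (hc : c ∈ ladder A B) : ∃ t : ℂ, a * c - c * a = t • (1 : R) := by
  induction hc using Submodule.span_induction with
  | zero => exact ⟨0, by simp⟩
  | add c c' _ _ h h' =>
    obtain ⟨t, ht⟩ := h
    obtain ⟨t', ht'⟩ := h'
    exact ⟨t + t', by rw [add_smul, ← ht, ← ht']; noncomm_ring⟩
  | smul s c _ h =>
    obtain ⟨t, ht⟩ := h
    exact ⟨s * t, by rw [mul_smul, ← ht, mul_smul_comm, smul_mul_assoc, smul_sub]⟩
  | mem c hc =>
    rcases hc with rfl | rfl | rfl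
    · exact ⟨0, by simp⟩
    · rcases ha with rfl | rfl
      · exact ⟨0, by simp⟩
      · exact ⟨-2, by rw [neg_smul, ← hAB]; noncomm_ring⟩
    · rcases ha with rfl | rfl
      · exact ⟨2, hAB⟩
      · exact ⟨0, by simp⟩

theorem quadratic_comm_ladder (hAB : A * B - B * A = (2 : ℂ) • (1 : R)) {a a' c : R}
    (ha : a ∈ ({A, B} : Set R)) (ha' : a' ∈ ({A, B} : Set R)) (hc : c ∈ ladder A B) :
    a * a' * c - c * (a * a') ∈ ladder A B := by
  obtain ⟨t, ht⟩ := exists_smul_one_of_mem_ladder hAB ha hc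
  obtain ⟨t', ht'⟩ := exists_smul_one_of_mem_ladder hAB ha' hc
  have e : a * a' * c - c * (a * a') = t' • a + t • a' := by
    calc a * a' * c - c * (a * a') = a * (a' * c - c * a') + (a * c - c * a) * a' := by noncomm_ring
      _ = _ := by rw [ht, ht', mul_smul_comm, smul_mul_assoc, mul_one, one_mul]
  rw [e]
  exact Submodule.add_mem _ (Submodule.smul_mem _ _ (mem_ladder_of_mem ha))
    (Submodule.smul_mem _ _ (mem_ladder_of_mem ha'))

theorem quadratic_comm_ladder_pow (hAB : A * B - B * A = (2 : ℂ) • (1 : R)) {a a' : R}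
    (ha : a ∈ ({A, B} : Set R)) (ha' : a' ∈ ({A, B} : Set R)) (n : ℕ) :
    ∀ w ∈ ladder A B ^ n, a * a' * w - w * (a * a') ∈ ladder A B ^ n := by
  induction n with
  | zero =>
    intro w hw
    rw [pow_zero, Submodule.mem_one] at hw
    obtain ⟨t, rfl⟩ := hw
    rw [Algebra.commutes, sub_self]
    exact Submodule.zero_mem _
  | succ n ih =>
    intro w hw
    rw [pow_succ] at hw ⊢
    induction hw using Submodule.mul_induction_on' with
    | mem_mul_mem w hw c hc =>
      have e : a * a' * (w * c) - w * c * (a * a') = (a * a' * w - w * (a * a')) * c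
          + w * (a * a' * c - c * (a * a')) := by noncomm_ring
      rw [e]
      exact Submodule.add_mem _ (Submodule.mul_mem_mul (ih w hw) hc)
        (Submodule.mul_mem_mul hw (quadratic_comm_ladder hAB ha ha' hc))
    | add w _ w' _ h h' =>
      have e : a * a' * (w + w') - (w + w') * (a * a') = (a * a' * w - w * (a * a'))
          + (a * a' * w' - w' * (a * a')) := by noncomm_ring
      rw [e]
      exact Submodule.add_mem _ h h'

/-- `F` will be the multiplication operators, stable under commutators with A and B. Each term of
[aa', mw] loses at least one of the letters a, a' to a commutator, so the ladder degree grows by one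
instead of two. -/
theorem quadratic_comm_mem (hAB : A * B - B * A = (2 : ℂ) • (1 : R))
    (hF : ∀ a ∈ ({A, B} : Set R), ∀ m ∈ F, a * m - m * a ∈ F) {a a' : R}
    (ha : a ∈ ({A, B} : Set R)) (ha' : a' ∈ ({A, B} : Set R)) (n : ℕ) {w : R} (hw : w ∈ F * ladder A B ^ n) :
    a * a' * w - w * (a * a') ∈ F * ladder A B ^ (n + 1) := by
  induction hw using Submodule.mul_induction_on' with
  | mem_mul_mem m hm w hw =>
    -- Each surviving letter is moved to the right of the element of `F`; the double commutator
    -- leaves no extra letter and is padded by 1.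
    have e : a * a' * (m * w) - m * w * (a * a') = (a' * m - m * a') * (a * w)
        + (a * (a' * m - m * a') - (a' * m - m * a') * a) * (1 * w)
        + (a * m - m * a) * (a' * w) + m * (a * a' * w - w * (a * a')) := by noncomm_ring
    have h1 := hF a' ha' m hm
    have hl : ∀ c ∈ ladder A B, c * w ∈ ladder A B ^ (n + 1) := fun c hc => by
      rw [pow_succ']; exact Submodule.mul_mem_mul hc hw
    rw [e]
    refine Submodule.add_mem _ (Submodule.add_mem _ (Submodule.add_mem _ ?_ ?_) ?_) ?_
    · exact Submodule.mul_mem_mul h1 (hl _ (mem_ladder_of_mem ha))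
    · exact Submodule.mul_mem_mul (hF a ha _ h1) (hl _ one_mem_ladder)
    · exact Submodule.mul_mem_mul (hF a ha m hm) (hl _ (mem_ladder_of_mem ha'))
    · exact Submodule.mul_mem_mul hm (ladder_pow_le_succ n (quadratic_comm_ladder_pow hAB ha ha' n w hw))
  | add w _ w' _ h h' =>
    have e : a * a' * (w + w') - (w + w') * (a * a') = (a * a' * w - w * (a * a'))
        + (a * a' * w' - w' * (a * a')) := by noncomm_ring
    rw [e]
    exact Submodule.add_mem _ h h'

end Ladder

/-! ### Unbounded operators as endomorphisms of an invariant subspace. -/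

section Represents

variable {H : Type*} [NormedAddCommGroup H] [InnerProductSpace ℂ H] [CompleteSpace H]
variable {V : Submodule ℂ H}

/-- The unbounded operator `P` is defined on `V` and coincides there with the endomorphism `L`. -/
def Represents (P : H →ₗ.[ℂ] H) (L : Module.End ℂ V) : Prop :=
  ∀ x : V, ∃ h : (x : H) ∈ P.domain, P ⟨x, h⟩ = L x

/-- The endomorphism of an invariant subspace given by an unbounded operator. -/
def restrictEnd (P : H →ₗ.[ℂ] H) (h : ∀ x ∈ V, ∃ h : x ∈ P.domain, P ⟨x, h⟩ ∈ V) : Module.End ℂ V where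
  toFun x := ⟨P ⟨x, (h x x.2).1⟩, (h x x.2).2⟩
  map_add' x y := Subtype.ext (P.map_add ⟨x, (h x x.2).1⟩ ⟨y, (h y y.2).1⟩)
  map_smul' c x := Subtype.ext (P.map_smul c ⟨x, (h x x.2).1⟩)

theorem represents_restrictEnd {P : H →ₗ.[ℂ] H} (h : ∀ x ∈ V, ∃ h : x ∈ P.domain, P ⟨x, h⟩ ∈ V) :
    Represents P (restrictEnd P h) := fun x => ⟨(h x x.2).1, rfl⟩

variable {P Q : H →ₗ.[ℂ] H} {L M : Module.End ℂ V}

theorem Represents.pcomp (hP : Represents P L) (hQ : Represents Q M) : Represents (pcomp P Q) (L * M) := by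
  intro x
  obtain ⟨h1, h2⟩ := hQ x
  obtain ⟨h3, h4⟩ := hP (M x)
  have h5 : Q ⟨x, h1⟩ ∈ P.domain := by rw [h2]; exact h3
  refine ⟨⟨h1, h5⟩, ?_⟩
  change P ⟨Q ⟨x, h1⟩, h5⟩ = _
  rw [Module.End.mul_apply, ← h4]
  congr 1
  exact Subtype.ext h2

theorem Represents.add (hP : Represents P L) (hQ : Represents Q M) : Represents (P + Q) (L + M) := by
  intro x
  obtain ⟨h1, h2⟩ := hP x
  obtain ⟨h3, h4⟩ := hQ x
  refine ⟨⟨h1, h3⟩, ?_⟩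
  change P ⟨x, h1⟩ + Q ⟨x, h3⟩ = _
  rw [h2, h4]
  rfl

theorem Represents.sub (hP : Represents P L) (hQ : Represents Q M) : Represents (P - Q) (L - M) := by
  intro x
  obtain ⟨h1, h2⟩ := hP x
  obtain ⟨h3, h4⟩ := hQ x
  refine ⟨⟨h1, h3⟩, ?_⟩
  change P ⟨x, h1⟩ - Q ⟨x, h3⟩ = _
  rw [h2, h4]
  rfl

theorem Represents.smul (c : ℂ) (hP : Represents P L) : Represents (c • P) (c • L) := by
  intro x
  obtain ⟨h1, h2⟩ := hP x
  refine ⟨h1, ?_⟩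
  change c • P ⟨x, h1⟩ = _
  rw [h2]
  rfl

theorem Represents.comm (hP : Represents P L) (hQ : Represents Q M) : Represents (comm P Q) (L * M - M * L) :=
  (hP.pcomp hQ).sub (hQ.pcomp hP)

theorem Represents.congr (hP : Represents P L) (h : L = M) : Represents P M := h ▸ hP

end Represents

/-! ### Ladder operators on smooth vectors. -/

section Oscillator

variable {H : Type*} [NormedAddCommGroup H] [InnerProductSpace ℂ H] [CompleteSpace H]
variable {b : HilbertBasis ℕ ℂ H} {N D : H →ₗ.[ℂ] H}

/-- Summing the entrywise relation against the coefficients of x works for every x in the maximal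
domain. It yields invariance of that domain under X together with the commutator formula, with no
regularity of x beyond membership. -/
theorem DerivRel.lower_apply (hD : IsLowering b D) {X X' : H →L[ℂ] H} (hX : DerivRel b X X') {x : H}
    (hx : x ∈ D.domain) : ∃ h : X x ∈ D.domain, D ⟨X x, h⟩ = X' x + X (D ⟨x, hx⟩) := by
  refine mem_graph_iff.1 ((hD _ _).2 fun m => ?_)
  have h1 := (hasSum_mat_apply b X x (m + 1)).mul_left (shiftWeight (m + 1) : ℂ)
  have h2 := hasSum_mat_apply b X' x m
  have h3 := hasSum_mat_apply b X (D ⟨x, hx⟩) m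
  simp only [hD.inner_apply] at h3
  have h4 : HasSum (fun n => (shiftWeight n : ℂ) * mat b X m (n - 1) * inner ℂ (b n) x)
      (inner ℂ (b m) (X (D ⟨x, hx⟩))) := by
    refine (hasSum_nat_add_iff' 1).1 ?_
    rw [Finset.sum_range_one, shiftWeight_zero]
    simp only [Complex.ofReal_zero, zero_mul, sub_zero]
    convert! h3 using 2 with n
    rw [Nat.add_sub_cancel]
    ring
  rw [inner_add_right]
  refine (h2.add h4).unique ?_
  convert! h1 using 2 with n
  rw [← hX.lower]
  ring

theorem DerivRel.raise_apply (hD : IsRaising b D) {X X' : H →L[ℂ] H} (hX : DerivRel b X X') {x : H}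
    (hx : x ∈ D.domain) : ∃ h : X x ∈ D.domain, D ⟨X x, h⟩ = -X' x + X (D ⟨x, hx⟩) := by
  refine mem_graph_iff.1 ((hD _ _).2 fun m => ?_)
  have h1 := (hasSum_mat_apply b X x (m - 1)).mul_left (shiftWeight m : ℂ)
  have h2 := hasSum_mat_apply b X' x m
  have h3 := hasSum_mat_apply b X (D ⟨x, hx⟩) m
  simp only [hD.inner_apply] at h3
  have h4 : HasSum (fun n => (shiftWeight (n + 1) : ℂ) * mat b X m (n + 1) * inner ℂ (b n) x)
      (inner ℂ (b m) (X (D ⟨x, hx⟩))) := by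
    have h5 := (hasSum_nat_add_iff' 1).2 h3
    rw [Finset.sum_range_one, shiftWeight_zero] at h5
    simp only [Complex.ofReal_zero, zero_mul, mul_zero, sub_zero] at h5
    convert! h5 using 2 with n
    rw [Nat.add_sub_cancel]
    ring
  rw [inner_add_right, inner_neg_right]
  refine (h2.neg.add h4).unique ?_
  convert! h1 using 2 with n
  have := hX.raise m n
  linear_combination (-inner ℂ (b n) x) * this

/-- The lowering operator as an endomorphism of the space of smooth vectors. -/
def lowerEnd (hD : IsLowering b D) : Module.End ℂ (smoothVectors (angleSq D)) :=
  restrictEnd D fun _ hx => hD.mem_smoothVectors hD.angleSq_isDiag hx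

/-- The raising operator as an endomorphism of the space of smooth vectors. -/
def raiseEnd (hD : IsLowering b D) : Module.End ℂ (smoothVectors (angleSq D)) :=
  restrictEnd D.adjoint fun _ hx => hD.adjoint.mem_smoothVectors hD.angleSq_isDiag hx

theorem represents_lowerEnd (hD : IsLowering b D) : Represents D (lowerEnd hD) := represents_restrictEnd _

theorem represents_raiseEnd (hD : IsLowering b D) : Represents D.adjoint (raiseEnd hD) := represents_restrictEnd _

theorem inner_lowerEnd (hD : IsLowering b D) (x : smoothVectors (angleSq D)) (n : ℕ) :
    inner ℂ (b n) (lowerEnd hD x : H) = (shiftWeight (n + 1) : ℂ) * inner ℂ (b (n + 1)) (x : H) :=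
  hD.inner_apply _ n

theorem inner_raiseEnd (hD : IsLowering b D) (x : smoothVectors (angleSq D)) (n : ℕ) :
    inner ℂ (b n) (raiseEnd hD x : H) = (shiftWeight n : ℂ) * inner ℂ (b (n - 1)) (x : H) :=
  hD.adjoint.inner_apply _ n

theorem lowerEnd_mul_raiseEnd (hD : IsLowering b D) :
    lowerEnd hD * raiseEnd hD - raiseEnd hD * lowerEnd hD = (2 : ℂ) • 1 := by
  refine LinearMap.ext fun x => Subtype.ext (basis_ext b fun n => ?_)
  change inner ℂ (b n) ((lowerEnd hD (raiseEnd hD x) : H) - (raiseEnd hD (lowerEnd hD x) : H))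
    = inner ℂ (b n) ((2 : ℂ) • (x : H))
  rw [inner_sub_right, inner_smul_right, inner_lowerEnd, inner_raiseEnd, inner_raiseEnd, inner_lowerEnd,
    Nat.add_sub_cancel, ← mul_assoc, shiftWeight_mul_self]
  rcases n with - | n
  · simp [shiftWeight_zero]
  · rw [Nat.add_sub_cancel, ← mul_assoc, shiftWeight_mul_self]
    push_cast
    ring

theorem represents_angleSq (hD : IsLowering b D) :
    Represents (angleSq D) (raiseEnd hD * lowerEnd hD + 1) := by
  have h : Represents (preAngleSq D) ((1 / 2 : ℂ) • (lowerEnd hD * raiseEnd hD + raiseEnd hD * lowerEnd hD)) :=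
    (((represents_lowerEnd hD).pcomp (represents_raiseEnd hD)).add
      ((represents_raiseEnd hD).pcomp (represents_lowerEnd hD))).smul _
  have e : preAngleSq D = angleSq D := (closure_eq_self hD.preAngleSq_isDiag.isSelfAdjoint.isClosed).symm
  rw [e] at h
  refine h.congr ?_
  rw [sub_eq_iff_eq_add.1 (lowerEnd_mul_raiseEnd hD)]
  module

theorem represents_remainder (hD : IsLowering b D) : Represents (remainder D)
    ((Complex.I / 2) • (lowerEnd hD * lowerEnd hD - raiseEnd hD * raiseEnd hD)) :=
  (((represents_lowerEnd hD).pcomp (represents_lowerEnd hD)).sub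
    ((represents_raiseEnd hD).pcomp (represents_raiseEnd hD))).smul _

/-! ### Products of ladder operators -/

variable (b) in
/-- The span of the bounded homogeneous operators. -/
def homogeneousSpan : Submodule ℂ (H →L[ℂ] H) :=
  Submodule.span ℂ {Z | ∃ d, IsHomogeneous b d Z}

/-- The row operation (α, σ) stands for left multiplication by 1, D or D*; the three cases share
this extension from homogeneous operators to their span. -/
theorem exists_rows_mem_homogeneousSpan {α : ℕ → ℂ} {σ : ℕ → ℕ}
    (h : ∀ d Z, IsHomogeneous b d Z → ∃ d' Z', IsHomogeneous b d' Z' ∧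
      ∀ l n, mat b Z' l n = α l * mat b Z (σ l) n / (lam n : ℂ)) {Z : H →L[ℂ] H} (hZ : Z ∈ homogeneousSpan b) :
    ∃ Z' ∈ homogeneousSpan b, ∀ l n, mat b Z' l n = α l * mat b Z (σ l) n / (lam n : ℂ) := by
  induction hZ using Submodule.span_induction with
  | zero => exact ⟨0, Submodule.zero_mem _, fun l n => by simp [mat_zero]⟩
  | mem Z hZ =>
    obtain ⟨d, hZ⟩ := hZ
    obtain ⟨d', Z', hZ', h2⟩ := h d Z hZ
    exact ⟨Z', Submodule.subset_span ⟨d', hZ'⟩, h2⟩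
  | add Z W _ _ hZ hW =>
    obtain ⟨Z', hZ', h2⟩ := hZ
    obtain ⟨W', hW', h3⟩ := hW
    exact ⟨Z' + W', Submodule.add_mem _ hZ' hW', fun l n => by rw [mat_add, mat_add, h2, h3]; ring⟩
  | smul c Z _ hZ =>
    obtain ⟨Z', hZ', h2⟩ := hZ
    exact ⟨c • Z', Submodule.smul_mem _ c hZ', fun l n => by rw [mat_smul, mat_smul, h2]; ring⟩

theorem mem_posPow_domain {x : H} (hx : x ∈ smoothVectors N) (n : ℕ) :
    x ∈ (posPow N n).domain := (mem_smoothVectors_iff x).1 hx n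

theorem inner_posPow (hN : IsDiag b N fun n => 2 * n + 1) {x : H} (n : ℕ) (h : x ∈ (posPow N n).domain) (k : ℕ) :
    inner ℂ (b k) (posPow N n ⟨x, h⟩) = (lam k : ℂ) ^ n * inner ℂ (b k) x := by
  rw [(posPow_isDiag hN n.cast_nonneg).inner_apply, Real.rpow_natCast]
  push_cast
  rfl

/-- The endomorphisms of the smooth vectors of the form `Z (1 + N)^(n/2)` with `Z` in the given
space of bounded operators. -/
def orderEnd (N : H →ₗ.[ℂ] H) (E : Submodule ℂ (H →L[ℂ] H)) (n : ℕ) :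
    Submodule ℂ (Module.End ℂ (smoothVectors N)) where
  carrier := {w | ∃ Z ∈ E, ∀ (x : smoothVectors N) (h : (x : H) ∈ (posPow N n).domain),
    (w x : H) = Z (posPow N n ⟨x, h⟩)}
  zero_mem' := ⟨0, E.zero_mem, fun x h => by simp⟩
  add_mem' := by
    rintro w w' ⟨Z, hZ, h⟩ ⟨Z', hZ', h'⟩
    refine ⟨Z + Z', E.add_mem hZ hZ', fun x hx => ?_⟩
    change (w x : H) + (w' x : H) = Z _ + Z' _
    rw [← h x hx, ← h' x hx]
  smul_mem' := by
    rintro c w ⟨Z, hZ, h⟩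
    refine ⟨c • Z, E.smul_mem c hZ, fun x hx => ?_⟩
    change c • (w x : H) = c • Z _
    rw [← h x hx]

/-- The regrouping is cZΛⁿ = (cZΛ⁻¹)Λⁿ⁺¹ for c = 1, D or D*, with the bracket bounded. -/
theorem rows_mul_mem_orderEnd (hN : IsDiag b N fun n => 2 * n + 1) {α : ℕ → ℂ} {σ : ℕ → ℕ}
    (h : ∀ d Z, IsHomogeneous b d Z → ∃ d' Z', IsHomogeneous b d' Z' ∧
      ∀ l n, mat b Z' l n = α l * mat b Z (σ l) n / (lam n : ℂ)) {c w : Module.End ℂ (smoothVectors N)}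
    (hc : ∀ x l, inner ℂ (b l) (c x : H) = α l * inner ℂ (b (σ l)) (x : H)) {n : ℕ}
    (hw : w ∈ orderEnd N (homogeneousSpan b) n) : c * w ∈ orderEnd N (homogeneousSpan b) (n + 1) := by
  obtain ⟨Z, hZ, hwZ⟩ := hw
  obtain ⟨Z', hZ', h2⟩ := exists_rows_mem_homogeneousSpan h hZ
  refine ⟨Z', hZ', fun x hx => basis_ext b fun l => ?_⟩
  rw [Module.End.mul_apply, hc, hwZ x (mem_posPow_domain x.2 n)]
  refine ((hasSum_mat_apply b Z _ (σ l)).mul_left (α l)).unique ?_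
  convert! hasSum_mat_apply b Z' (posPow N (n + 1 : ℕ) ⟨x, hx⟩) l using 2 with k
  rw [inner_posPow hN, inner_posPow hN, h2]
  have : (lam k : ℂ) ≠ 0 := by exact_mod_cast (lam_pos k).ne'
  field_simp
  ring

theorem isHomogeneous_one : IsHomogeneous b 0 (1 : H →L[ℂ] H) := by
  intro m n h
  change inner ℂ (b m) (b n) = 0
  rw [inner_basis, if_neg (by omega)]

theorem ladder_pow_le_orderEnd (hD : IsLowering b D) (n : ℕ) :
    ladder (lowerEnd hD) (raiseEnd hD) ^ n ≤ orderEnd (angleSq D) (homogeneousSpan b) n := by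
  have hN := hD.angleSq_isDiag
  induction n with
  | zero =>
    rw [pow_zero, Submodule.one_le]
    refine ⟨1, Submodule.subset_span ⟨0, isHomogeneous_one⟩, fun x h => basis_ext b fun k => ?_⟩
    change _ = inner ℂ (b k) (posPow (angleSq D) (0 : ℕ) ⟨x, h⟩)
    rw [inner_posPow hN]
    simp
  | succ n ih =>
    rw [pow_succ', Submodule.mul_le]
    intro c hc w hw
    replace hw := ih hw
    induction hc using Submodule.span_induction with
    | zero => rw [zero_mul]; exact Submodule.zero_mem _
    | add c c' _ _ h h' => rw [add_mul]; exact Submodule.add_mem _ h h'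
    | smul t c _ h => rw [smul_mul_assoc]; exact Submodule.smul_mem _ t h
    | mem c hc =>
      rcases hc with rfl | rfl | rfl
      · refine rows_mul_mem_orderEnd hN (α := fun _ => 1) (σ := id) (fun d Z hZ => ?_) (fun x l => by simp) hw
        obtain ⟨C, hC, h⟩ := hZ.exists_div_lam
        exact ⟨d, C, hC, fun l n => by rw [h]; simp⟩
      · refine rows_mul_mem_orderEnd hN (α := fun l => (shiftWeight (l + 1) : ℂ)) (σ := fun l => l + 1)
          (fun d Z hZ => ?_) (fun x l => inner_lowerEnd hD x l) hw
        obtain ⟨C, hC, h⟩ := hZ.exists_lower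
        exact ⟨d - 1, C, hC, h⟩
      · refine rows_mul_mem_orderEnd hN (α := fun l => (shiftWeight l : ℂ)) (σ := fun l => l - 1)
          (fun d Z hZ => ?_) (fun x l => inner_raiseEnd hD x l) hw
        obtain ⟨C, hC, h⟩ := hZ.exists_raise
        exact ⟨d + 1, C, hC, h⟩

/-! ### Regularity of homogeneous operators -/

theorem abs_lam_sub_lam_le (m n : ℕ) : |lam m - lam n| ≤ |(m : ℝ) - n| := by
  have h1 := lam_sq m
  have h2 := lam_sq n
  have h3 := one_le_lam m
  have h4 := one_le_lam n
  have h5 : (lam m - lam n) * (lam m + lam n) = 2 * ((m : ℝ) - n) := by ring_nf; rw [h1, h2]; ring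
  have h6 := congrArg abs h5
  rw [abs_mul, abs_mul, abs_of_pos (by linarith : 0 < lam m + lam n), abs_two] at h6
  nlinarith [abs_nonneg (lam m - lam n)]

/-- On the only nonzero diagonal |lam m − lam n| ≤ |m − n| = |d|, so every iterated commutator has
bounded entries on that same diagonal. -/
theorem IsHomogeneous.hasDeltas {d : ℤ} {Z : H →L[ℂ] H} (hZ : IsHomogeneous b d Z) :
    HasDeltas b (⊤ : Submodule ℂ (H →L[ℂ] H)) Z := by
  intro k
  obtain ⟨S, hS⟩ := exists_clm_homogeneous b d (fun m n => ((lam m - lam n : ℝ) : ℂ) ^ k * mat b Z m n)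
    (|(d : ℝ)| ^ k * ‖Z‖) (fun m n h => by rw [hZ m n h, mul_zero]) fun m n => by
      by_cases h : (m : ℤ) = n + d
      · rw [norm_mul, norm_pow, Complex.norm_real, Real.norm_eq_abs]
        have h1 := abs_lam_sub_lam_le m n
        have h2 : (m : ℝ) - n = d := by
          have : (m : ℝ) = n + d := by exact_mod_cast h
          linarith
        rw [h2] at h1
        gcongr
        exact norm_mat_le Z m n
      · rw [hZ m n h, mul_zero, norm_zero]
        positivity
  exact ⟨S, trivial, hS⟩

theorem remainder_mapsTo_smoothVectors (hD : IsLowering b D) : ∀ x ∈ smoothVectors (angleSq D),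
    ∃ h : x ∈ (remainder D).domain, remainder D ⟨x, h⟩ ∈ smoothVectors (angleSq D) := fun x hx => by
  obtain ⟨h1, h2⟩ := represents_remainder hD ⟨x, hx⟩
  exact ⟨h1, by rw [h2]; exact Subtype.coe_prop _⟩

/-- The number operator BA satisfies [BA, A²] = −4A² and [BA, B²] = 4B², by AB = BA + 2. -/
theorem represents_comm_remainder (hD : IsLowering b D) : Represents (comm (angleSq D) (remainder D))
    ((-2 * Complex.I) • (lowerEnd hD * lowerEnd hD + raiseEnd hD * raiseEnd hD)) := by
  refine ((represents_angleSq hD).comm (represents_remainder hD)).congr ?_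
  set A := lowerEnd hD
  set B := raiseEnd hD
  have h : A * B = B * A + (2 : ℂ) • 1 := by
    rw [← lowerEnd_mul_raiseEnd hD]; noncomm_ring
  have h1 : B * A * (A * A) - A * A * (B * A) = (-4 : ℂ) • (A * A) := by
    have e : A * A * (B * A) = A * (A * B) * A := by noncomm_ring
    have e2 : A * (B * A) * A = (A * B) * (A * A) := by noncomm_ring
    rw [e, h, mul_add, add_mul, e2, h, add_mul, mul_smul_comm, smul_mul_assoc, smul_mul_assoc, mul_one, one_mul]
    module
  have h2 : B * A * (B * B) - B * B * (B * A) = (4 : ℂ) • (B * B) := by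
    have e : B * A * (B * B) = B * (A * B) * B := by noncomm_ring
    have e2 : B * (B * A) * B = B * B * (A * B) := by noncomm_ring
    rw [e, h, mul_add, add_mul, e2, h, mul_add]
    simp only [mul_smul_comm, smul_mul_assoc, mul_one]
    module
  have e : (B * A + 1) * ((Complex.I / 2) • (A * A - B * B)) - (Complex.I / 2) • (A * A - B * B) * (B * A + 1)
      = (Complex.I / 2) • ((B * A * (A * A) - A * A * (B * A)) - (B * A * (B * B) - B * B * (B * A))) := by
    rw [mul_smul_comm, smul_mul_assoc]
    refine Eq.trans (smul_sub (Complex.I / 2) _ _).symm (congrArg _ ?_)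
    simp only [mul_sub, sub_mul, add_mul, mul_add, one_mul, mul_one, mul_assoc]
    abel
  rw [e, h1, h2]
  module

/-- With Λ² factored out on the left, the commutator is Λ² times −2i(Λ⁻²D² + Λ⁻²D*²). Both summands
are bounded and homogeneous, of degrees −2 and 2. -/
theorem comm_remainder_mem_OP (hD : IsLowering b D) : comm (angleSq D) (remainder D) ∈ OP (angleSq D) 2 := by
  have hN := hD.angleSq_isDiag
  have hsw : ∀ n, 0 ≤ shiftWeight n := shiftWeight_nonneg
  have hl := lam_pos
  obtain ⟨A₁, hA₁⟩ := exists_clm_homogeneous b (-2) (fun m n => if n = m + 2 then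
    ((shiftWeight (m + 1) * shiftWeight (m + 2) / lam m ^ 2 : ℝ) : ℂ) else 0) 2
    (fun m n h => if_neg (by omega)) fun m n => by
      split_ifs
      · rw [Complex.norm_real, Real.norm_of_nonneg (by have := hsw (m + 1); have := hsw (m + 2); positivity),
          shiftWeight_succ, shiftWeight_succ, div_le_iff₀ (pow_pos (hl m) 2)]
        nlinarith [lam_succ_le m, hl m]
      · simp
  obtain ⟨A₂, hA₂⟩ := exists_clm_homogeneous b 2 (fun m n => if m = n + 2 then
    ((shiftWeight m * shiftWeight (m - 1) / lam m ^ 2 : ℝ) : ℂ) else 0) 1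
    (fun m n h => if_neg (by omega)) fun m n => by
      split_ifs
      · rw [Complex.norm_real, Real.norm_of_nonneg (by have := hsw m; have := hsw (m - 1); positivity),
          div_le_iff₀ (pow_pos (hl m) 2), one_mul, sq]
        refine mul_le_mul (shiftWeight_le_lam m) ?_ (hsw _) (hl m).le
        exact (Real.sqrt_le_sqrt (by gcongr; omega)).trans (shiftWeight_le_lam m)
      · simp
  have hd₁ : IsHomogeneous b (-2) A₁ := fun m n h => by rw [hA₁, if_neg (by omega)]
  have hd₂ : IsHomogeneous b 2 A₂ := fun m n h => by rw [hA₂, if_neg (by omega)]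
  have i₁ : ∀ (x : smoothVectors (angleSq D)) (m : ℕ), (lam m : ℂ) ^ 2 * inner ℂ (b m) (A₁ x)
      = inner ℂ (b m) ((lowerEnd hD * lowerEnd hD) x : H) := fun x m => by
    rw [(hasSum_mat_apply b A₁ x m).unique (hasSum_single (m + 2) fun n hn => by rw [hA₁, if_neg hn, zero_mul]),
      Module.End.mul_apply, inner_lowerEnd, inner_lowerEnd, hA₁, if_pos rfl]
    have : (lam m : ℂ) ≠ 0 := by exact_mod_cast (hl m).ne'
    push_cast
    field_simp
  have i₂ : ∀ (x : smoothVectors (angleSq D)) (m : ℕ), (lam m : ℂ) ^ 2 * inner ℂ (b m) (A₂ x)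
      = inner ℂ (b m) ((raiseEnd hD * raiseEnd hD) x : H) := fun x m => by
    rw [Module.End.mul_apply, inner_raiseEnd, inner_raiseEnd]
    have h0 : (lam m : ℂ) ≠ 0 := by exact_mod_cast (hl m).ne'
    rcases lt_or_ge m 2 with hm | hm
    · have e : inner ℂ (b m) (A₂ x) = 0 := by
        refine (hasSum_mat_apply b A₂ x m).unique ?_
        convert! hasSum_zero using 2 with n
        rw [hA₂, if_neg (by omega), zero_mul]
      rw [e]
      interval_cases m <;> simp [shiftWeight_zero]
    · rw [(hasSum_mat_apply b A₂ x m).unique (hasSum_single (m - 2) fun n hn => by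
        rw [hA₂, if_neg (by omega), zero_mul]), hA₂, if_pos (by omega), Nat.sub_sub]
      push_cast
      field_simp
  refine ⟨(-2 * Complex.I) • (A₁ + A₂), HasDeltas.mem_OP0 hN ((hd₁.hasDeltas.add hd₂.hasDeltas).smul _),
    fun x hx => ?_⟩
  obtain ⟨h1, h2⟩ := represents_comm_remainder hD ⟨x, hx⟩
  have hg : (((-2 * Complex.I) • (A₁ + A₂)) x,
      ((((-2 * Complex.I) • (lowerEnd hD * lowerEnd hD + raiseEnd hD * raiseEnd hD)) ⟨x, hx⟩ :
        smoothVectors (angleSq D)) : H)) ∈ (posPow (angleSq D) 2).graph := by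
    refine (posPow_isDiag hN zero_le_two _ _).2 fun m => ?_
    change inner ℂ (b m) ((-2 * Complex.I) • (((lowerEnd hD * lowerEnd hD) ⟨x, hx⟩ : H)
      + ((raiseEnd hD * raiseEnd hD) ⟨x, hx⟩ : H))) = _ * inner ℂ (b m) ((-2 * Complex.I) • (A₁ x + A₂ x))
    rw [inner_smul_right, inner_smul_right, inner_add_right, inner_add_right, ← i₁, ← i₂]
    simp only [Real.rpow_two]
    push_cast
    ring
  obtain ⟨h3, h4⟩ := mem_graph_iff.1 hg
  exact ⟨h1, h3, by rw [h2, h4]⟩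

end Oscillator

/-! ### Smooth summability of the harmonic oscillator -/

theorem IsC1inf.deriv {f : ℝ → ℂ} (hf : IsC1inf f) : IsC1inf (deriv f) :=
  ⟨(contDiff_infty_iff_deriv.1 hf.1).2, fun k => by
    rw [← iteratedDeriv_succ']
    exact hf.2 (k + 1)⟩

theorem oscRep_eq_mulL (a : C1inf) : oscRep a = mulL (a : ℝ → ℂ) := mulOp_eq_mulL a

theorem exists_derivRel_oscRep (a : C1inf) : ∃ a' : C1inf, DerivRel hermiteBasis (oscRep a) (oscRep a') := by
  have ha : IsC1inf a := a.2
  have hd := ha.hasDerivAt 0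
  rw [zero_add, iteratedDeriv_one, iteratedDeriv_zero] at hd
  obtain ⟨C, hC⟩ := ha.bounded 0
  obtain ⟨C', hC'⟩ := ha.bounded 1
  rw [iteratedDeriv_zero] at hC
  rw [iteratedDeriv_one] at hC'
  refine ⟨⟨deriv a, ha.deriv⟩, ?_⟩
  rw [oscRep_eq_mulL, oscRep_eq_mulL]
  exact derivRel_mulL hd ha.deriv.1.continuous hC hC'

theorem exists_oscRep_eq_mul (a : C1inf) : ∃ g h : ℝ → ℂ, IsSmoothL2 g ∧ IsSmoothL2 h ∧
    oscRep a = mulL g * mulL h := by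
  obtain ⟨g, h, hg, hh, e⟩ := IsC1inf.exists_mul a.2
  refine ⟨g, h, hg, hh, ?_⟩
  rw [oscRep_eq_mulL, e]
  have hm := C1inf.memLp_top a
  rw [e] at hm
  exact mulL_mul hg.memLp_top hh.memLp_top hm

theorem hasDeltas_mulL_mul {h : ℝ → ℂ} (hh : IsSmoothL2 h) {Z : L2 →L[ℂ] L2}
    (hZ : Z ∈ homogeneousSpan hermiteBasis) :
    HasDeltas hermiteBasis (HSB2 hermiteBasis (angleSq osc) 1) (mulL h * Z) := by
  refine HasDeltas.of_mem_towerSpan isDiag_angleSq_osc zero_le_one ?_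
  induction hZ using Submodule.span_induction with
  | zero => rw [mul_zero]; exact Submodule.zero_mem _
  | add Z Z' _ _ h h' => rw [mul_add]; exact Submodule.add_mem _ h h'
  | smul c Z _ h => rw [mul_smul_comm]; exact Submodule.smul_mem _ c h
  | mem Z hZ =>
    obtain ⟨d, hZ⟩ := hZ
    rw [← one_mul (mulL h)]
    exact mem_towerSpan isHomogeneous_one hh.isDerivTower_mulL hZ

theorem one_mem_homogeneousSpan : (1 : L2 →L[ℂ] L2) ∈ homogeneousSpan hermiteBasis :=
  Submodule.subset_span ⟨0, isHomogeneous_one⟩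

theorem hasDeltas_mulL {h : ℝ → ℂ} (hh : IsSmoothL2 h) :
    HasDeltas hermiteBasis (HSB2 hermiteBasis (angleSq osc) 1) (mulL h) := by
  have := hasDeltas_mulL_mul hh one_mem_homogeneousSpan
  rwa [mul_one] at this

/-- Split fZ as g times hZ: both factors have all iterated commutators square integrable, and the
Leibniz rule does the rest. -/
theorem hasDeltas_oscRep_mul (a : C1inf) {Z : L2 →L[ℂ] L2} (hZ : Z ∈ homogeneousSpan hermiteBasis) :
    HasDeltas hermiteBasis (B2sq (angleSq osc) 1) (oscRep a * Z) := by
  obtain ⟨g, h, hg, hh, e⟩ := exists_oscRep_eq_mul a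
  rw [e, mul_assoc]
  exact HasDeltas.mul_mem_B2sq isDiag_angleSq_osc zero_le_one (hasDeltas_mulL hg) (hasDeltas_mulL_mul hh hZ)

theorem oscRep_mem_smoothVectors (a : C1inf) {x : L2} (hx : x ∈ smoothVectors (angleSq osc)) :
    oscRep a x ∈ smoothVectors (angleSq osc) := by
  have := hasDeltas_oscRep_mul a one_mem_homogeneousSpan
  rw [mul_one] at this
  exact this.map_smoothVectors isDiag_angleSq_osc hx

/-- The multiplication operators as endomorphisms of the space of smooth vectors. -/
def mulEnds : Submodule ℂ (Module.End ℂ (smoothVectors (angleSq osc))) where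
  carrier := {m | ∃ a, ∀ x, (m x : L2) = oscRep a x}
  zero_mem' := ⟨0, fun x => by simp⟩
  add_mem' := by
    rintro m m' ⟨a, h⟩ ⟨a', h'⟩
    refine ⟨a + a', fun x => ?_⟩
    rw [map_add]
    change (m x : L2) + (m' x : L2) = oscRep a x + oscRep a' x
    rw [h, h']
  smul_mem' := by
    rintro c m ⟨a, h⟩
    refine ⟨c • a, fun x => ?_⟩
    rw [map_smul]
    change c • (m x : L2) = c • oscRep a x
    rw [h]

theorem exists_represents_oscRep (a : C1inf) : ∃ m ∈ mulEnds, Represents (ofBdd (oscRep a)) m ∧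
    ∀ x, (m x : L2) = oscRep a x :=
  ⟨restrictEnd (ofBdd (oscRep a)) fun _ hx => ⟨trivial, oscRep_mem_smoothVectors a hx⟩, ⟨a, fun _ => rfl⟩,
    represents_restrictEnd _, fun _ => rfl⟩

/-- The lowering operator on smooth vectors. -/
abbrev oscLower : Module.End ℂ (smoothVectors (angleSq osc)) := lowerEnd isLowering_osc

/-- The raising operator on smooth vectors. -/
abbrev oscRaise : Module.End ℂ (smoothVectors (angleSq osc)) := raiseEnd isLowering_osc

theorem ladder_comm_mem_mulEnds : ∀ c ∈ ({oscLower, oscRaise} : Set _), ∀ m ∈ mulEnds,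
    c * m - m * c ∈ mulEnds := by
  rintro c hc m ⟨a, ha⟩
  obtain ⟨a', ha'⟩ := exists_derivRel_oscRep a
  rcases hc with rfl | rfl
  · refine ⟨a', fun x => ?_⟩
    obtain ⟨h1, h2⟩ := represents_lowerEnd isLowering_osc x
    obtain ⟨h3, h4⟩ := represents_lowerEnd isLowering_osc (m x)
    obtain ⟨h5, h6⟩ := ha'.lower_apply isLowering_osc h1
    change (oscLower (m x) : L2) - (m (oscLower x) : L2) = _
    rw [ha, ← h4, ← h2]
    simp only [ha]
    rw [h6]
    abel
  · refine ⟨(-1 : ℂ) • a', fun x => ?_⟩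
    obtain ⟨h1, h2⟩ := represents_raiseEnd isLowering_osc x
    obtain ⟨h3, h4⟩ := represents_raiseEnd isLowering_osc (m x)
    obtain ⟨h5, h6⟩ := ha'.raise_apply isRaising_osc_adjoint h1
    rw [map_smul]
    change (oscRaise (m x) : L2) - (m (oscRaise x) : L2) = (-1 : ℂ) • oscRep a' x
    rw [ha, ← h4, ← h2]
    simp only [ha]
    rw [h6]
    module

/-- The sets S⁰ contain only multiplications, since [D, f] = f' and [D*, f] = −f'. As ⟨D⟩² = D*D + 1
and R_D are quadratic in the ladder operators up to a scalar, each further commutator costs one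
ladder factor. -/
theorem exists_represents_of_mem_iteratedCommutators (n : ℕ) : ∀ T ∈ iteratedCommutators oscRep osc n,
    ∃ L ∈ mulEnds * ladder oscLower oscRaise ^ n, Represents T L := by
  induction n with
  | zero =>
    rintro T ⟨a, rfl | rfl | rfl⟩
    all_goals
      obtain ⟨m, hm, hrep, -⟩ := exists_represents_oscRep a
      rw [pow_zero, mul_one]
    · exact ⟨m, hm, hrep⟩
    · exact ⟨_, ladder_comm_mem_mulEnds oscLower (by simp) m hm, (represents_lowerEnd _).comm hrep⟩
    · exact ⟨_, ladder_comm_mem_mulEnds oscRaise (by simp) m hm, (represents_raiseEnd _).comm hrep⟩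
  | succ n ih =>
    rintro T ⟨T', hT', hT⟩
    obtain ⟨L, hL, hrep⟩ := ih T' hT'
    have key := fun a a' (ha : a ∈ ({oscLower, oscRaise} : Set _)) (ha' : a' ∈ ({oscLower, oscRaise} : Set _)) =>
      quadratic_comm_mem (lowerEnd_mul_raiseEnd isLowering_osc) ladder_comm_mem_mulEnds ha ha' n hL
    rcases hT with rfl | rfl
    · refine ⟨_, ?_, (represents_angleSq isLowering_osc).comm hrep⟩
      have e : (oscRaise * oscLower + 1) * L - L * (oscRaise * oscLower + 1)
          = oscRaise * oscLower * L - L * (oscRaise * oscLower) := by noncomm_ring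
      rw [e]
      exact key oscRaise oscLower (by simp) (by simp)
    · refine ⟨_, ?_, (represents_remainder isLowering_osc).comm hrep⟩
      have e : ((Complex.I / 2) • (oscLower * oscLower - oscRaise * oscRaise)) * L
          - L * ((Complex.I / 2) • (oscLower * oscLower - oscRaise * oscRaise))
          = (Complex.I / 2) • ((oscLower * oscLower * L - L * (oscLower * oscLower))
            - (oscRaise * oscRaise * L - L * (oscRaise * oscRaise))) := by
        rw [mul_smul_comm, smul_mul_assoc]
        refine Eq.trans (smul_sub (Complex.I / 2) _ _).symm (congrArg _ ?_)
        simp only [mul_sub, sub_mul]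
        abel
      rw [e]
      exact Submodule.smul_mem _ _ (Submodule.sub_mem _ (key oscLower oscLower (by simp) (by simp))
        (key oscRaise oscRaise (by simp) (by simp)))

/-- The bounded operators all of whose iterated commutators lie in `B₂²`. -/
def deltasB2sq : Submodule ℂ (L2 →L[ℂ] L2) where
  carrier := {T | HasDeltas hermiteBasis (B2sq (angleSq osc) 1) T}
  zero_mem' := HasDeltas.zero _
  add_mem' h h' := h.add h'
  smul_mem' c _ h := h.smul c

theorem mulEnds_mul_ladder_pow_le (n : ℕ) :
    mulEnds * ladder oscLower oscRaise ^ n ≤ orderEnd (angleSq osc) deltasB2sq n := by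
  rw [Submodule.mul_le]
  rintro m ⟨a, ha⟩ w hw
  obtain ⟨Z, hZ, h⟩ := ladder_pow_le_orderEnd isLowering_osc n hw
  refine ⟨oscRep a * Z, hasDeltas_oscRep_mul a hZ, fun x hx => ?_⟩
  rw [Module.End.mul_apply, ha, h x hx]
  rfl

theorem iteratedCommutators_subset (n : ℕ) :
    iteratedCommutators oscRep osc n ⊆ tameOP (angleSq osc) 1 n := by
  intro T hT
  obtain ⟨L, hL, hrep⟩ := exists_represents_of_mem_iteratedCommutators n T hT
  obtain ⟨A, hA, h⟩ := mulEnds_mul_ladder_pow_le n hL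
  refine ⟨A, HasDeltas.mem_B1smooth isDiag_angleSq_osc (HasDeltas.mono (B2sq_subset_B1 1) hA), fun x hx => ?_⟩
  obtain ⟨h1, h2⟩ := hrep ⟨x, hx⟩
  exact ⟨h1, mem_posPow_domain hx n, by rw [h2, h]⟩

theorem comm_osc_bounded (a : C1inf) : ∃ S, AgreesOn (comm osc (ofBdd (oscRep a))) osc.domain S := by
  obtain ⟨a', ha'⟩ := exists_derivRel_oscRep a
  refine ⟨oscRep a', fun x hx => ?_⟩
  obtain ⟨h1, h2⟩ := ha'.lower_apply isLowering_osc hx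
  refine ⟨⟨⟨trivial, h1⟩, hx, trivial⟩, ?_⟩
  change osc ⟨oscRep a x, h1⟩ - oscRep a (osc ⟨x, hx⟩) = _
  rw [h2]
  abel

theorem comm_osc_adjoint_bounded (a : C1inf) :
    ∃ S, AgreesOn (comm osc.adjoint (ofBdd (oscRep a))) osc.adjoint.domain S := by
  obtain ⟨a', ha'⟩ := exists_derivRel_oscRep a
  refine ⟨-oscRep a', fun x hx => ?_⟩
  obtain ⟨h1, h2⟩ := ha'.raise_apply isRaising_osc_adjoint hx
  refine ⟨⟨⟨trivial, h1⟩, hx, trivial⟩, ?_⟩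
  change osc.adjoint ⟨oscRep a x, h1⟩ - oscRep a (osc.adjoint ⟨x, hx⟩) = -oscRep a' x
  rw [h2]
  abel

/-! ### Spectral dimension -/

section Abstract

variable {H : Type*} [NormedAddCommGroup H] [InnerProductSpace ℂ H] [CompleteSpace H]
variable {b : HilbertBasis ℕ ℂ H} {N : H →ₗ.[ℂ] H}

theorem enorm_sq_eq_ofReal (z : ℂ) : ‖z‖ₑ ^ 2 = ENNReal.ofReal (‖z‖ ^ 2) := by
  rw [ENNReal.ofReal_pow (norm_nonneg _), ofReal_norm]

variable (b) in
theorem exists_clm_of_hs {K : ℕ → ℕ → ℂ} (hK : ∑' (n : ℕ) (m : ℕ), ‖K m n‖ₑ ^ 2 < ⊤) :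
    ∃ T : H →L[ℂ] H, ∀ m n, mat b T m n = K m n := by
  set S := (∑' (n : ℕ) (m : ℕ), ‖K m n‖ₑ ^ 2).toReal with hS
  refine exists_clm_of_form b K (Real.sqrt S) fun s u v => ?_
  have h1 : ∑ m ∈ s, ∑ n ∈ s, ‖K m n‖ ^ 2 ≤ S := by
    rw [hS, ← ENNReal.ofReal_le_iff_le_toReal hK.ne, ENNReal.ofReal_sum_of_nonneg fun m _ =>
      Finset.sum_nonneg fun n _ => by positivity]
    calc ∑ m ∈ s, ENNReal.ofReal (∑ n ∈ s, ‖K m n‖ ^ 2) = ∑ m ∈ s, ∑ n ∈ s, ‖K m n‖ₑ ^ 2 := by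
          refine Finset.sum_congr rfl fun m _ => ?_
          rw [ENNReal.ofReal_sum_of_nonneg fun n _ => by positivity]
          exact Finset.sum_congr rfl fun n _ => (enorm_sq_eq_ofReal _).symm
      _ = ∑ n ∈ s, ∑ m ∈ s, ‖K m n‖ₑ ^ 2 := Finset.sum_comm
      _ ≤ ∑ n ∈ s, ∑' m, ‖K m n‖ₑ ^ 2 := Finset.sum_le_sum fun n _ => ENNReal.sum_le_tsum _
      _ ≤ _ := ENNReal.sum_le_tsum _
  set A := ∑ n ∈ s, ‖u n‖ ^ 2 with hA
  set B := ∑ m ∈ s, ‖v m‖ ^ 2 with hB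
  have hA0 : 0 ≤ A := Finset.sum_nonneg fun _ _ => by positivity
  have hB0 : 0 ≤ B := Finset.sum_nonneg fun _ _ => by positivity
  have h2 : ‖∑ m ∈ s, ∑ n ∈ s, star (v m) * K m n * u n‖ ≤ ∑ z ∈ s ×ˢ s, ‖K z.1 z.2‖ * (‖v z.1‖ * ‖u z.2‖) := by
    rw [Finset.sum_product]
    refine (norm_sum_le _ _).trans (Finset.sum_le_sum fun m _ => (norm_sum_le _ _).trans
      (Finset.sum_le_sum fun n _ => le_of_eq ?_))
    rw [norm_mul, norm_mul, norm_star]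
    ring
  have h3 := Finset.sum_mul_sq_le_sq_mul_sq (s ×ˢ s) (fun z => ‖K z.1 z.2‖) fun z => ‖v z.1‖ * ‖u z.2‖
  have h4 : ∑ z ∈ s ×ˢ s, (‖v z.1‖ * ‖u z.2‖) ^ 2 = B * A := by
    rw [Finset.sum_product, hA, hB, Finset.sum_mul_sum]
    simp only [mul_pow]
  have h1' : ∑ z ∈ s ×ˢ s, ‖K z.1 z.2‖ ^ 2 ≤ S := (Finset.sum_product s s fun z => ‖K z.1 z.2‖ ^ 2).trans_le h1
  rw [h4] at h3
  refine h2.trans (abs_le_of_sq_le_sq' ?_ (by positivity)).2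
  rw [mul_pow, Real.sq_sqrt ENNReal.toReal_nonneg]
  refine h3.trans ?_
  have h5 : B * A ≤ (A + B) ^ 2 := by nlinarith
  exact mul_le_mul h1' h5 (by positivity) ENNReal.toReal_nonneg

/-- A Peetre-type inequality: growth in lam m is traded for growth in lam n at the price of (lam m −
lam n)². For s ≤ 2 this means one commutator with Λ in the square of a Hilbert-Schmidt norm. -/
theorem lam_rpow_le {s : ℝ} (hs0 : 0 ≤ s) (hs2 : s ≤ 2) (m n : ℕ) :
    lam m ^ s ≤ (3 + 2 * (lam m - lam n) ^ 2) * lam n ^ s := by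
  have hm := lam_pos m
  have hn := lam_pos n
  rcases le_or_gt (lam m) (lam n) with h | h
  · have h1 : lam m ^ s ≤ lam n ^ s := Real.rpow_le_rpow hm.le h hs0
    have h2 : 0 ≤ lam n ^ s := by positivity
    nlinarith [sq_nonneg (lam m - lam n)]
  · have h1 : (lam m / lam n) ^ s ≤ (lam m / lam n) ^ (2 : ℝ) :=
      Real.rpow_le_rpow_of_exponent_le ((one_le_div hn).2 h.le) hs2
    rw [Real.div_rpow hm.le hn.le, Real.rpow_two, div_le_iff₀ (by positivity)] at h1
    refine h1.trans (mul_le_mul_of_nonneg_right ?_ (by positivity))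
    rw [div_pow, div_le_iff₀ (by positivity)]
    have h2 := one_le_lam n
    have h3 : lam m ^ 2 ≤ 2 * lam n ^ 2 + 2 * (lam m - lam n) ^ 2 := by nlinarith [sq_nonneg (lam m - 2 * lam n)]
    have h4 : (lam m - lam n) ^ 2 ≤ (lam m - lam n) ^ 2 * lam n ^ 2 :=
      le_mul_of_one_le_right (sq_nonneg _) (by nlinarith)
    nlinarith [sq_nonneg (lam n)]

theorem enorm_sq_le_of_norm_sq_le {z z₁ z₂ : ℂ} (h : ‖z‖ ^ 2 ≤ 3 * ‖z₁‖ ^ 2 + 2 * ‖z₂‖ ^ 2) :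
    ‖z‖ₑ ^ 2 ≤ 3 * ‖z₁‖ₑ ^ 2 + 2 * ‖z₂‖ₑ ^ 2 := by
  rw [enorm_sq_eq_ofReal, enorm_sq_eq_ofReal, enorm_sq_eq_ofReal]
  refine (ENNReal.ofReal_le_ofReal h).trans (le_of_eq ?_)
  rw [ENNReal.ofReal_add (by positivity) (by positivity), ENNReal.ofReal_mul (by norm_num),
    ENNReal.ofReal_mul (by norm_num)]
  simp

/-- If `X` and its commutator with `(1 + N)^(1/2)` are square integrable, then
`(1 + N)^(s/4) X (1 + N)^(-s/2)` is Hilbert-Schmidt. -/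
theorem exists_hs_conjugate (hN : IsDiag b N fun n => 2 * n + 1) {p s : ℝ} (hp : 0 ≤ p) (hps : p < s) (hs2 : s ≤ 2)
    {X : H →L[ℂ] H} (hX : HasDeltas b (HSB2 b N p) X) :
    ∃ Y : H →L[ℂ] H, hs b Y < ⊤ ∧ negPow N (s / 2) * Y = X * negPow N s := by
  obtain ⟨X₁, hX₁, hd⟩ := hX 1
  have hs0 : 0 < s := hp.trans_lt hps
  have hn := negPow_apply hN (s := s / 2) (by linarith)
  have f0 := (hX.mem s hps).1
  have f1 := (hX₁ s hps).1
  set K : ℕ → ℕ → ℂ := fun m n => ((lam m ^ (s / 2) * lam n ^ (-s) : ℝ) : ℂ) * mat b X m n with hK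
  -- The entries of Λ^(s/2)XΛ⁻ˢ are dominated by those of XΛ^(−s/2) and [Λ, X]Λ^(−s/2), both
  -- Hilbert-Schmidt.
  have hle : ∀ m n, ‖K m n‖ₑ ^ 2 ≤ 3 * ‖mat b (X * negPow N (s / 2)) m n‖ₑ ^ 2
      + 2 * ‖mat b (X₁ * negPow N (s / 2)) m n‖ₑ ^ 2 := by
    intro m n
    apply enorm_sq_le_of_norm_sq_le
    rw [hK, mat_mul_diag b hn, mat_mul_diag b hn, hd m n, pow_one]
    simp only [norm_mul, mul_pow, Complex.norm_real, Real.norm_eq_abs, sq_abs]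
    have e1 : (lam m ^ (s / 2)) ^ 2 = lam m ^ s := by
      rw [← Real.rpow_natCast, ← Real.rpow_mul (lam_pos m).le]; congr 1; push_cast; ring
    have e2 : (lam n ^ (-(s / 2))) ^ 2 = lam n ^ (-s) := by
      rw [← Real.rpow_natCast, ← Real.rpow_mul (lam_pos n).le]; congr 1; push_cast; ring
    have e3 : lam n ^ (-s) * lam n ^ s = 1 := by rw [← Real.rpow_add (lam_pos n)]; simp
    have h1 := lam_rpow_le hs0.le hs2 m n
    have h2 : 0 ≤ lam n ^ (-s) := by have := lam_pos n; positivity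
    rw [e1, e2]
    calc lam m ^ s * (lam n ^ (-s)) ^ 2 * ‖mat b X m n‖ ^ 2
        ≤ (3 + 2 * (lam m - lam n) ^ 2) * lam n ^ s * (lam n ^ (-s)) ^ 2 * ‖mat b X m n‖ ^ 2 := by gcongr
      _ = (3 + 2 * (lam m - lam n) ^ 2) * (lam n ^ (-s) * lam n ^ s) * lam n ^ (-s) * ‖mat b X m n‖ ^ 2 := by ring
      _ = _ := by rw [e3]; ring
  have hfin : ∑' (n : ℕ) (m : ℕ), ‖K m n‖ₑ ^ 2 < ⊤ := by
    refine (ENNReal.tsum_le_tsum fun n => ENNReal.tsum_le_tsum fun m => hle m n).trans_lt ?_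
    simp only [ENNReal.tsum_add, ENNReal.tsum_mul_left, ← hs_eq_tsum_mat]
    exact ENNReal.add_lt_top.2 ⟨ENNReal.mul_lt_top (by simp) f0, ENNReal.mul_lt_top (by simp) f1⟩
  obtain ⟨Y, hY⟩ := exists_clm_of_hs b hfin
  refine ⟨Y, by rw [hs_eq_tsum_mat]; simpa only [hY] using hfin, mat_ext b fun m n => ?_⟩
  rw [mat_diag_mul b hn, mat_mul_diag b (negPow_apply hN hs0.le), hY, hK]
  have e : lam m ^ (-(s / 2)) * lam m ^ (s / 2) = 1 := by rw [← Real.rpow_add (lam_pos m)]; simp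
  have e' : ((lam m ^ (-(s / 2)) : ℝ) : ℂ) * ((lam m ^ (s / 2) : ℝ) : ℂ) = 1 := by exact_mod_cast e
  push_cast at e' ⊢
  linear_combination ((lam n ^ (-s) : ℝ) : ℂ) * mat b X m n * e'

/-- The vector d plays the role of D*x, so Σ lam n² |x_n|² ≤ μ and, as in Chebyshev's inequality,
half of the mass of x sits where lam n² ≤ 2μ. It is implemented by the pointwise bound lam n⁻ˢ ≥
(2μ)^(−s/2)(1 − lam n²/(2μ)). -/
theorem half_rpow_le_re_inner_negPow (hN : IsDiag b N fun n => 2 * n + 1) {s : ℝ} (hs : 0 ≤ s) {x d : H}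
    (hx : ‖x‖ = 1) (hd : ∀ n, inner ℂ (b (n + 1)) d = (lam n : ℂ) * inner ℂ (b n) x) {μ : ℝ} (hμ : 0 < μ)
    (hdμ : ‖d‖ ^ 2 ≤ μ) : 1 / 2 * (2 * μ) ^ (-(s / 2)) ≤ (inner ℂ x (negPow N s x)).re := by
  set c : ℕ → ℝ := fun n => ‖(inner ℂ (b n) x : ℂ)‖ ^ 2 with hc
  have h1 : HasSum c 1 := by
    have := norm_sq_eq_tsum b x
    rwa [hx, one_pow] at this
  have h2 : Summable fun n => lam n ^ 2 * c n := by
    refine ((summable_nat_add_iff 1).2 (norm_sq_eq_tsum b d).summable).congr fun n => ?_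
    rw [hd, norm_mul, Complex.norm_real, Real.norm_eq_abs, mul_pow, sq_abs]
  have h2' : ∑' n, lam n ^ 2 * c n ≤ μ := by
    refine le_trans ?_ hdμ
    have h3 := (hasSum_nat_add_iff' 1).2 (norm_sq_eq_tsum b d)
    have h4 : HasSum (fun n => lam n ^ 2 * c n)
        (‖d‖ ^ 2 - ∑ i ∈ Finset.range 1, ‖(inner ℂ (b i) d : ℂ)‖ ^ 2) := by
      convert! h3 using 2 with n
      rw [hd, norm_mul, Complex.norm_real, Real.norm_eq_abs, mul_pow, sq_abs]
    rw [h4.tsum_eq, Finset.sum_range_one]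
    have : 0 ≤ ‖(inner ℂ (b 0) d : ℂ)‖ ^ 2 := by positivity
    linarith
  have h5 : HasSum (fun n => lam n ^ (-s) * c n) (inner ℂ x (negPow N s x)).re := by
    have := Complex.hasSum_re (b.hasSum_inner_mul_inner x (negPow N s x))
    convert! this using 2 with n
    rw [inner_negPow hN hs, hc]
    have e : inner ℂ x (b n) * (((lam n ^ (-s) : ℝ) : ℂ) * inner ℂ (b n) x)
        = ((lam n ^ (-s) * ‖(inner ℂ (b n) x : ℂ)‖ ^ 2 : ℝ) : ℂ) := by
      rw [← inner_conj_symm]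
      have := Complex.normSq_eq_conj_mul_self (z := inner ℂ (b n) x)
      rw [Complex.normSq_eq_norm_sq] at this
      push_cast at this ⊢
      rw [this]
      ring
    rw [e, Complex.ofReal_re]
  have h6 : HasSum (fun n => (2 * μ) ^ (-(s / 2)) * c n - (2 * μ) ^ (-(s / 2)) / (2 * μ) * (lam n ^ 2 * c n))
      ((2 * μ) ^ (-(s / 2)) * 1 - (2 * μ) ^ (-(s / 2)) / (2 * μ) * ∑' n, lam n ^ 2 * c n) :=
    (h1.mul_left _).sub (h2.hasSum.mul_left _)
  have hpos : 0 < (2 * μ) ^ (-(s / 2)) := by positivity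
  have h7 : (2 * μ) ^ (-(s / 2)) * 1 - (2 * μ) ^ (-(s / 2)) / (2 * μ) * ∑' n, lam n ^ 2 * c n
      ≤ (inner ℂ x (negPow N s x)).re := by
    refine hasSum_le (fun n => ?_) h6 h5
    have hcn : 0 ≤ c n := by positivity
    have hl := lam_pos n
    have e : lam n ^ (-s) = (lam n ^ 2) ^ (-(s / 2)) := by
      rw [← Real.rpow_natCast, ← Real.rpow_mul hl.le]; congr 1; push_cast; ring
    have h8 : (2 * μ) ^ (-(s / 2)) - (2 * μ) ^ (-(s / 2)) / (2 * μ) * lam n ^ 2 ≤ lam n ^ (-s) := by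
      rcases le_or_gt (lam n ^ 2) (2 * μ) with h | h
      · have h9 : (2 * μ) ^ (-(s / 2)) ≤ lam n ^ (-s) := by
          rw [e]
          exact Real.rpow_le_rpow_of_nonpos (by positivity) h (by linarith)
        have : 0 ≤ (2 * μ) ^ (-(s / 2)) / (2 * μ) * lam n ^ 2 := by positivity
        linarith
      · have h9 : (2 * μ) ^ (-(s / 2)) ≤ (2 * μ) ^ (-(s / 2)) / (2 * μ) * lam n ^ 2 := by
          rw [div_mul_eq_mul_div, le_div_iff₀ (by positivity)]
          gcongr
        have : 0 ≤ lam n ^ (-s) := by positivity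
        linarith
    calc _ = ((2 * μ) ^ (-(s / 2)) - (2 * μ) ^ (-(s / 2)) / (2 * μ) * lam n ^ 2) * c n := by ring
      _ ≤ _ := by gcongr
  refine le_trans ?_ h7
  have h8 : (2 * μ) ^ (-(s / 2)) / (2 * μ) * ∑' n, lam n ^ 2 * c n ≤ (2 * μ) ^ (-(s / 2)) / (2 * μ) * μ := by gcongr
  have h9 : (2 * μ) ^ (-(s / 2)) / (2 * μ) * μ = 1 / 2 * (2 * μ) ^ (-(s / 2)) := by
    field_simp
  linarith

end Abstract

/-- With f = gh the operator equals (M_g Λ^(−s/2))(Λ^(s/2) M_h Λ⁻ˢ), a product of two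
Hilbert-Schmidt operators. -/
theorem isTraceClass_oscRep_mul_negPow (a : C1inf) {s : ℝ} (hs1 : 1 < s) (hs2 : s ≤ 2) :
    IsTraceClass (oscRep a * negPow (angleSq osc) s) := by
  obtain ⟨g, h, hg, hh, e⟩ := exists_oscRep_eq_mul a
  obtain ⟨Y, hY, e2⟩ := exists_hs_conjugate isDiag_angleSq_osc zero_le_one hs1 hs2 (hasDeltas_mulL hh)
  rw [e, mul_assoc, ← e2, ← mul_assoc]
  exact isTraceClass_mul hermiteBasis ((hasDeltas_mulL hg).mem s hs1).1 hY

theorem isC1inf_of_hasCompactSupport {f : ℝ → ℂ} (hf : ContDiff ℝ ∞ f) (hc : HasCompactSupport f) : IsC1inf f := by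
  refine ⟨hf, fun k => ?_⟩
  have h : HasCompactSupport (iteratedDeriv k f) := by
    induction k with
    | zero => rwa [iteratedDeriv_zero]
    | succ k ih => rw [iteratedDeriv_succ]; exact ih.deriv
  exact (hf.continuous_iteratedDeriv k (by exact_mod_cast le_top)).integrable_of_hasCompactSupport h

/-- A bump function supported in the unit interval. -/
def unitBump : ContDiffBump (1 / 2 : ℝ) := ⟨1 / 8, 1 / 4, by norm_num, by norm_num⟩

theorem unitBump_eq_zero {x : ℝ} (hx : x ≤ 0 ∨ 1 ≤ x) : unitBump x = 0 := by
  refine unitBump.zero_of_le_dist ?_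
  rw [Real.dist_eq]
  change (1 / 4 : ℝ) ≤ _
  rcases hx with h | h
  · rw [abs_of_neg (by linarith)]; linarith
  · rw [abs_of_pos (by linarith)]; linarith

/-- The rescaled bump functions `x ↦ c h(M x - j)`. -/
theorem exists_scaled_bump (c M j : ℝ) (hM : 0 < M) : ∃ φ : 𝓢(ℝ, ℂ),
    (∀ x, φ x = ((c * unitBump (M * x - j) : ℝ) : ℂ)) ∧
    ∀ x, deriv φ x = ((c * M * deriv unitBump (M * x - j) : ℝ) : ℂ) := by
  have hcd : ContDiff ℝ ∞ fun x : ℝ => ((c * unitBump (M * x - j) : ℝ) : ℂ) := by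
    refine Complex.ofRealCLM.contDiff.comp (contDiff_const.mul (ContDiff.comp (g := unitBump) ?_ ?_))
    · exact unitBump.contDiff
    · exact (contDiff_const.mul contDiff_id).sub contDiff_const
  have hcs : HasCompactSupport fun x : ℝ => ((c * unitBump (M * x - j) : ℝ) : ℂ) := by
    refine HasCompactSupport.of_support_subset_isCompact (isCompact_Icc (a := j / M) (b := (j + 1) / M)) fun x hx => ?_
    by_contra h
    refine hx ?_
    have : unitBump (M * x - j) = 0 := by
      refine unitBump_eq_zero ?_
      by_contra! h2
      refine h ⟨?_, ?_⟩
      · rw [div_le_iff₀ hM]; linarith [h2.1]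
      · rw [le_div_iff₀ hM]; linarith [h2.2]
    simp only [this, mul_zero, Complex.ofReal_zero]
  refine ⟨hcs.toSchwartzMap hcd, fun x => rfl, fun x => ?_⟩
  change deriv (fun x : ℝ => ((c * unitBump (M * x - j) : ℝ) : ℂ)) x = _
  have h1 : HasDerivAt unitBump (deriv unitBump (M * x - j)) (M * x - j) :=
    ((unitBump.contDiff (n := 1)).differentiable (by simp) _).hasDerivAt
  have h2 : HasDerivAt (fun x : ℝ => M * x - j) M x := by
    simpa using ((hasDerivAt_id x).const_mul M).sub_const j
  have h3 := ((h1.comp x h2).const_mul c).ofReal_comp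
  refine h3.deriv.trans ?_
  congr 1
  ring

theorem integral_scaled (g : ℝ → ℝ) {M : ℝ} (hM : 0 < M) (j : ℝ) : ∫ x, g (M * x - j) = M⁻¹ * ∫ x, g x := by
  have h := Measure.integral_comp_mul_left (fun y => g (y - j)) M
  rw [integral_sub_right_eq_self, abs_of_pos (inv_pos.2 hM), smul_eq_mul] at h
  exact h

theorem integral_sq_pos {f : ℝ → ℝ} (hf : Continuous f) (hc : HasCompactSupport f) {x : ℝ} (hx : f x ≠ 0) :
    0 < ∫ y, f y ^ 2 := by
  have h1 : Continuous fun y => f y ^ 2 := hf.pow 2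
  have h2 : HasCompactSupport fun y => f y ^ 2 := by
    refine hc.mono' fun y hy => subset_tsupport f ?_
    intro h
    exact hy (by simp [h])
  have h3 : 0 ≤ fun y => f y ^ 2 := fun y => sq_nonneg (f y)
  have h4 : (fun y => f y ^ 2) x ≠ 0 := pow_ne_zero 2 hx
  exact h1.integral_pos_of_hasCompactSupport_nonneg_nonzero h2 h3 h4

theorem unitBump_half_ne_zero : unitBump (1 / 2) ≠ 0 := by
  rw [unitBump.one_of_mem_closedBall (Metric.mem_closedBall_self unitBump.rIn_pos.le)]
  exact one_ne_zero

theorem norm_sq_oscAdjSchwartz_le {φ : 𝓢(ℝ, ℂ)} (hφ : ∀ x, x ∉ Set.Icc (0 : ℝ) 1 → φ x = 0) :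
    ‖schwartzToL2 (oscAdjSchwartz φ)‖ ^ 2 ≤ 2 * (∫ x, ‖deriv φ x‖ ^ 2) + 2 * ‖schwartzToL2 φ‖ ^ 2 := by
  rw [← integral_norm_sq_schwartz, ← integral_norm_sq_schwartz, ← integral_const_mul, ← integral_const_mul]
  have i1 : Integrable fun x => ‖φ x‖ ^ 2 :=
    (memLp_two_iff_integrable_sq_norm φ.continuous.aestronglyMeasurable).1 (φ.memLp 2 volume)
  have e : ∀ x, SchwartzMap.derivCLM ℂ ℂ φ x = deriv φ x := fun x => SchwartzMap.derivCLM_apply ℂ φ x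
  have i2 : Integrable fun x => ‖deriv φ x‖ ^ 2 := by
    simpa only [e] using (memLp_two_iff_integrable_sq_norm
      (SchwartzMap.derivCLM ℂ ℂ φ).continuous.aestronglyMeasurable).1
      ((SchwartzMap.derivCLM ℂ ℂ φ).memLp 2 volume)
  have i3 : Integrable fun x => ‖oscAdjSchwartz φ x‖ ^ 2 :=
    (memLp_two_iff_integrable_sq_norm (oscAdjSchwartz φ).continuous.aestronglyMeasurable).1
      ((oscAdjSchwartz φ).memLp 2 volume)
  rw [← integral_add (i2.const_mul 2) (i1.const_mul 2)]
  refine integral_mono i3 ((i2.const_mul 2).add (i1.const_mul 2)) fun x => ?_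
  have h1 : ‖(x : ℂ) * φ x‖ ≤ ‖φ x‖ := by
    by_cases hx : x ∈ Set.Icc (0 : ℝ) 1
    · rw [norm_mul, Complex.norm_real, Real.norm_of_nonneg hx.1]
      exact mul_le_of_le_one_left (norm_nonneg _) hx.2
    · rw [hφ x hx, mul_zero]
  have h2 : ‖oscAdjSchwartz φ x‖ ≤ ‖deriv φ x‖ + ‖φ x‖ := by
    rw [oscAdjSchwartz_apply]
    exact (norm_add_le _ _).trans (add_le_add (norm_neg _).le h1)
  have h3 := pow_le_pow_left₀ (norm_nonneg _) h2 2
  simp only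
  nlinarith [sq_nonneg (‖deriv φ x‖ - ‖φ x‖)]

/-- Orthonormal families of `M` bump functions in the unit interval, with derivatives of size `M`. -/
theorem exists_orthonormal_bumps : ∃ K : ℝ, 0 < K ∧ ∀ M : ℕ, 0 < M → ∃ φ : Fin M → 𝓢(ℝ, ℂ),
    Orthonormal ℂ (fun i => schwartzToL2 (φ i)) ∧ (∀ i x, x ∉ Set.Icc (0 : ℝ) 1 → φ i x = 0) ∧
    ∀ i, ‖schwartzToL2 (oscAdjSchwartz (φ i))‖ ^ 2 ≤ K * M ^ 2 := by
  set κ : ℝ := ∫ x, unitBump x ^ 2 with hκ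
  set κ' : ℝ := ∫ x, deriv unitBump x ^ 2 with hκ'
  have hbc : Continuous unitBump := unitBump.continuous
  have hκ0 : 0 < κ := integral_sq_pos hbc unitBump.hasCompactSupport (x := 1 / 2) unitBump_half_ne_zero
  have hκ'0 : 0 ≤ κ' := integral_nonneg fun _ => sq_nonneg _
  -- After normalisation a bump has derivative energy M²κ'/κ. The term x φ contributes at most 1 ≤
  -- M², as the support lies in [0, 1].
  refine ⟨2 * (κ' / κ + 1), by positivity, fun M hM => ?_⟩
  have hM0 : (0 : ℝ) < M := by exact_mod_cast hM
  have hM1 : (1 : ℝ) ≤ M := by exact_mod_cast hM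
  set c : ℝ := Real.sqrt (M / κ) with hc
  have hc2 : c ^ 2 = M / κ := Real.sq_sqrt (by positivity)
  choose φ hφ hφ' using fun j : Fin M => exists_scaled_bump c M (j : ℕ) hM0
  have hsupp : ∀ i x, φ i x ≠ 0 → ((i : ℕ) : ℝ) < M * x ∧ M * x < (i : ℕ) + 1 := by
    intro i x h
    rw [hφ] at h
    by_contra h2
    refine h ?_
    rw [unitBump_eq_zero, mul_zero, Complex.ofReal_zero]
    by_contra! h3
    exact h2 ⟨by linarith [h3.1], by linarith [h3.2]⟩
  have hsupp' : ∀ i x, x ∉ Set.Icc (0 : ℝ) 1 → φ i x = 0 := by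
    intro i x hx
    by_contra h
    obtain ⟨h1, h2⟩ := hsupp i x h
    have h3 : ((i : ℕ) : ℝ) + 1 ≤ M := by exact_mod_cast i.2
    have h4 : (0 : ℝ) ≤ (i : ℕ) := Nat.cast_nonneg _
    refine hx ⟨?_, ?_⟩
    · by_contra! h; nlinarith
    · by_contra! h; nlinarith
  have hnorm : ∀ i, ‖schwartzToL2 (φ i)‖ ^ 2 = 1 := by
    intro i
    rw [← integral_norm_sq_schwartz]
    have : ∀ x, ‖φ i x‖ ^ 2 = c ^ 2 * unitBump (M * x - (i : ℕ)) ^ 2 := fun x => by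
      rw [hφ, Complex.norm_real, Real.norm_eq_abs, sq_abs]; ring
    simp only [this]
    rw [integral_const_mul, integral_scaled (fun y => unitBump y ^ 2) hM0, ← hκ, hc2]
    field_simp
  refine ⟨φ, ⟨fun i => ?_, fun i j hij => ?_⟩, hsupp', fun i => ?_⟩
  · exact (pow_eq_one_iff_of_nonneg (norm_nonneg _) two_ne_zero).1 (hnorm i)
  · change inner ℂ (schwartzToL2 (φ i)) (schwartzToL2 (φ j)) = 0
    rw [inner_schwartzToL2]
    refine integral_eq_zero_of_ae (Filter.Eventually.of_forall fun x => ?_)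
    by_contra h
    have hi : φ i x ≠ 0 := fun h0 => h (by simp [h0])
    have hj : φ j x ≠ 0 := fun h0 => h (by simp [h0])
    obtain ⟨h1, h2⟩ := hsupp i x hi
    obtain ⟨h3, h4⟩ := hsupp j x hj
    have h5 : ((i : ℕ) : ℝ) < (j : ℕ) + 1 := by linarith
    have h6 : ((j : ℕ) : ℝ) < (i : ℕ) + 1 := by linarith
    have h7 : (i : ℕ) < (j : ℕ) + 1 := by exact_mod_cast h5
    have h8 : (j : ℕ) < (i : ℕ) + 1 := by exact_mod_cast h6
    exact hij (Fin.ext (by omega))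
  · refine (norm_sq_oscAdjSchwartz_le (hsupp' i)).trans ?_
    rw [hnorm]
    have hd : ∀ x, ‖deriv (φ i) x‖ ^ 2 = (c * M) ^ 2 * deriv unitBump (M * x - (i : ℕ)) ^ 2 := fun x => by
      rw [hφ', Complex.norm_real, Real.norm_eq_abs, sq_abs]; ring
    simp only [hd]
    rw [integral_const_mul, integral_scaled (fun y => deriv unitBump y ^ 2) hM0, ← hκ', mul_pow, hc2]
    have : 2 * (↑M / κ * ↑M ^ 2 * ((↑M : ℝ)⁻¹ * κ')) = 2 * (κ' / κ) * M ^ 2 := by field_simp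
    rw [this]
    nlinarith

theorem inner_hermiteBasis_oscAdjSchwartz (φ : 𝓢(ℝ, ℂ)) (n : ℕ) :
    inner ℂ (hermiteBasis (n + 1)) (schwartzToL2 (oscAdjSchwartz φ))
      = (lam n : ℂ) * inner ℂ (hermiteBasis n) (schwartzToL2 φ) := by
  rw [hermiteBasis_apply, hermiteBasis_apply, ← inner_oscSchwartz_left, oscSchwartz_hermiteFun, map_smul,
    inner_smul_left, Complex.conj_ofReal, shiftWeight_succ, Nat.add_sub_cancel]

/-- For a cutoff equal to 1 on [0, 1] and M orthonormal bumps supported there, each diagonal entry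
is at least a constant times M⁻ˢ. The sum grows like M^(1−s), whereas diagonal sums of a trace class
operator are bounded, so s < 1 is impossible. -/
theorem one_le_of_isTraceClass {s : ℝ} (hs0 : 0 < s)
    (h : ∀ a : C1inf, IsTraceClass (oscRep a * negPow (angleSq osc) s)) : 1 ≤ s := by
  let χ : ContDiffBump (0 : ℝ) := ⟨1, 2, by norm_num, by norm_num⟩
  let a : C1inf := ⟨fun x => ((χ x : ℝ) : ℂ), isC1inf_of_hasCompactSupport
    (Complex.ofRealCLM.contDiff.comp χ.contDiff) (χ.hasCompactSupport.comp_left (g := fun y : ℝ => (y : ℂ)) (by simp))⟩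
  obtain ⟨C, hC⟩ := exists_sum_re_inner_le hermiteBasis (h a)
  obtain ⟨K, hK, hbump⟩ := exists_orthonormal_bumps
  by_contra! hs1
  have key : ∀ M : ℕ, 0 < M → 1 / 2 * (2 * K) ^ (-(s / 2)) * (M : ℝ) ^ (1 - s) ≤ C := by
    intro M hM
    have hM0 : (0 : ℝ) < M := by exact_mod_cast hM
    obtain ⟨φ, hφ, hsupp, hd⟩ := hbump M hM
    have hfix : ∀ i, star (oscRep a) (schwartzToL2 (φ i)) = schwartzToL2 (φ i) := by
      intro i
      rw [← map_star]
      refine Lp.ext ?_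
      filter_upwards [mulOp_apply (star a) (schwartzToL2 (φ i)), schwartzToL2_coe (φ i)] with x h1 h2
      refine h1.trans ?_
      rw [h2]
      by_cases hx : x ∈ Set.Icc (0 : ℝ) 1
      · have h3 : χ x = 1 := χ.one_of_mem_closedBall (by
          rw [Metric.mem_closedBall, Real.dist_eq, sub_zero, abs_of_nonneg hx.1]; exact hx.2)
        change star (((χ x : ℝ) : ℂ)) * _ = _
        rw [h3]
        simp
      · rw [hsupp i x hx, mul_zero]
    have hterm : ∀ i, 1 / 2 * (2 * (K * M ^ 2)) ^ (-(s / 2)) ≤ (inner ℂ (schwartzToL2 (φ i))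
        ((oscRep a * negPow (angleSq osc) s) (schwartzToL2 (φ i)))).re := by
      intro i
      have e : inner ℂ (schwartzToL2 (φ i)) ((oscRep a * negPow (angleSq osc) s) (schwartzToL2 (φ i)))
          = inner ℂ (schwartzToL2 (φ i)) (negPow (angleSq osc) s (schwartzToL2 (φ i))) := by
        conv_rhs => rw [← hfix i]
        rw [ContinuousLinearMap.star_eq_adjoint, ContinuousLinearMap.adjoint_inner_left,
          ← ContinuousLinearMap.star_eq_adjoint, hfix i]
        rfl
      rw [e]
      exact half_rpow_le_re_inner_negPow isDiag_angleSq_osc hs0.le (hφ.1 i)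
        (inner_hermiteBasis_oscAdjSchwartz (φ i)) (by positivity) (hd i)
    have hsum := Finset.card_nsmul_le_sum Finset.univ _ _ fun i _ => hterm i
    rw [Finset.card_univ, Fintype.card_fin, nsmul_eq_mul] at hsum
    refine le_trans (le_of_eq ?_) (hsum.trans (hC M _ hφ))
    have e1 : (2 * (K * (M : ℝ) ^ 2)) ^ (-(s / 2)) = (2 * K) ^ (-(s / 2)) * (M : ℝ) ^ (-s) := by
      rw [← mul_assoc, Real.mul_rpow (by positivity) (by positivity), ← Real.rpow_natCast (M : ℝ),
        ← Real.rpow_mul hM0.le]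
      congr 2
      push_cast
      ring
    rw [e1, sub_eq_add_neg, Real.rpow_add hM0, Real.rpow_one]
    ring
  have ht : Filter.Tendsto (fun M : ℕ => 1 / 2 * (2 * K) ^ (-(s / 2)) * (M : ℝ) ^ (1 - s)) Filter.atTop Filter.atTop :=
    ((tendsto_rpow_atTop (by linarith : 0 < 1 - s)).comp tendsto_natCast_atTop_atTop).const_mul_atTop (by positivity)
  obtain ⟨M, hM, hM0⟩ := ((ht.eventually_gt_atTop C).and (Filter.eventually_gt_atTop 0)).exists
  exact absurd (key M hM0) (not_le.2 hM)

theorem hasSpectralDimension_osc : HasSpectralDimension oscRep osc 1 := by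
  refine ⟨⟨2, two_pos, fun a => isTraceClass_oscRep_mul_negPow a one_lt_two le_rfl⟩, ?_, ?_⟩
  · rintro s ⟨hs0, hs⟩
    exact one_le_of_isTraceClass hs0 fun a => (isTraceClass_abs_mul _ _).1 (hs a)
  · intro t ht
    refine le_of_forall_gt_imp_ge_of_dense fun s hs => ?_
    rcases le_or_gt s 2 with h2 | h2
    · exact ht ⟨by linarith, fun a => (isTraceClass_abs_mul _ _).2 (isTraceClass_oscRep_mul_negPow a hs h2)⟩
    -- Trace class was established only up to exponent 2, but a lower bound t ≤ 2 already suffices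
    -- for s > 2.
    · refine le_trans (ht ⟨two_pos, fun a => (isTraceClass_abs_mul _ _).2
        (isTraceClass_oscRep_mul_negPow a one_lt_two le_rfl)⟩) h2.le

theorem isSmoothlySummable_osc : IsSmoothlySummable oscRep osc 1 :=
  ⟨hasSpectralDimension_osc, iteratedCommutators_subset⟩

/-! ### Compactness -/

section Abstract

variable {H : Type*} [NormedAddCommGroup H] [InnerProductSpace ℂ H] [CompleteSpace H]
variable {b : HilbertBasis ℕ ℂ H} {N D : H →ₗ.[ℂ] H}

theorem norm_le_of_diag {T : H →L[ℂ] H} {w : ℕ → ℂ} (hT : ∀ n, T (b n) = w n • b n) {C : ℝ}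
    (hw : ∀ n, ‖w n‖ ≤ C) : ‖T‖ ≤ C := by
  have hC : 0 ≤ C := (norm_nonneg _).trans (hw 0)
  refine ContinuousLinearMap.opNorm_le_bound _ hC fun x => ?_
  refine abs_le_of_sq_le_sq' ?_ (by positivity) |>.2
  rw [mul_pow]
  refine hasSum_le (fun n => ?_) (norm_sq_eq_tsum b (T x)) ((norm_sq_eq_tsum b x).mul_left (C ^ 2))
  rw [inner_diag_apply b hT, norm_mul, mul_pow]
  gcongr
  exact hw n

theorem isCompactOperator_of_diag {T : H →L[ℂ] H} {w : ℕ → ℂ} (hT : ∀ n, T (b n) = w n • b n)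
    (hw : Filter.Tendsto w Filter.atTop (nhds 0)) : IsCompactOperator T := by
  let F : ℕ → H →L[ℂ] H := fun k => ∑ n ∈ Finset.range k, (innerSL ℂ (b n)).smulRight (w n • b n)
  have hF : ∀ k, IsCompactOperator (F k) := fun k => by
    refine Submodule.sum_mem (compactOperator (RingHom.id ℂ) H H) fun n _ => ?_
    exact ((isCompactOperator_id (E := ℂ)).clm_comp (ContinuousLinearMap.toSpanSingleton ℂ (w n • b n))).comp_clm
      (innerSL ℂ (b n))
  have hFb : ∀ k n, F k (b n) = (if n < k then w n else 0) • b n := fun k n => by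
    simp only [F, sum_apply, ContinuousLinearMap.smulRight_apply, innerSL_apply_apply,
      inner_basis]
    simp [ite_smul]
  refine isCompactOperator_of_tendsto (F := F) (l := Filter.atTop) ?_ (Filter.Eventually.of_forall hF)
  rw [Metric.tendsto_atTop] at hw ⊢
  intro ε hε
  obtain ⟨K, hK⟩ := hw (ε / 2) (by positivity)
  refine ⟨K, fun k hk => ?_⟩
  rw [dist_eq_norm]
  refine (norm_le_of_diag (b := b) (w := fun n => (if n < k then w n else 0) - w n) (fun n => ?_)
    (fun n => ?_)).trans_lt (half_lt_self hε)
  · rw [sub_apply, hFb, hT, sub_smul]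
  · split_ifs with h
    · rw [sub_self, norm_zero]; positivity
    · have := (hK n (hk.trans (not_lt.1 h))).le
      rwa [dist_zero_right, ← norm_neg, ← zero_sub] at this

theorem tendsto_lam : Filter.Tendsto lam Filter.atTop Filter.atTop :=
  Real.tendsto_sqrt_atTop.comp (Filter.tendsto_atTop_add_const_right _ _
    (tendsto_natCast_atTop_atTop.const_mul_atTop (by norm_num)))

/-- The eigenvalues of `(1 + N)^(-1/2)`, where `N` has the eigenvalues `2 n + 1`. -/
def invLam (n : ℕ) : ℂ := ((lam n)⁻¹ : ℝ)

theorem norm_invLam_le_one (n : ℕ) : ‖invLam n‖ ≤ 1 := by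
  rw [invLam, Complex.norm_real, Real.norm_of_nonneg (inv_nonneg.2 (lam_pos n).le)]
  exact inv_le_one_of_one_le₀ (one_le_lam n)

theorem negPow_one_apply (hN : IsDiag b N fun n => 2 * n + 1) (n : ℕ) :
    negPow N 1 (b n) = invLam n • b n := by
  rw [negPow_apply hN zero_le_one, Real.rpow_neg_one, invLam]

theorem negPow_two_apply (hN : IsDiag b N fun n => 2 * n + 1) (n : ℕ) :
    negPow N 2 (b n) = (invLam n * invLam n : ℂ) • b n := by
  rw [negPow_apply hN zero_le_two, Real.rpow_neg (lam_pos n).le, Real.rpow_two, invLam,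
    ← Complex.ofReal_mul, sq, mul_inv]

theorem isCompactOperator_negPow_one (hN : IsDiag b N fun n => 2 * n + 1) : IsCompactOperator (negPow N 1) := by
  refine isCompactOperator_of_diag (negPow_one_apply hN) ?_
  rw [← Complex.ofReal_zero]
  exact (Complex.continuous_ofReal.tendsto 0).comp (tendsto_inv_atTop_zero.comp tendsto_lam)

variable (b) in
theorem exists_shift (d : ℤ) (f : ℕ → ℕ) (w : ℕ → ℂ) (C : ℝ) (hf : ∀ n, w n ≠ 0 → (f n : ℤ) = n + d)
    (hw : ∀ n, ‖w n‖ ≤ C) : ∃ T : H →L[ℂ] H, ∀ n, T (b n) = w n • b (f n) := by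
  have hC : 0 ≤ C := (norm_nonneg _).trans (hw 0)
  obtain ⟨T, hT⟩ := exists_clm_homogeneous b d (fun m n => if m = f n then w n else 0) C
    (fun m n h => by
      rw [ite_eq_right_iff]
      rintro rfl
      by_contra h1
      exact h (hf n h1))
    (fun m n => by
      split_ifs
      · exact hw n
      · rwa [norm_zero])
  refine ⟨T, fun n => basis_ext b fun m => ?_⟩
  rw [inner_smul_right, inner_basis]
  simpa [mat] using hT m n

/-- For a closed P the vectors x with (Ux, Vx) in its graph form a closed subspace. So PU = V,
including the claim that U maps everything into dom P, need only be checked on the basis. -/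
theorem mem_graph_of_basis {P : H →ₗ.[ℂ] H} (hP : P.IsClosed) {U V : H →L[ℂ] H}
    (h : ∀ n, (U (b n), V (b n)) ∈ P.graph) (x : H) : (U x, V x) ∈ P.graph := by
  let W : Submodule ℂ H := P.graph.comap (U.prod V : H →ₗ[ℂ] H × H)
  have hc : IsClosed (W : Set H) := hP.preimage (U.prod V).continuous
  have hd : Dense (W : Set H) := dense_of_basis_mem (b := b) h
  have : x ∈ (W : Set H) := by rw [← hc.closure_eq, hd.closure_eq]; trivial
  exact this

theorem IsLowering.basis_mem_graph {P : H →ₗ.[ℂ] H} (hP : IsLowering b P) (n : ℕ) :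
    (b n, (shiftWeight n : ℂ) • b (n - 1)) ∈ P.graph :=
  mem_graph_iff.2 ⟨hP.basis_mem n, hP.apply_basis n⟩

theorem IsRaising.basis_mem_graph {P : H →ₗ.[ℂ] H} (hP : IsRaising b P) (n : ℕ) :
    (b n, (shiftWeight (n + 1) : ℂ) • b (n + 1)) ∈ P.graph := by
  refine (hP _ _).2 fun m => ?_
  rw [inner_smul_right, inner_basis, inner_basis]
  rcases m with - | m
  · simp [shiftWeight_zero]
  · by_cases h : m = n
    · simp [h]
    · simp [h]

theorem norm_shiftWeight_mul_inv_le (m n : ℕ) (h : m ≤ n + 2) :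
    ‖(shiftWeight m * invLam n : ℂ)‖ ≤ 2 := by
  have h1 : shiftWeight m ≤ 2 * lam n := by
    have h2 := shiftWeight_sq m
    have h3 := lam_sq n
    have h4 : (m : ℝ) ≤ n + 2 := by exact_mod_cast h
    refine abs_le_of_sq_le_sq' ?_ (by have := lam_pos n; positivity) |>.2
    nlinarith [n.cast_nonneg (α := ℝ)]
  rw [invLam, ← Complex.ofReal_mul, Complex.norm_real,
    Real.norm_of_nonneg (mul_nonneg (shiftWeight_nonneg m) (inv_nonneg.2 (lam_pos n).le)),
    ← div_eq_mul_inv, div_le_iff₀ (lam_pos n)]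
  exact h1

/-- `R_D (1 + ⟨D⟩²)⁻¹` is a bounded operator, given on the basis by explicit weights. -/
theorem exists_remainder_mul_negPow (hD : IsLowering b D) (hDc : D.IsClosed)
    (hN : IsDiag b N fun n => 2 * n + 1) :
    ∃ B : H →L[ℂ] H, (∀ n, B (b n) = (invLam n * invLam n * (Complex.I / 2) : ℂ) •
      ((shiftWeight n * shiftWeight (n - 1) : ℂ) • b (n - 2)
        - (shiftWeight (n + 1) * shiftWeight (n + 2) : ℂ) • b (n + 2))) ∧
      AgreesOn (pcomp (remainder D) (ofBdd (negPow N 2))) ⊤ B := by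
  have hA := hD.adjoint
  have hAc : D.adjoint.IsClosed := LinearPMap.adjoint_isClosed (dense_of_basis_mem hD.basis_mem)
  -- The operators U₁, U₂, V₁, V₂ are DΛ⁻², D²Λ⁻², D*Λ⁻² and D*²Λ⁻², bounded since each ladder
  -- factor is paired with a Λ⁻¹.
  obtain ⟨U₁, hU₁⟩ := exists_shift b (-1) (fun n => n - 1) (fun n => shiftWeight n * invLam n * invLam n) 2
    (fun n h => by
      rcases n with - | n
      · simp [shiftWeight_zero] at h
      · push_cast; ring)
    (fun n => by
      rw [norm_mul]
      exact (mul_le_of_le_one_right (norm_nonneg _) (norm_invLam_le_one n)).trans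
        (norm_shiftWeight_mul_inv_le n n (by omega)))
  obtain ⟨U₂, hU₂⟩ := exists_shift b (-2) (fun n => n - 2)
    (fun n => shiftWeight n * invLam n * (shiftWeight (n - 1) * invLam n)) 4
    (fun n h => by
      rcases n with - | - | n
      · simp [shiftWeight_zero] at h
      · simp [shiftWeight_zero] at h
      · push_cast; ring)
    (fun n => by
      rw [norm_mul]
      have := norm_nonneg (shiftWeight n * invLam n : ℂ)
      nlinarith [norm_shiftWeight_mul_inv_le n n (by omega), norm_shiftWeight_mul_inv_le (n - 1) n (by omega)])
  obtain ⟨V₁, hV₁⟩ := exists_shift b 1 (fun n => n + 1) (fun n => shiftWeight (n + 1) * invLam n * invLam n) 2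
    (fun n h => by push_cast; rfl)
    (fun n => by
      rw [norm_mul]
      exact (mul_le_of_le_one_right (norm_nonneg _) (norm_invLam_le_one n)).trans
        (norm_shiftWeight_mul_inv_le (n + 1) n (by omega)))
  obtain ⟨V₂, hV₂⟩ := exists_shift b 2 (fun n => n + 2)
    (fun n => shiftWeight (n + 1) * invLam n * (shiftWeight (n + 2) * invLam n)) 4
    (fun n h => by push_cast; rfl)
    (fun n => by
      rw [norm_mul]
      have := norm_nonneg (shiftWeight (n + 1) * invLam n : ℂ)
      nlinarith [norm_shiftWeight_mul_inv_le (n + 1) n (by omega), norm_shiftWeight_mul_inv_le (n + 2) n (by omega)])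
  have g₁ := mem_graph_of_basis (b := b) hDc (U := negPow N 2) (V := U₁) fun n => by
    rw [negPow_two_apply hN, hU₁]
    convert! D.graph.smul_mem (invLam n * invLam n : ℂ) (hD.basis_mem_graph n) using 1
    rw [Prod.smul_mk, smul_smul]
    congr 2
    ring
  have g₂ := mem_graph_of_basis (b := b) hDc (U := U₁) (V := U₂) fun n => by
    rw [hU₁, hU₂]
    convert! D.graph.smul_mem (shiftWeight n * invLam n * invLam n : ℂ) (hD.basis_mem_graph (n - 1)) using 1
    rw [Prod.smul_mk, smul_smul, Nat.sub_sub]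
    congr 2
    ring
  have g₃ := mem_graph_of_basis (b := b) hAc (U := negPow N 2) (V := V₁) fun n => by
    rw [negPow_two_apply hN, hV₁]
    convert! D.adjoint.graph.smul_mem (invLam n * invLam n : ℂ) (hA.basis_mem_graph n) using 1
    rw [Prod.smul_mk, smul_smul]
    congr 2
    ring
  have g₄ := mem_graph_of_basis (b := b) hAc (U := V₁) (V := V₂) fun n => by
    rw [hV₁, hV₂]
    convert! D.adjoint.graph.smul_mem (shiftWeight (n + 1) * invLam n * invLam n : ℂ)
      (hA.basis_mem_graph (n + 1)) using 1
    rw [Prod.smul_mk, smul_smul, add_assoc]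
    congr 2
    ring
  refine ⟨(Complex.I / 2) • (U₂ - V₂), fun n => ?_, fun x _ => ?_⟩
  · rw [smul_apply, sub_apply, hU₂, hV₂]
    simp only [smul_sub, smul_smul]
    congr 2 <;> ring
  · obtain ⟨h₁, e₁⟩ := mem_graph_iff.1 (g₁ x)
    obtain ⟨h₂, e₂⟩ := mem_graph_iff.1 (g₂ x)
    obtain ⟨h₃, e₃⟩ := mem_graph_iff.1 (g₃ x)
    obtain ⟨h₄, e₄⟩ := mem_graph_iff.1 (g₄ x)
    have k₁ : D ⟨negPow N 2 x, h₁⟩ ∈ D.domain := by rwa [e₁]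
    have k₂ : D.adjoint ⟨negPow N 2 x, h₃⟩ ∈ D.adjoint.domain := by rwa [e₃]
    refine ⟨⟨trivial, ⟨h₁, k₁⟩, ⟨h₃, k₂⟩⟩, ?_⟩
    change (Complex.I / 2) • (D ⟨D ⟨negPow N 2 x, h₁⟩, k₁⟩ - D.adjoint ⟨D.adjoint ⟨negPow N 2 x, h₃⟩, k₂⟩) = _
    have r₁ : D ⟨D ⟨negPow N 2 x, h₁⟩, k₁⟩ = U₂ x := by rw [← e₂]; congr 2
    have r₂ : D.adjoint ⟨D.adjoint ⟨negPow N 2 x, h₃⟩, k₂⟩ = V₂ x := by rw [← e₄]; congr 2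
    rw [r₁, r₂]
    rfl

/-- `(D - D*) (1 + ⟨D⟩²)⁻¹` is compact. -/
theorem exists_compact_sub_adjoint_mul_negPow (hN : IsDiag b N fun n => 2 * n + 1) :
    ∃ C : H →L[ℂ] H, IsCompactOperator C ∧ ∀ n, C (b n) = (invLam n * invLam n : ℂ) •
      ((shiftWeight n : ℂ) • b (n - 1) - (shiftWeight (n + 1) : ℂ) • b (n + 1)) := by
  obtain ⟨U, hU⟩ := exists_shift b (-1) (fun n => n - 1) (fun n => shiftWeight n * invLam n) 2
    (fun n h => by
      rcases n with - | n
      · simp [shiftWeight_zero] at h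
      · push_cast; ring)
    (fun n => norm_shiftWeight_mul_inv_le n n (by omega))
  obtain ⟨V, hV⟩ := exists_shift b 1 (fun n => n + 1) (fun n => shiftWeight (n + 1) * invLam n) 2
    (fun n h => by push_cast; rfl) (fun n => norm_shiftWeight_mul_inv_le (n + 1) n (by omega))
  refine ⟨(U - V) * negPow N 1, (isCompactOperator_negPow_one hN).clm_comp (U - V), fun n => ?_⟩
  rw [mul_apply_eq_comp, negPow_one_apply hN, map_smul, sub_apply, hU, hV]
  simp only [smul_sub, smul_smul]
  congr 2 <;> ring

end Abstract

theorem mulL_sub {a c : ℝ → ℂ} (ha : MemLp a ∞ volume) (hc : MemLp c ∞ volume) :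
    mulL a - mulL c = mulL (a - c) := by
  ext f
  filter_upwards [mulL_apply ha f, mulL_apply hc f, mulL_apply (ha.sub hc) f, Lp.coeFn_sub (mulL a f) (mulL c f)]
    with x h1 h2 h3 h4
  rw [h3, sub_apply, h4, Pi.sub_apply, h1, h2, Pi.sub_apply, sub_mul]

/-- By 2x = D + D*, ladder operators acting on the function are traded for a factor x on the bounded
multiplier. -/
theorem mulL_id_mul_schwartz {a : ℝ → ℂ} (ha : MemLp a ∞ volume)
    (hxa : MemLp (fun x : ℝ => (x : ℂ) * a x) ∞ volume) (φ : 𝓢(ℝ, ℂ)) :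
    mulL (fun x : ℝ => (x : ℂ) * a x) (schwartzToL2 φ)
      = (1 / 2 : ℂ) • mulL a (schwartzToL2 (oscSchwartz φ + oscAdjSchwartz φ)) := by
  ext1
  filter_upwards [mulL_apply hxa (schwartzToL2 φ),
    mulL_apply ha (schwartzToL2 (oscSchwartz φ + oscAdjSchwartz φ)),
    Lp.coeFn_smul (1 / 2 : ℂ) (mulL a (schwartzToL2 (oscSchwartz φ + oscAdjSchwartz φ))),
    φ.coeFn_toLp 2 volume, (oscSchwartz φ + oscAdjSchwartz φ).coeFn_toLp 2 volume] with x h1 h2 h3 h4 h5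
  rw [h1, h3, Pi.smul_apply, h2]
  change _ * (φ.toLp 2 volume : ℝ → ℂ) x = _ • (_ * ((oscSchwartz φ + oscAdjSchwartz φ).toLp 2 volume : ℝ → ℂ) x)
  rw [h4, h5, add_apply, oscSchwartz_apply, oscAdjSchwartz_apply, smul_eq_mul]
  ring

theorem mulL_id_mul_hermiteBasis {a : ℝ → ℂ} (ha : MemLp a ∞ volume)
    (hxa : MemLp (fun x : ℝ => (x : ℂ) * a x) ∞ volume) (n : ℕ) :
    mulL (fun x : ℝ => (x : ℂ) * a x) (hermiteBasis n) = (1 / 2 : ℂ) •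
      ((shiftWeight n : ℂ) • mulL a (hermiteBasis (n - 1))
        + (shiftWeight (n + 1) : ℂ) • mulL a (hermiteBasis (n + 1))) := by
  simp only [hermiteBasis_apply]
  rw [mulL_id_mul_schwartz ha hxa, oscSchwartz_hermiteFun, oscAdjSchwartz_hermiteFun]
  simp only [map_add, map_smul]

theorem memLp_top_indicator {a : ℝ → ℂ} (ha : MemLp a ∞ volume) (m : ℕ) :
    MemLp ((Set.Icc (-m : ℝ) m).indicator a) ∞ volume := ha.indicator measurableSet_Icc

theorem memLp_top_id_mul_indicator {a : ℝ → ℂ} (ha : Continuous a) {C : ℝ} (hC : ∀ x, ‖a x‖ ≤ C) (m : ℕ) :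
    MemLp (fun x : ℝ => (x : ℂ) * (Set.Icc (-m : ℝ) m).indicator a x) ∞ volume := by
  refine memLp_top_of_bound (C := m * C) ?_ (Filter.Eventually.of_forall fun x => ?_)
  · exact Complex.continuous_ofReal.aestronglyMeasurable.mul
      (ha.aestronglyMeasurable.indicator measurableSet_Icc)
  · have hC0 : 0 ≤ C := (norm_nonneg _).trans (hC 0)
    by_cases h : x ∈ Set.Icc (-m : ℝ) m
    · rw [Set.indicator_of_mem h, norm_mul, Complex.norm_real]
      exact mul_le_mul (abs_le.2 h) (hC x) (norm_nonneg _) (Nat.cast_nonneg m)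
    · rw [Set.indicator_of_notMem h, mul_zero, norm_zero]
      positivity

/-- Integrability of a and a' forces a to vanish at ±∞, so the cutoffs converge uniformly, hence in
operator norm. -/
theorem IsC1inf.tendsto_mulL_indicator {a : ℝ → ℂ} (ha : IsC1inf a) :
    Filter.Tendsto (fun m : ℕ => mulL ((Set.Icc (-m : ℝ) m).indicator a)) Filter.atTop (nhds (mulL a)) := by
  obtain ⟨C, hC⟩ := ha.bounded 0
  simp only [iteratedDeriv_zero] at hC
  have hm : MemLp a ∞ volume := memLp_top_of_continuous ha.1.continuous hC
  have hd := ha.hasDerivAt 0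
  have hi := ha.2 0
  have hi' := ha.2 1
  rw [zero_add, iteratedDeriv_zero] at hd
  rw [iteratedDeriv_zero] at hi
  have t1 := tendsto_zero_of_hasDerivAt_of_integrableOn_Ioi (a := 0) (fun x _ => hd x) hi'.integrableOn
    hi.integrableOn
  have t2 := tendsto_zero_of_hasDerivAt_of_integrableOn_Iic (a := 0) (fun x _ => hd x) hi'.integrableOn
    hi.integrableOn
  rw [Metric.tendsto_atTop]
  intro ε hε
  obtain ⟨x₁, h₁⟩ := Filter.eventually_atTop.1 (Metric.tendsto_nhds.1 t1 (ε / 2) (by positivity))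
  obtain ⟨x₂, h₂⟩ := Filter.eventually_atBot.1 (Metric.tendsto_nhds.1 t2 (ε / 2) (by positivity))
  obtain ⟨M, hM⟩ := exists_nat_ge (max x₁ (-x₂))
  refine ⟨M, fun m hm' => ?_⟩
  have hMm : (M : ℝ) ≤ m := by exact_mod_cast hm'
  rw [dist_comm, dist_eq_norm, mulL_sub hm (memLp_top_indicator hm m)]
  refine (norm_mulL_le (hm.sub (memLp_top_indicator hm m)) (by positivity) (C := ε / 2) fun x => ?_).trans_lt
    (half_lt_self hε)
  rw [Pi.sub_apply]
  by_cases h : x ∈ Set.Icc (-m : ℝ) m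
  · rw [Set.indicator_of_mem h, sub_self, norm_zero]; positivity
  · rw [Set.indicator_of_notMem h, sub_zero]
    rw [Set.mem_Icc, not_and_or, not_le, not_le] at h
    rcases h with h | h
    · have := h₂ x (by linarith [le_max_right x₁ (-x₂)])
      rw [dist_zero_right] at this
      exact this.le
    · have := h₁ x (by linarith [le_max_left x₁ (-x₂)])
      rw [dist_zero_right] at this
      exact this.le

theorem resolvent_compact_osc (a : C1inf) : IsCompactOperator (oscRep a * negPow (angleSq osc) 1) :=
  (isCompactOperator_negPow_one isDiag_angleSq_osc).clm_comp (oscRep a)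

/-- R_D Λ⁻² by itself is only bounded, its weights tending to nonzero constants; compactness comes
from the decay of a. After cutting a off, x times the cutoff is bounded and one order of R_D is
gained. Compactness survives the norm limit. -/
theorem remainder_compact_osc (a : C1inf) : ∃ K : L2 →L[ℂ] L2, IsCompactOperator K ∧
    AgreesOn (pcomp (ofBdd (oscRep a)) (pcomp (remainder osc) (ofBdd (negPow (angleSq osc) 2)))) ⊤ K := by
  have hN := isDiag_angleSq_osc
  obtain ⟨B, hB, hBR⟩ := exists_remainder_mul_negPow isLowering_osc osc_isClosed hN
  obtain ⟨C, hCc, hC⟩ := exists_compact_sub_adjoint_mul_negPow hN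
  refine ⟨oscRep a * B, ?_, fun x hx => ?_⟩
  · have ha : IsC1inf a := a.2
    obtain ⟨c, hc⟩ := ha.bounded 0
    simp only [iteratedDeriv_zero] at hc
    have hm : MemLp (a : ℝ → ℂ) ∞ volume := memLp_top_of_continuous ha.1.continuous hc
    rw [oscRep_eq_mulL]
    refine isCompactOperator_of_tendsto (ha.tendsto_mulL_indicator.mul_const B)
      (Filter.Eventually.of_forall fun m => ?_)
    have h1 := memLp_top_indicator hm m
    have h2 := memLp_top_id_mul_indicator ha.1.continuous hc m
    set g := (Set.Icc (-m : ℝ) m).indicator (a : ℝ → ℂ) with hg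
    -- From D² − D*² = (D + D*)(D − D*) + 2 and D + D* = 2x one gets R_D = i x(D − D*) + i. Here `C`
    -- is (D − D*)Λ⁻².
    have e : mulL g * B = Complex.I • (mulL (fun x : ℝ => (x : ℂ) * g x) * C)
        + Complex.I • (mulL g * negPow (angleSq osc) 1 * negPow (angleSq osc) 1) := by
      refine clm_ext_basis hermiteBasis fun n => ?_
      simp only [add_apply, smul_apply, mul_apply_eq_comp]
      rw [hB, hC]
      simp only [negPow_one_apply hN, map_smul, map_sub]
      rw [mulL_id_mul_hermiteBasis h1 h2, mulL_id_mul_hermiteBasis h1 h2, Nat.sub_sub, add_assoc]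
      have e1 : (shiftWeight n : ℂ) * shiftWeight (n - 1 + 1) = 2 * n := by
        rcases n with - | n
        · simp [shiftWeight_zero]
        · rw [Nat.add_sub_cancel, shiftWeight_mul_self]
      have e2 : mulL g (hermiteBasis (n - 1 + 1)) = mulL g (hermiteBasis n) ∨ n = 0 := by
        rcases n with - | n
        · exact Or.inr rfl
        · exact Or.inl (by rw [Nat.add_sub_cancel])
      have e3 := shiftWeight_mul_self (n + 1)
      push_cast at e3
      rw [Nat.add_sub_cancel]
      have e4 : (shiftWeight n * shiftWeight (n - 1 + 1) : ℂ) • mulL g (hermiteBasis (n - 1 + 1))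
          = (2 * n : ℂ) • mulL g (hermiteBasis n) := by
        rcases e2 with h | h
        · rw [h, e1]
        · simp [h, shiftWeight_zero]
      have e5 := congrArg (fun c : ℂ => c • mulL g (hermiteBasis n)) e3
      linear_combination (norm := module) (-(Complex.I / 2 * (invLam n * invLam n)) : ℂ) • e4
        + (Complex.I / 2 * (invLam n * invLam n) : ℂ) • e5
    rw [e]
    exact ((hCc.clm_comp (mulL fun x : ℝ => (x : ℂ) * g x)).smul Complex.I).add
      (((isCompactOperator_negPow_one hN).clm_comp (mulL g * negPow (angleSq osc) 1)).smul Complex.I)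
  · obtain ⟨h, e⟩ := hBR x hx
    refine ⟨⟨h, trivial⟩, ?_⟩
    change oscRep a (pcomp (remainder osc) (ofBdd (negPow (angleSq osc) 2)) ⟨x, h⟩) = _
    rw [e]
    rfl

theorem isPseudoRiemannianTriple_osc : IsPseudoRiemannianTriple oscRep osc where
  dense_domain := dense_domain_osc
  isClosed := osc_isClosed
  essentiallySelfAdjoint := isLowering_osc.preAngleSq_isDiag.isEssentiallySelfAdjoint
  remainder_mapsTo := remainder_mapsTo_smoothVectors isLowering_osc
  comm_remainder := comm_remainder_mem_OP isLowering_osc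
  remainder_compact := remainder_compact_osc
  comm_bounded := comm_osc_bounded
  comm_adjoint_bounded := comm_osc_adjoint_bounded
  resolvent_compact := resolvent_compact_osc

end PRST

end

theorem proposition4p13 :
    PRST.IsPseudoRiemannianTriple PRST.oscRep PRST.osc ∧
    PRST.IsSmoothlySummable PRST.oscRep PRST.osc 1 :=
  ⟨PRST.isPseudoRiemannianTriple_osc, PRST.isSmoothlySummable_osc⟩
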